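/- Let $\pi:(M^3,g)\to(N^2,h)$ be a Riemannian submersion between smooth Riemannian manifolds of dimensions $3$ and $2$. Let $U\subseteq M$ and $V\subseteq N$ be open with $\pi(U)\subseteq V$ (for instance $U=M$, $V=N$). Let $\{e_1,e_2,e_3\}$ be a smooth orthonormal frame on $U$ adapted to $\pi$: $e_3$ is vertical, and $e_1,e_2$ are $\pi$-related to the members of a smooth orthonormal frame $\{\varepsilon_1,\varepsilon_2\}$ on $V$. Let $F_1,F_2\in C^\infty(V)$ and $\kappa_1,\kappa_2,\sigma\in C^\infty(U)$ be the functions with $$[\varepsilon_1,\varepsilon_2]=F_1\varepsilon_1+F_2\varepsilon_2,\quad [e_1,e_3]=\kappa_1e_3,\quad [e_2,e_3]=\kappa_2e_3,\quad [e_1,e_2]=f_1e_1+f_2e_2-2\sigma e_3,$$ where $f_i=F_i\circ\pi$. Assume that $\kappa_2=0$ on $U$. Then $\pi$ is biharmonic on $U$ if and only if $$-\Delta^M\kappa_1+\kappa_1\left(-K^N\circ\pi+f_1^2+f_2^2\right)=0,$$ $$f_1e_1(\kappa_1)+e_1(\kappa_1f_1)+f_2e_2(\kappa_1)+e_2(\kappa_1f_2)-\kappa_1^2f_1=0$$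 hold on $U$. Here $\Delta^M=\operatorname{div}\operatorname{grad}$ is the Laplace–Beltrami operator of $(M,g)$ and $K^N$ is the Gauss curvature of $(N,h)$. A smooth map $\varphi:M\to N$ is called biharmonic on $U$ if for every compact $\Omega\subseteq U$ it is a critical point of the bienergy $E^2(\varphi,\Omega)=\frac12\int_\Omega|\tau(\varphi)|^2\,dx$, where $\tau(\varphi)=\operatorname{Trace}_g\nabla d\varphi$ is the tension field; that is, $\frac{d}{dt}\big|_{t=0}E^2(\varphi_t,\Omega)=0$ for every smooth variation $(\varphi_t)_{t\in\mathbb R}$ of $\varphi_0=\varphi$ with $\varphi_t=\varphi$ outside $\Omega$ for all $t$. -/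

import Mathlib

open Bundle
open scoped Manifold ContDiff

namespace RiemSubm

noncomputable section

/-! ### Local Riemannian geometry in charts

`M` is a smooth `m`-dimensional manifold whose tangent bundle carries a Riemannian metric.
Geometric objects are computed in the preferred chart `extChartAt (𝓡 m) p` at a point `p : M`;
the variable `u` denotes a point of the coordinate space. -/

section Chart

variable {m : ℕ} {M : Type*} [TopologicalSpace M] [ChartedSpace (EuclideanSpace ℝ (Fin m)) M]

/-- The `i`-th partial derivative `∂ᵢ F (u)`. -/
def pderiv (i : Fin m) (F : EuclideanSpace ℝ (Fin m) → ℝ) (u : EuclideanSpace ℝ (Fin m)) : ℝ :=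
  fderiv ℝ F u (EuclideanSpace.single i 1)

/-- The coordinate vector field `∂ᵢ` of the chart at `p`, at the point with coordinates `u`. -/
def coordVec (p : M) (u : EuclideanSpace ℝ (Fin m)) (i : Fin m) :
    TangentSpace (𝓡 m) ((extChartAt (𝓡 m) p).symm u) :=
  mfderiv (𝓡 m) (𝓡 m) (extChartAt (𝓡 m) p).symm u
    (EuclideanSpace.single i 1 : EuclideanSpace ℝ (Fin m))

variable [RiemannianBundle (fun x : M => TangentSpace (𝓡 m) x)]

/-- The coefficients `gᵢⱼ = ⟨∂ᵢ, ∂ⱼ⟩` of the metric in the chart at `p`. -/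
def metricMatrix (p : M) (u : EuclideanSpace ℝ (Fin m)) : Matrix (Fin m) (Fin m) ℝ :=
  Matrix.of fun i j => inner ℝ (coordVec p u i) (coordVec p u j)

/-- The Christoffel symbols of the Levi-Civita connection in the chart at `p`,
`Γᵏᵢⱼ = ½ ∑ₗ gᵏˡ (∂ᵢ gⱼₗ + ∂ⱼ gᵢₗ - ∂ₗ gᵢⱼ)`. -/
def christoffel (p : M) (u : EuclideanSpace ℝ (Fin m)) (k i j : Fin m) : ℝ :=
  (1 / 2) * ∑ l, (metricMatrix p u)⁻¹ k l *
    (pderiv i (fun w => metricMatrix p w j l) u + pderiv j (fun w => metricMatrix p w i l) u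
      - pderiv l (fun w => metricMatrix p w i j) u)

/-- The Laplace-Beltrami operator, in the chart at `p`:
`Δ f = ∑ᵢⱼ gⁱʲ (∂ᵢ∂ⱼ f - ∑ₖ Γᵏᵢⱼ ∂ₖ f)`, evaluated at `x`. -/
def laplacianIn (p : M) (f : M → ℝ) (x : M) : ℝ :=
  let u := extChartAt (𝓡 m) p x
  let F := fun w => f ((extChartAt (𝓡 m) p).symm w)
  ∑ i, ∑ j, (metricMatrix p u)⁻¹ i j *
    (pderiv i (pderiv j F) u - ∑ k, christoffel p u k i j * pderiv k F u)

/-- The Laplace-Beltrami operator `Δ f` (the value does not depend on the chart). -/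
def laplacian (f : M → ℝ) (x : M) : ℝ :=
  laplacianIn (m := m) x f x

/-- The components `Rˡ` of `R(∂ᵢ, ∂ⱼ)∂ₖ = ∑ₗ Rˡ ∂ₗ` in the chart at `p`, where
`R(X, Y)Z = ∇_X ∇_Y Z - ∇_Y ∇_X Z - ∇_[X,Y] Z`. -/
def curvatureCoeff (p : M) (u : EuclideanSpace ℝ (Fin m)) (i j k l : Fin m) : ℝ :=
  pderiv i (fun w => christoffel p w l j k) u - pderiv j (fun w => christoffel p w l i k) u
    + ∑ s, (christoffel p u l i s * christoffel p u s j k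
      - christoffel p u l j s * christoffel p u s i k)

/-- The Riemannian measure in the chart at `p`: it is `√(det g) du` on the coordinate domain,
transported to `M`. -/
def chartVolume [MeasurableSpace M] (p : M) : MeasureTheory.Measure M :=
  ((MeasureTheory.volume.restrict (extChartAt (𝓡 m) p).target).withDensity
    (fun u => ENNReal.ofReal (Real.sqrt (metricMatrix p u).det))).map (extChartAt (𝓡 m) p).symm

end Chart

theorem exists_chart_cover {m : ℕ} (M : Type*) [TopologicalSpace M]
    [ChartedSpace (EuclideanSpace ℝ (Fin m)) M] [SecondCountableTopology M] [Nonempty M] :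
    ∃ c : ℕ → M, ⋃ n, (extChartAt (𝓡 m) (c n)).source = Set.univ := by
  obtain ⟨s, hs, hU⟩ := TopologicalSpace.countable_cover_nhds
    (fun x : M => extChartAt_source_mem_nhds (I := 𝓡 m) x)
  have hne : s.Nonempty := by
    by_contra h
    rw [Set.not_nonempty_iff_eq_empty] at h
    subst h
    obtain ⟨x⟩ := ‹Nonempty M›
    have : x ∈ (Set.univ : Set M) := trivial
    rw [← hU] at this
    simp at this
  obtain ⟨c, rfl⟩ := hs.exists_eq_range hne
  exact ⟨c, by simpa using hU⟩

open Classical in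
/-- The Riemannian volume measure: cover `M` by the domains of countably many charts, cut `M` into
the pieces that lie in the `n`-th but in no earlier domain, and measure each piece in its chart.
By the change of variables formula the result does not depend on the cover. -/
def riemannianVolume (m : ℕ) (M : Type*) [TopologicalSpace M]
    [ChartedSpace (EuclideanSpace ℝ (Fin m)) M] [SecondCountableTopology M]
    [RiemannianBundle (fun x : M => TangentSpace (𝓡 m) x)] [MeasurableSpace M] :
    MeasureTheory.Measure M :=
  if _h : Nonempty M then
    let c := (exists_chart_cover (m := m) M).choose
    MeasureTheory.Measure.sum fun n => (chartVolume (m := m) (c n)).restrict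
      (disjointed (fun k => (extChartAt (𝓡 m) (c k)).source) n)
  else 0

/-- The Gauss curvature `⟨R(∂₁, ∂₂)∂₂, ∂₁⟩ / (g₁₁ g₂₂ - g₁₂²)` of a surface. -/
def gaussCurvature {N : Type*} [TopologicalSpace N] [ChartedSpace (EuclideanSpace ℝ (Fin 2)) N]
    [RiemannianBundle (fun y : N => TangentSpace (𝓡 2) y)] (y : N) : ℝ :=
  let u := extChartAt (𝓡 2) y y
  (∑ l, curvatureCoeff y u 0 1 1 l * metricMatrix y u l 0) / (metricMatrix y u).det

/-! ### Tension field, bienergy, biharmonic maps -/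

section Maps

variable {m n : ℕ}
  {M : Type*} [TopologicalSpace M] [ChartedSpace (EuclideanSpace ℝ (Fin m)) M]
  [RiemannianBundle (fun x : M => TangentSpace (𝓡 m) x)]
  {N : Type*} [TopologicalSpace N] [ChartedSpace (EuclideanSpace ℝ (Fin n)) N]
  [RiemannianBundle (fun y : N => TangentSpace (𝓡 n) y)]

/-- The `a`-th component of the tension field `τ(φ) = Trace_g ∇dφ` at `x`, in the charts at
`p : M` and `q : N`:
`τᵃ = ∑ᵢⱼ gⁱʲ (∂ᵢ∂ⱼ φᵃ - ∑ₖ Γᵏᵢⱼ ∂ₖ φᵃ + ∑_{b,c} Γᵃ_{bc}(φ) ∂ᵢ φᵇ ∂ⱼ φᶜ)`. -/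
def tensionIn (p : M) (q : N) (φ : M → N) (x : M) (a : Fin n) : ℝ :=
  let u := extChartAt (𝓡 m) p x
  let F : Fin n → EuclideanSpace ℝ (Fin m) → ℝ :=
    fun b w => extChartAt (𝓡 n) q (φ ((extChartAt (𝓡 m) p).symm w)) b
  ∑ i, ∑ j, (metricMatrix p u)⁻¹ i j *
    (pderiv i (pderiv j (F a)) u - ∑ k, christoffel p u k i j * pderiv k (F a) u
      + ∑ b, ∑ c, christoffel q (extChartAt (𝓡 n) q (φ x)) a b c
          * pderiv i (F b) u * pderiv j (F c) u)

/-- The squared norm `|τ(φ)|²` of the tension field at `x` (it does not depend on the charts). -/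
def tensionNormSq (φ : M → N) (x : M) : ℝ :=
  ∑ a, ∑ b, metricMatrix (m := n) (φ x) (extChartAt (𝓡 n) (φ x) (φ x)) a b
    * tensionIn (m := m) (n := n) x (φ x) φ x a * tensionIn (m := m) (n := n) x (φ x) φ x b

/-- The bienergy `E²(φ, Ω) = ½ ∫_Ω |τ(φ)|² dx`. -/
def bienergy [SecondCountableTopology M] [MeasurableSpace M] (φ : M → N) (Ω : Set M) : ℝ :=
  (1 / 2) * ∫ x in Ω, tensionNormSq (m := m) (n := n) φ x ∂(riemannianVolume m M)

/-- `φ` is biharmonic on the open set `U`: for every compact `Ω ⊆ U` it is a critical point of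
`E²(·, Ω)` with respect to all smooth variations `φₜ` of `φ = φ₀` that are supported in `Ω`.
For `U = Set.univ` this says that `φ` is a biharmonic map. -/
def IsBiharmonicOn [SecondCountableTopology M] [MeasurableSpace M] (φ : M → N) (U : Set M) :
    Prop :=
  ∀ Ω : Set M, IsCompact Ω → Ω ⊆ U → ∀ Φ : ℝ → M → N,
    ContMDiff (𝓘(ℝ, ℝ).prod (𝓡 m)) (𝓡 n) ∞ (fun z : ℝ × M => Φ z.1 z.2) →
    Φ 0 = φ →
    (∀ t : ℝ, ∀ x ∉ Ω, Φ t x = φ x) →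
    HasDerivAt (fun t => bienergy (m := m) (n := n) (Φ t) Ω) 0 0

/-- A Riemannian submersion: a smooth map whose differential is everywhere onto and restricts to
an isometry on the orthogonal complement of its kernel. -/
structure IsRiemannianSubmersion (ψ : M → N) : Prop where
  smooth : ContMDiff (𝓡 m) (𝓡 n) ∞ ψ
  surjective : ∀ x, Function.Surjective (mfderiv (𝓡 m) (𝓡 n) ψ x)
  isometry : ∀ x, ∀ v w : TangentSpace (𝓡 m) x,
    (∀ z, mfderiv (𝓡 m) (𝓡 n) ψ x z = 0 → inner ℝ z v = 0) →
    (∀ z, mfderiv (𝓡 m) (𝓡 n) ψ x z = 0 → inner ℝ z w = 0) →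
    inner ℝ (mfderiv (𝓡 m) (𝓡 n) ψ x v) (mfderiv (𝓡 m) (𝓡 n) ψ x w) = inner ℝ v w

end Maps

/-- The derivative `X(f)` of a function `f` in the direction of a vector field `X`. -/
def dirDeriv {m : ℕ} {M : Type*} [TopologicalSpace M]
    [ChartedSpace (EuclideanSpace ℝ (Fin m)) M]
    (X : (x : M) → TangentSpace (𝓡 m) x) (f : M → ℝ) (x : M) : ℝ :=
  mfderiv (𝓡 m) 𝓘(ℝ, ℝ) f x (X x)

/-- Smoothness of a vector field on a set. -/
def SmoothFieldOn {m : ℕ} {M : Type*} [TopologicalSpace M]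
    [ChartedSpace (EuclideanSpace ℝ (Fin m)) M] [IsManifold (𝓡 m) ∞ M]
    (X : (x : M) → TangentSpace (𝓡 m) x) (U : Set M) : Prop :=
  ContMDiffOn (𝓡 m) (𝓡 m).tangent ∞ (fun x => (⟨x, X x⟩ : TangentBundle (𝓡 m) M)) U

section Frames

variable
  {M : Type*} [TopologicalSpace M] [ChartedSpace (EuclideanSpace ℝ (Fin 3)) M]
  [IsManifold (𝓡 3) ∞ M] [RiemannianBundle (fun x : M => TangentSpace (𝓡 3) x)]
  {N : Type*} [TopologicalSpace N] [ChartedSpace (EuclideanSpace ℝ (Fin 2)) N]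
  [IsManifold (𝓡 2) ∞ N] [RiemannianBundle (fun y : N => TangentSpace (𝓡 2) y)]

/-- `e` is an orthonormal frame on `U` adapted to `ψ`: `e 2` is vertical and `e 0`, `e 1` are
`ψ`-related to an orthonormal frame `ε` on `V`. Indices start at `0`: `e 0, e 1, e 2` are
`e₁, e₂, e₃`, and `ε 0, ε 1` are `ε₁, ε₂`. -/
structure IsAdaptedFrame (ψ : M → N) (U : Set M) (V : Set N)
    (e : Fin 3 → (x : M) → TangentSpace (𝓡 3) x)
    (ε : Fin 2 → (y : N) → TangentSpace (𝓡 2) y) : Prop where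
  isOpen_source : IsOpen U
  isOpen_target : IsOpen V
  mapsTo : Set.MapsTo ψ U V
  smooth : ∀ i, SmoothFieldOn (e i) U
  smooth_base : ∀ i, SmoothFieldOn (ε i) V
  orthonormal : ∀ x ∈ U, Orthonormal ℝ (fun i => e i x)
  orthonormal_base : ∀ y ∈ V, Orthonormal ℝ (fun i => ε i y)
  vertical : ∀ x ∈ U, mfderiv (𝓡 3) (𝓡 2) ψ x (e 2 x) = 0
  related_zero : ∀ x ∈ U, mfderiv (𝓡 3) (𝓡 2) ψ x (e 0 x) = ε 0 (ψ x)
  related_one : ∀ x ∈ U, mfderiv (𝓡 3) (𝓡 2) ψ x (e 1 x) = ε 1 (ψ x)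

/-- `f₁ = F₁ ∘ ψ`, `f₂ = F₂ ∘ ψ`, `κ₁`, `κ₂`, `σ` are the integrability data of the adapted frame:
`[ε₁, ε₂] = F₁ ε₁ + F₂ ε₂`, `[e₁, e₃] = κ₁ e₃`, `[e₂, e₃] = κ₂ e₃` and
`[e₁, e₂] = f₁ e₁ + f₂ e₂ - 2 σ e₃`. -/
structure IsIntegrabilityData (ψ : M → N) (U : Set M) (V : Set N)
    (e : Fin 3 → (x : M) → TangentSpace (𝓡 3) x)
    (ε : Fin 2 → (y : N) → TangentSpace (𝓡 2) y)
    (F₁ F₂ : N → ℝ) (κ₁ κ₂ σ : M → ℝ) : Prop where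
  smooth_F₁ : ContMDiffOn (𝓡 2) 𝓘(ℝ, ℝ) ∞ F₁ V
  smooth_F₂ : ContMDiffOn (𝓡 2) 𝓘(ℝ, ℝ) ∞ F₂ V
  smooth_κ₁ : ContMDiffOn (𝓡 3) 𝓘(ℝ, ℝ) ∞ κ₁ U
  smooth_κ₂ : ContMDiffOn (𝓡 3) 𝓘(ℝ, ℝ) ∞ κ₂ U
  smooth_σ : ContMDiffOn (𝓡 3) 𝓘(ℝ, ℝ) ∞ σ U
  bracket_base : ∀ y ∈ V,
    VectorField.mlieBracket (𝓡 2) (ε 0) (ε 1) y = F₁ y • ε 0 y + F₂ y • ε 1 y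
  bracket_02 : ∀ x ∈ U, VectorField.mlieBracket (𝓡 3) (e 0) (e 2) x = κ₁ x • e 2 x
  bracket_12 : ∀ x ∈ U, VectorField.mlieBracket (𝓡 3) (e 1) (e 2) x = κ₂ x • e 2 x
  bracket_01 : ∀ x ∈ U, VectorField.mlieBracket (𝓡 3) (e 0) (e 1) x =
    F₁ (ψ x) • e 0 x + F₂ (ψ x) • e 1 x - (2 * σ x) • e 2 x

end Frames

end

end RiemSubm

/-! Indices in this comment count from 1; the code counts from 0.

In orthonormal frames the bienergy density is half a sum of squares. If τ¹, τ² are the components in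
the frame ε of the tension field of Φ_t, the derivative of the bienergy at t = 0 is the integral of
τ¹ ∂_tτ¹ + τ² ∂_tτ², with ordinary derivatives of functions and no covariant derivative in t. For
the submersion itself dψ has constant components in the frames, and the f-terms coming from M and
from N cancel, so the tension field is -κ₁ε₁ - κ₂ε₂. When κ₂ = 0 only -κ₁ ∂_tτ¹ survives.

Let v₁, v₂ be the components of the velocity of the variation. The connection of N is torsion-free,
so covariant differentiation in t of dΦ(e_s) equals covariant differentiation along e_s of the
velocity (`IsFrame.deriv_spaceComp`). This makes -κ₁ ∂_tτ¹ an explicit expression, linear in v₁, v₂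
and of second order. Collecting divergences into a vector field, the flux, leaves v₁B₁ + v₂B₂, where
B₁, B₂ are the left-hand sides of the two equations (`tension_mul_deriv_eq`). No curvature tensor
has to be commuted past derivatives: curvature arises because F₂ ∘ Φ_t is differentiated in t, and
the first derivatives of F₁, F₂ combine to K = ε₁F₂ - ε₂F₁ - F₁² - F₂²
(`IsFrame.gaussCurvature_eq`). The flux integrates to zero by the divergence theorem
(`IsFrame.integral_divergence`), and the fundamental lemma of the calculus of variations gives the
equivalence (`isBiharmonicOn_iff_bitension`).

The definitions, however, are coordinate formulas, so most of the work is a dictionary between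
charts and frames. Its core is the Koszul formula `IsFrame.koszul`, which relates the Christoffel
symbols to the structure functions of a frame; it yields the Laplacian, the Gauss curvature and the
tension field (`tensionIn_eq`) in frames. On the measure side, the change of variables formula shows
that the Riemannian volume is computed by any chart (`riemannianVolume_apply_of_subset`), and the
divergence theorem is reduced to charts by a partition of unity. -/

namespace RiemSubm

/-! ### Vector fields and functions in a chart -/

section ChartCalculus

variable {m : ℕ} {M : Type*} [TopologicalSpace M] [ChartedSpace (EuclideanSpace ℝ (Fin m)) M]

/-- The representative of a vector field in the chart at `p`. -/
noncomputable def chartField (p : M) (X : (x : M) → TangentSpace (𝓡 m) x)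
    (u : EuclideanSpace ℝ (Fin m)) : EuclideanSpace ℝ (Fin m) :=
  mfderiv (𝓡 m) 𝓘(ℝ, EuclideanSpace ℝ (Fin m)) (extChartAt (𝓡 m) p)
    ((extChartAt (𝓡 m) p).symm u) (X ((extChartAt (𝓡 m) p).symm u))

/-- The `i`-th coordinate function of the chart at `p`. -/
noncomputable def coord (p : M) (i : Fin m) (x : M) : ℝ := extChartAt (𝓡 m) p x i

theorem source_mem_nhds {p x : M} (hx : x ∈ (extChartAt (𝓡 m) p).source) :
    (extChartAt (𝓡 m) p).source ∈ nhds x :=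
  (isOpen_extChartAt_source (I := 𝓡 m) p).mem_nhds hx

theorem target_mem_nhds {p : M} {u : EuclideanSpace ℝ (Fin m)}
    (hu : u ∈ (extChartAt (𝓡 m) p).target) : (extChartAt (𝓡 m) p).target ∈ nhds u :=
  (isOpen_extChartAt_target (I := 𝓡 m) p).mem_nhds hu

theorem mem_chartAt_source {p x : M} (hx : x ∈ (extChartAt (𝓡 m) p).source) :
    x ∈ (chartAt (EuclideanSpace ℝ (Fin m)) p).source := by
  rwa [← extChartAt_source (𝓡 m)]

theorem eventually_of_eventually_chart {p x : M} (hx : x ∈ (extChartAt (𝓡 m) p).source)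
    {P : M → Prop} (hP : ∀ᶠ y in nhds x, P y) :
    ∀ᶠ u in nhds (extChartAt (𝓡 m) p x), P ((extChartAt (𝓡 m) p).symm u) := by
  have hc : ContinuousAt (extChartAt (𝓡 m) p).symm (extChartAt (𝓡 m) p x) :=
    continuousAt_extChartAt_symm' hx
  refine hc.eventually ?_
  rwa [(extChartAt (𝓡 m) p).left_inv hx]

theorem eq_comp_symm {α : Type*} {p x : M} (hx : x ∈ (extChartAt (𝓡 m) p).source) (f : M → α) :
    f =ᶠ[nhds x] (fun u => f ((extChartAt (𝓡 m) p).symm u)) ∘ (extChartAt (𝓡 m) p) := by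
  filter_upwards [source_mem_nhds hx] with y hy
  change f y = f ((extChartAt (𝓡 m) p).symm (extChartAt (𝓡 m) p y))
  rw [(extChartAt (𝓡 m) p).left_inv hy]

theorem dirDeriv_congr {f g : M → ℝ} {x : M} (h : f =ᶠ[nhds x] g)
    (X : (x : M) → TangentSpace (𝓡 m) x) : dirDeriv X f x = dirDeriv X g x := by
  unfold dirDeriv
  rw [h.mfderiv_eq]
  rfl

theorem dirDeriv_const (c : ℝ) (X : (x : M) → TangentSpace (𝓡 m) x) (x : M) :
    dirDeriv X (fun _ => c) x = 0 := by
  unfold dirDeriv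
  rw [mfderiv_const]
  rfl

theorem dirDeriv_add {f g : M → ℝ} {x : M} (hf : ContMDiffAt (𝓡 m) 𝓘(ℝ, ℝ) ∞ f x)
    (hg : ContMDiffAt (𝓡 m) 𝓘(ℝ, ℝ) ∞ g x) (X : (x : M) → TangentSpace (𝓡 m) x) :
    dirDeriv X (fun y => f y + g y) x = dirDeriv X f x + dirDeriv X g x := by
  have := ((hf.mdifferentiableAt (by simp)).hasMFDerivAt.add
    (hg.mdifferentiableAt (by simp)).hasMFDerivAt).mfderiv
  unfold dirDeriv
  exact congrArg (fun L : TangentSpace (𝓡 m) x →L[ℝ] ℝ => L (X x)) this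

theorem dirDeriv_mul {f g : M → ℝ} {x : M} (hf : ContMDiffAt (𝓡 m) 𝓘(ℝ, ℝ) ∞ f x)
    (hg : ContMDiffAt (𝓡 m) 𝓘(ℝ, ℝ) ∞ g x) (X : (x : M) → TangentSpace (𝓡 m) x) :
    dirDeriv X (fun y => f y * g y) x = dirDeriv X f x * g x + f x * dirDeriv X g x := by
  have := ((hf.mdifferentiableAt (by simp)).hasMFDerivAt.mul
    (hg.mdifferentiableAt (by simp)).hasMFDerivAt).mfderiv
  unfold dirDeriv
  refine (congrArg (fun L : TangentSpace (𝓡 m) x →L[ℝ] ℝ => L (X x)) this).trans ?_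
  change f x * _ + g x * _ = _
  rw [add_comm, mul_comm (g x)]
  rfl

theorem dirDeriv_sum {ι : Type*} (s : Finset ι) {f : ι → M → ℝ} {x : M}
    (hf : ∀ i ∈ s, ContMDiffAt (𝓡 m) 𝓘(ℝ, ℝ) ∞ (f i) x) (X : (x : M) → TangentSpace (𝓡 m) x) :
    dirDeriv X (fun y => ∑ i ∈ s, f i y) x = ∑ i ∈ s, dirDeriv X (f i) x := by
  classical
  induction s using Finset.induction_on with
  | empty => simpa using dirDeriv_const 0 X x
  | insert a s ha ih =>
    simp only [Finset.sum_insert ha]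
    rw [dirDeriv_add (hf a (Finset.mem_insert_self _ _)) ?_,
      ih fun i hi => hf i (Finset.mem_insert_of_mem hi)]
    exact ContMDiffAt.sum fun i hi => hf i (Finset.mem_insert_of_mem hi)

variable [IsManifold (𝓡 m) ∞ M]

theorem contMDiffAt_symm {p x : M} (hx : x ∈ (extChartAt (𝓡 m) p).source) :
    ContMDiffAt 𝓘(ℝ, EuclideanSpace ℝ (Fin m)) (𝓡 m) ∞ (extChartAt (𝓡 m) p).symm
      (extChartAt (𝓡 m) p x) :=
  (contMDiffOn_extChartAt_symm p).contMDiffAt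
    ((isOpen_extChartAt_target p).mem_nhds ((extChartAt (𝓡 m) p).map_source hx))

theorem contMDiffAt_chart {p x : M} (hx : x ∈ (extChartAt (𝓡 m) p).source) :
    ContMDiffAt (𝓡 m) 𝓘(ℝ, EuclideanSpace ℝ (Fin m)) ∞ (extChartAt (𝓡 m) p) x :=
  contMDiffAt_extChartAt' (mem_chartAt_source hx)

theorem contMDiffAt_comp_chart {p x : M} (hx : x ∈ (extChartAt (𝓡 m) p).source)
    {F : EuclideanSpace ℝ (Fin m) → ℝ} (hF : ContDiffAt ℝ ∞ F (extChartAt (𝓡 m) p x)) :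
    ContMDiffAt (𝓡 m) 𝓘(ℝ, ℝ) ∞ (fun y => F (extChartAt (𝓡 m) p y)) x :=
  ContMDiffAt.comp x (I' := 𝓘(ℝ, EuclideanSpace ℝ (Fin m))) hF.contMDiffAt (contMDiffAt_chart hx)

theorem contMDiffAt_coord {p x : M} (hx : x ∈ (extChartAt (𝓡 m) p).source) (i : Fin m) :
    ContMDiffAt (𝓡 m) 𝓘(ℝ, ℝ) ∞ (coord p i) x :=
  contMDiffAt_comp_chart (F := fun u => u i) hx (EuclideanSpace.proj (𝕜 := ℝ) i).contDiff.contDiffAt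

theorem contDiffAt_comp_symm {p x : M} (hx : x ∈ (extChartAt (𝓡 m) p).source) {f : M → ℝ}
    (hf : ContMDiffAt (𝓡 m) 𝓘(ℝ, ℝ) ∞ f x) :
    ContDiffAt ℝ ∞ (fun u => f ((extChartAt (𝓡 m) p).symm u)) (extChartAt (𝓡 m) p x) := by
  rw [← contMDiffAt_iff_contDiffAt]
  refine ContMDiffAt.comp _ (I' := 𝓡 m) ?_ (contMDiffAt_symm hx)
  rwa [(extChartAt (𝓡 m) p).left_inv hx]

theorem contMDiffAt_of_comp_symm {p x : M} (hx : x ∈ (extChartAt (𝓡 m) p).source) {f : M → ℝ}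
    (hf : ContDiffAt ℝ ∞ (fun u => f ((extChartAt (𝓡 m) p).symm u)) (extChartAt (𝓡 m) p x)) :
    ContMDiffAt (𝓡 m) 𝓘(ℝ, ℝ) ∞ f x :=
  (contMDiffAt_comp_chart hx hf).congr_of_eventuallyEq (eq_comp_symm hx f)

theorem eventually_mdifferentiableAt {f : M → ℝ} {x : M}
    (hf : ContMDiffAt (𝓡 m) 𝓘(ℝ, ℝ) ∞ f x) :
    ∀ᶠ y in nhds x, MDifferentiableAt (𝓡 m) 𝓘(ℝ, ℝ) f y := by
  have h1 : ContMDiffAt (𝓡 m) 𝓘(ℝ, ℝ) 1 f x := hf.of_le (by simp)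
  filter_upwards [(contMDiffAt_iff_contMDiffAt_nhds (by simp)).1 h1] with y hy using hy.mdifferentiableAt (by simp)

theorem dirDeriv_eq_fderiv {p x : M} (hx : x ∈ (extChartAt (𝓡 m) p).source) {f : M → ℝ}
    (hf : MDifferentiableAt (𝓡 m) 𝓘(ℝ, ℝ) f x) (X : (x : M) → TangentSpace (𝓡 m) x) :
    dirDeriv X f x = fderiv ℝ (fun u => f ((extChartAt (𝓡 m) p).symm u)) (extChartAt (𝓡 m) p x)
      (chartField p X (extChartAt (𝓡 m) p x)) := by
  have hl := (extChartAt (𝓡 m) p).left_inv hx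
  have h2 : MDifferentiableAt 𝓘(ℝ, EuclideanSpace ℝ (Fin m)) 𝓘(ℝ, ℝ)
      (fun u => f ((extChartAt (𝓡 m) p).symm u)) (extChartAt (𝓡 m) p x) :=
    MDifferentiableAt.comp _ (I' := 𝓡 m) (by rwa [hl])
      ((contMDiffAt_symm hx).mdifferentiableAt (by simp))
  have h3 : MDifferentiableAt (𝓡 m) 𝓘(ℝ, EuclideanSpace ℝ (Fin m)) (extChartAt (𝓡 m) p) x :=
    mdifferentiableAt_extChartAt (mem_chartAt_source hx)
  unfold dirDeriv chartField
  rw [(eq_comp_symm hx f).mfderiv_eq, mfderiv_comp x h2 h3, mfderiv_eq_fderiv, hl]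
  rfl

/-- The trivialization of the tangent bundle at `p` acts on fibres as the derivative of the chart,
so a smooth section has a smooth chart representative. -/
theorem contDiffAt_chartField {p x : M} (hx : x ∈ (extChartAt (𝓡 m) p).source)
    {X : (x : M) → TangentSpace (𝓡 m) x}
    (hX : ContMDiffAt (𝓡 m) (𝓡 m).tangent ∞ (fun x => (⟨x, X x⟩ : TangentBundle (𝓡 m) M)) x) :
    ContDiffAt ℝ ∞ (chartField p X) (extChartAt (𝓡 m) p x) := by
  have h1 := (Trivialization.contMDiffAt_section_iff (IB := 𝓡 m) (n := ∞)
    (e := trivializationAt (EuclideanSpace ℝ (Fin m)) (TangentSpace (𝓡 m)) p) (s := X) (x₀ := x)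
    (by simpa using mem_chartAt_source hx)).1 hX
  rw [← contMDiffAt_iff_contDiffAt]
  have h2 := ContMDiffAt.comp (extChartAt (𝓡 m) p x) (I' := 𝓡 m)
    (by rwa [(extChartAt (𝓡 m) p).left_inv hx]) (contMDiffAt_symm hx)
  refine h2.congr_of_eventuallyEq ?_
  filter_upwards [target_mem_nhds ((extChartAt (𝓡 m) p).map_source hx)] with u hu
  have hu' := mem_chartAt_source ((extChartAt (𝓡 m) p).map_target hu)
  unfold chartField
  rw [← TangentBundle.continuousLinearMapAt_trivializationAt hu']
  simp only [Function.comp_apply]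
  exact (trivializationAt (EuclideanSpace ℝ (Fin m)) (TangentSpace (𝓡 m)) p).continuousLinearMapAt_apply_of_mem (R := ℝ) (by simpa using hu') _

theorem dirDeriv_comp_symm_eventuallyEq {p x : M} (hx : x ∈ (extChartAt (𝓡 m) p).source)
    {f : M → ℝ} (hf : ContMDiffAt (𝓡 m) 𝓘(ℝ, ℝ) ∞ f x) (X : (x : M) → TangentSpace (𝓡 m) x) :
    (fun u => dirDeriv X f ((extChartAt (𝓡 m) p).symm u)) =ᶠ[nhds (extChartAt (𝓡 m) p x)]
      fun u => fderiv ℝ (fun u => f ((extChartAt (𝓡 m) p).symm u)) u (chartField p X u) := by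
  filter_upwards [eventually_of_eventually_chart hx (eventually_mdifferentiableAt hf),
    target_mem_nhds ((extChartAt (𝓡 m) p).map_source hx)] with u hu hu'
  rw [dirDeriv_eq_fderiv ((extChartAt (𝓡 m) p).map_target hu') hu X,
    (extChartAt (𝓡 m) p).right_inv hu']

theorem contMDiffAt_dirDeriv {x : M} {f : M → ℝ} (hf : ContMDiffAt (𝓡 m) 𝓘(ℝ, ℝ) ∞ f x)
    {X : (x : M) → TangentSpace (𝓡 m) x}
    (hX : ContMDiffAt (𝓡 m) (𝓡 m).tangent ∞ (fun x => (⟨x, X x⟩ : TangentBundle (𝓡 m) M)) x) :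
    ContMDiffAt (𝓡 m) 𝓘(ℝ, ℝ) ∞ (dirDeriv X f) x := by
  have hx := mem_extChartAt_source (I := 𝓡 m) x
  refine contMDiffAt_of_comp_symm hx ?_
  refine ContDiffAt.congr_of_eventuallyEq ?_ (dirDeriv_comp_symm_eventuallyEq hx hf X)
  exact ((contDiffAt_comp_symm hx hf).fderiv_right (by simp)).clm_apply
    (contDiffAt_chartField hx hX)

/-- In the chart this is the symmetry of the second derivative. Through it brackets enter all later
computations as first-order operators on functions. -/
theorem dirDeriv_mlieBracket {x : M} {f : M → ℝ} (hf : ContMDiffAt (𝓡 m) 𝓘(ℝ, ℝ) ∞ f x)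
    {X Y : (x : M) → TangentSpace (𝓡 m) x}
    (hX : ContMDiffAt (𝓡 m) (𝓡 m).tangent ∞ (fun x => (⟨x, X x⟩ : TangentBundle (𝓡 m) M)) x)
    (hY : ContMDiffAt (𝓡 m) (𝓡 m).tangent ∞ (fun x => (⟨x, Y x⟩ : TangentBundle (𝓡 m) M)) x) :
    dirDeriv (VectorField.mlieBracket (𝓡 m) X Y) f x =
      dirDeriv X (dirDeriv Y f) x - dirDeriv Y (dirDeriv X f) x := by
  have hx := mem_extChartAt_source (I := 𝓡 m) x
  have hu := mem_extChartAt_target (I := 𝓡 m) x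
  -- `mlieBracket` is defined by pulling back along the inverse chart. The derivatives of the chart
  -- and of its inverse are mutually inverse, so the pullback is the chart representative.
  have hpull : ∀ Z : (x : M) → TangentSpace (𝓡 m) x,
      VectorField.mpullbackWithin 𝓘(ℝ, EuclideanSpace ℝ (Fin m)) (𝓡 m) (extChartAt (𝓡 m) x).symm Z
        (Set.range (𝓡 m)) =ᶠ[nhds (extChartAt (𝓡 m) x x)] chartField x Z := by
    intro Z
    filter_upwards [target_mem_nhds hu] with u hu
    unfold chartField
    rw [VectorField.mpullbackWithin_apply, ContinuousLinearMap.inverse_eq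
      (mfderivWithin_extChartAt_symm_comp_mfderiv_extChartAt hu)
      (mfderiv_extChartAt_comp_mfderivWithin_extChartAt_symm hu)]
    rfl
  have hbr : chartField x (VectorField.mlieBracket (𝓡 m) X Y) (extChartAt (𝓡 m) x x) =
      VectorField.lieBracket ℝ (chartField x X) (chartField x Y) (extChartAt (𝓡 m) x x) := by
    unfold chartField
    rw [(extChartAt (𝓡 m) x).left_inv hx]
    unfold VectorField.mlieBracket
    rw [VectorField.mlieBracketWithin_apply]
    have hinv := isInvertible_mfderiv_extChartAt (I := 𝓡 m) hx
    obtain ⟨L, hL⟩ := hinv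
    rw [← hL, ContinuousLinearMap.inverse_equiv]
    refine (L.apply_symm_apply _).trans ?_
    rw [Set.preimage_univ, Set.univ_inter]
    refine (Filter.EventuallyEq.lieBracketWithin_vectorField_eq
      (nhdsWithin_le_nhds (hpull X)) (hpull X).self_of_nhds
      (nhdsWithin_le_nhds (hpull Y)) (hpull Y).self_of_nhds).trans ?_
    rw [ModelWithCorners.range_eq_univ]
    exact congrFun (VectorField.lieBracketWithin_univ (V := chartField x X)
      (W := chartField x Y)) _
  rw [dirDeriv_eq_fderiv hx (hf.mdifferentiableAt (by simp)), hbr,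
    VectorField.fderiv_apply_lieBracket (n := ∞) (contDiffAt_comp_symm hx hf)
      (by simpa using WithTop.coe_le_coe.2 (le_top : (2 : ℕ∞) ≤ ⊤)) ((contDiffAt_chartField hx hY).differentiableAt (by simp))
      ((contDiffAt_chartField hx hX).differentiableAt (by simp)),
    dirDeriv_eq_fderiv hx ((contMDiffAt_dirDeriv hf hY).mdifferentiableAt (by simp)),
    dirDeriv_eq_fderiv hx ((contMDiffAt_dirDeriv hf hX).mdifferentiableAt (by simp)),
    (dirDeriv_comp_symm_eventuallyEq hx hf X).fderiv_eq,
    (dirDeriv_comp_symm_eventuallyEq hx hf Y).fderiv_eq]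
end ChartCalculus

/-! ### Orthonormal frames in a chart -/

section LinearAlgebra

variable {m : ℕ}

/-- Orthonormality says E γ Eᵀ = 1. One-sided inverses of square matrices are two-sided, hence γ (Eᵀ
E) = 1. -/
theorem inv_eq_sum_of_orthonormal {γ : Matrix (Fin m) (Fin m) ℝ} {E : Fin m → Fin m → ℝ}
    (h : ∀ a b, ∑ i, ∑ j, γ i j * E a i * E b j = if a = b then 1 else 0) :
    γ⁻¹ = Matrix.of (fun i j => ∑ a, E a i * E a j) ∧
      γ * Matrix.of (fun i j => ∑ a, E a i * E a j) = 1 ∧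
      Matrix.of (fun i j => ∑ a, E a i * E a j) * γ = 1 := by
  have hG : (Matrix.of fun i j => ∑ a, E a i * E a j) = (Matrix.of E).transpose * Matrix.of E := by
    ext i j
    simp [Matrix.mul_apply]
  have h1 : Matrix.of E * (γ * (Matrix.of E).transpose) = 1 := by
    ext a b
    rw [Matrix.one_apply, ← h a b]
    simp only [Matrix.mul_apply, Matrix.of_apply, Matrix.transpose_apply, Finset.mul_sum]
    exact Finset.sum_congr rfl fun i _ => Finset.sum_congr rfl fun j _ => by ring
  have h2 := mul_eq_one_comm.1 h1
  rw [Matrix.mul_assoc] at h2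
  rw [hG]
  exact ⟨Matrix.inv_eq_right_inv h2, h2, mul_eq_one_comm.1 h2⟩

/-- The Koszul formula, as an identity between the values at a point of a metric `γ`, its first
derivatives `dγ`, an orthonormal frame `E` with structure constants `c` and its derivatives `T`. -/
theorem koszul_algebra {γ : Matrix (Fin m) (Fin m) ℝ} {E : Fin m → Fin m → ℝ}
    {T dγ c : Fin m → Fin m → Fin m → ℝ}
    (h : ∀ a b, ∑ i, ∑ j, γ i j * E a i * E b j = if a = b then 1 else 0)
    (hγ : ∀ i j, γ i j = γ j i)
    (hd : ∀ a b d, ∑ k, ∑ i, ∑ j, E a k * dγ k i j * E b i * E d j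
      + ∑ i, ∑ j, γ i j * T a b i * E d j + ∑ i, ∑ j, γ i j * E b i * T a d j = 0)
    (hc : ∀ a b k, T a b k - T b a k = ∑ d, c a b d * E d k) (a b k : Fin m) :
    T a b k + ∑ i, ∑ j, (1 / 2 * ∑ l, γ⁻¹ k l * (dγ i j l + dγ j i l - dγ l i j)) * E a i * E b j
      = ∑ d, (1 / 2 * (c a b d + c d a b + c d b a)) * E d k := by
  obtain ⟨hinv, hl, -⟩ := inv_eq_sum_of_orthonormal h
  -- `H a b d` is (e_a γ)(e_b, e_d), and `P a b d` is γ(T_ab, e_d), where T_ab is the coordinate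
  -- derivative of e_b along e_a.
  set H : Fin m → Fin m → Fin m → ℝ :=
    fun a b d => ∑ k, ∑ i, ∑ j, E a k * dγ k i j * E b i * E d j with hH
  set P : Fin m → Fin m → Fin m → ℝ := fun a b d => ∑ i, ∑ j, γ i j * T a b i * E d j with hP
  have hHP : ∀ a b d, H a b d + P a b d + P a d b = 0 := by
    intro a b d
    rw [← hd a b d]
    congr 1
    rw [hP]
    simp only
    rw [Finset.sum_comm]
    exact Finset.sum_congr rfl fun i _ => Finset.sum_congr rfl fun j _ => by rw [hγ]; ring
  have hPc : ∀ a b d, P a b d - P b a d = c a b d := by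
    intro a b d
    calc P a b d - P b a d = ∑ i, ∑ j, γ i j * (T a b i - T b a i) * E d j := by
          simp only [hP, ← Finset.sum_sub_distrib]
          exact Finset.sum_congr rfl fun i _ => Finset.sum_congr rfl fun j _ => by ring
      _ = ∑ f, c a b f * ∑ i, ∑ j, γ i j * E f i * E d j := by
          simp only [hc, Finset.mul_sum, Finset.sum_mul]
          rw [Finset.sum_comm]
          conv_lhs => enter [2, j]; rw [Finset.sum_comm]
          rw [Finset.sum_comm]
          refine Finset.sum_congr rfl fun f _ => ?_
          rw [Finset.sum_comm]
          exact Finset.sum_congr rfl fun i _ => Finset.sum_congr rfl fun j _ => by ring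
      _ = c a b d := by simp [h]
  have hT : T a b k = ∑ d, P a b d * E d k := by
    have hl' : ∀ i, ∑ j, γ i j * ∑ d, E d j * E d k = if i = k then 1 else 0 := by
      intro i
      have := congrFun (congrFun hl i) k
      rwa [Matrix.mul_apply, Matrix.one_apply] at this
    calc T a b k = ∑ i, T a b i * ∑ j, γ i j * ∑ d, E d j * E d k := by simp [hl']
      _ = _ := by
          simp only [hP, Finset.mul_sum, Finset.sum_mul]
          conv_lhs => enter [2, i]; rw [Finset.sum_comm]
          rw [Finset.sum_comm]
          exact Finset.sum_congr rfl fun i _ => Finset.sum_congr rfl fun j _ =>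
            Finset.sum_congr rfl fun d _ => by ring
  have hΓ : ∑ i, ∑ j, (1 / 2 * ∑ l, γ⁻¹ k l * (dγ i j l + dγ j i l - dγ l i j)) * E a i * E b j
      = ∑ d, 1 / 2 * (H a b d + H b a d - H d a b) * E d k := by
    have e1 : ∀ d, H b a d = ∑ i, ∑ j, ∑ l, E b j * dγ j i l * E a i * E d l := by
      intro d
      simp only [hH]
      rw [Finset.sum_comm]
    have e2 : ∀ d, H d a b = ∑ i, ∑ j, ∑ l, E d l * dγ l i j * E a i * E b j := by
      intro d
      simp only [hH]
      rw [Finset.sum_comm]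
      exact Finset.sum_congr rfl fun i _ => by rw [Finset.sum_comm]
    simp only [e1, e2]
    simp only [hH, hinv, Matrix.of_apply, ← Finset.sum_add_distrib, ← Finset.sum_sub_distrib,
      Finset.mul_sum, Finset.sum_mul]
    conv_lhs => enter [2, i, 2, j]; rw [Finset.sum_comm]
    conv_lhs => enter [2, i]; rw [Finset.sum_comm]
    rw [Finset.sum_comm]
    exact Finset.sum_congr rfl fun d _ => Finset.sum_congr rfl fun i _ =>
      Finset.sum_congr rfl fun j _ => Finset.sum_congr rfl fun l _ => by ring
  rw [hT, hΓ, ← Finset.sum_add_distrib]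
  refine Finset.sum_congr rfl fun d _ => ?_
  rw [← add_mul]
  congr 1
  -- Koszul's trick: three cyclic copies of metric compatibility express `H` through `P`, and the
  -- six `P` terms that remain pair up into three antisymmetrizations, each a structure constant.
  have := hHP a b d
  have := hHP b a d
  have := hHP d a b
  have := hPc a b d
  have := hPc d a b
  have := hPc d b a
  linarith

end LinearAlgebra

/-! ### Smooth matrix functions, coordinate derivatives, and frames with their Levi-Civita
connection. -/

section Frame

variable {m : ℕ} {M : Type*} [TopologicalSpace M] [ChartedSpace (EuclideanSpace ℝ (Fin m)) M]

theorem contMDiffAt_prod {ι : Type*} (s : Finset ι) {f : ι → M → ℝ} {x : M}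
    (hf : ∀ i ∈ s, ContMDiffAt (𝓡 m) 𝓘(ℝ, ℝ) ∞ (f i) x) :
    ContMDiffAt (𝓡 m) 𝓘(ℝ, ℝ) ∞ (fun y => ∏ i ∈ s, f i y) x := by
  classical
  induction s using Finset.induction_on with
  | empty => simpa using contMDiffAt_const
  | insert a s ha ih =>
    simp only [Finset.prod_insert ha]
    exact (hf a (Finset.mem_insert_self _ _)).mul
      (ih fun i hi => hf i (Finset.mem_insert_of_mem hi))

theorem contMDiffAt_mul {f g : M → ℝ} {x : M} (hf : ContMDiffAt (𝓡 m) 𝓘(ℝ, ℝ) ∞ f x)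
    (hg : ContMDiffAt (𝓡 m) 𝓘(ℝ, ℝ) ∞ g x) :
    ContMDiffAt (𝓡 m) 𝓘(ℝ, ℝ) ∞ (fun y => f y * g y) x := hf.mul hg

theorem contMDiffAt_sum {ι : Type*} (s : Finset ι) {f : ι → M → ℝ} {x : M}
    (hf : ∀ i ∈ s, ContMDiffAt (𝓡 m) 𝓘(ℝ, ℝ) ∞ (f i) x) :
    ContMDiffAt (𝓡 m) 𝓘(ℝ, ℝ) ∞ (fun y => ∑ i ∈ s, f i y) x := ContMDiffAt.sum hf

theorem contMDiffAt_det {n : ℕ} {A : M → Matrix (Fin n) (Fin n) ℝ} {x : M}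
    (hA : ∀ i j, ContMDiffAt (𝓡 m) 𝓘(ℝ, ℝ) ∞ (fun y => A y i j) x) :
    ContMDiffAt (𝓡 m) 𝓘(ℝ, ℝ) ∞ (fun y => (A y).det) x := by
  simp only [Matrix.det_apply']
  exact ContMDiffAt.sum fun σ _ =>
    contMDiffAt_const.mul (contMDiffAt_prod _ fun i _ => hA _ _)

theorem contMDiffAt_inv {f : M → ℝ} {x : M} (hf : ContMDiffAt (𝓡 m) 𝓘(ℝ, ℝ) ∞ f x)
    (h0 : f x ≠ 0) : ContMDiffAt (𝓡 m) 𝓘(ℝ, ℝ) ∞ (fun y => (f y)⁻¹) x :=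
  ContMDiffAt.comp x (I' := 𝓘(ℝ, ℝ)) (contDiffAt_inv ℝ h0).contMDiffAt hf

theorem contMDiffAt_matrix_inv {n : ℕ} {A : M → Matrix (Fin n) (Fin n) ℝ} {x : M}
    (hA : ∀ i j, ContMDiffAt (𝓡 m) 𝓘(ℝ, ℝ) ∞ (fun y => A y i j) x) (h0 : (A x).det ≠ 0)
    (i j : Fin n) : ContMDiffAt (𝓡 m) 𝓘(ℝ, ℝ) ∞ (fun y => (A y)⁻¹ i j) x := by
  simp only [Matrix.inv_def, Matrix.smul_apply, Ring.inverse_eq_inv', Matrix.adjugate_apply,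
    smul_eq_mul]
  refine (contMDiffAt_inv (contMDiffAt_det hA) h0).mul (contMDiffAt_det fun k l => ?_)
  by_cases hk : k = j
  · subst hk
    simpa using contMDiffAt_const
  · simpa [Matrix.updateRow_apply, hk] using hA k l

/-- The coefficients of the Levi-Civita connection in an orthonormal frame with structure
functions `c`: `∇_{e a} (e b) = ∑ d, connCoeff c a b d • e d`. -/
noncomputable def connCoeff (c : Fin m → Fin m → Fin m → M → ℝ) (a b d : Fin m) (x : M) : ℝ :=
  1 / 2 * (c a b d x + c d a b x + c d b a x)

theorem fderiv_eq_sum_pderiv (F : EuclideanSpace ℝ (Fin m) → ℝ) (u v : EuclideanSpace ℝ (Fin m)) :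
    fderiv ℝ F u v = ∑ i, v i * pderiv i F u := by
  have h2 := (EuclideanSpace.basisFun (Fin m) ℝ).sum_repr v
  conv_lhs => rw [← h2]
  simp [pderiv]

theorem comp_chart_comp_symm {p x : M} (hx : x ∈ (extChartAt (𝓡 m) p).source)
    (F : EuclideanSpace ℝ (Fin m) → ℝ) :
    (fun u => F (extChartAt (𝓡 m) p ((extChartAt (𝓡 m) p).symm u)))
      =ᶠ[nhds (extChartAt (𝓡 m) p x)] F := by
  filter_upwards [target_mem_nhds ((extChartAt (𝓡 m) p).map_source hx)] with u hu
  rw [(extChartAt (𝓡 m) p).right_inv hu]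

theorem pderiv_congr {F G : EuclideanSpace ℝ (Fin m) → ℝ} {u : EuclideanSpace ℝ (Fin m)}
    (h : F =ᶠ[nhds u] G) (i : Fin m) : pderiv i F u = pderiv i G u := by
  unfold pderiv
  rw [h.fderiv_eq]

theorem contDiffAt_pderiv {F : EuclideanSpace ℝ (Fin m) → ℝ} {u : EuclideanSpace ℝ (Fin m)}
    (h : ContDiffAt ℝ ∞ F u) (i : Fin m) : ContDiffAt ℝ ∞ (pderiv i F) u :=
  (h.fderiv_right (by simp)).clm_apply contDiffAt_const

variable [IsManifold (𝓡 m) ∞ M]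

/-- The components of a tangent vector in the chart at `p`. -/
noncomputable def chartComp (p x : M) (v : TangentSpace (𝓡 m) x) (i : Fin m) : ℝ :=
  let w : EuclideanSpace ℝ (Fin m) :=
    mfderiv (𝓡 m) 𝓘(ℝ, EuclideanSpace ℝ (Fin m)) (extChartAt (𝓡 m) p) x v
  w i

/-- This allows the components of a field to be carried as the functions X(xⁱ). Differentiating a
frame then means iterating `dirDeriv` on coordinate functions. -/
theorem dirDeriv_coord {p x : M} (hx : x ∈ (extChartAt (𝓡 m) p).source)
    (X : (x : M) → TangentSpace (𝓡 m) x) (i : Fin m) :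
    dirDeriv X (coord p i) x = chartComp p x (X x) i := by
  have h1 : MDifferentiableAt (𝓡 m) 𝓘(ℝ, EuclideanSpace ℝ (Fin m)) (extChartAt (𝓡 m) p) x :=
    mdifferentiableAt_extChartAt (mem_chartAt_source hx)
  have h2 : HasMFDerivAt 𝓘(ℝ, EuclideanSpace ℝ (Fin m)) 𝓘(ℝ, ℝ)
      (fun u : EuclideanSpace ℝ (Fin m) => u i) (extChartAt (𝓡 m) p x)
      (EuclideanSpace.proj (𝕜 := ℝ) i) :=
    (EuclideanSpace.proj (𝕜 := ℝ) i : EuclideanSpace ℝ (Fin m) →L[ℝ] ℝ).hasMFDerivAt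
  have h3 := (h2.comp x h1.hasMFDerivAt).mfderiv
  exact congrArg (fun L : TangentSpace (𝓡 m) x →L[ℝ] ℝ => L (X x)) h3

theorem chartField_apply {p x : M} (hx : x ∈ (extChartAt (𝓡 m) p).source)
    (X : (x : M) → TangentSpace (𝓡 m) x) (i : Fin m) :
    chartField p X (extChartAt (𝓡 m) p x) i = dirDeriv X (coord p i) x := by
  rw [dirDeriv_coord hx]
  unfold chartField chartComp
  rw [(extChartAt (𝓡 m) p).left_inv hx]

theorem dirDeriv_eq_sum_pderiv {p x : M} (hx : x ∈ (extChartAt (𝓡 m) p).source) {f : M → ℝ}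
    (hf : MDifferentiableAt (𝓡 m) 𝓘(ℝ, ℝ) f x) (X : (x : M) → TangentSpace (𝓡 m) x) :
    dirDeriv X f x = ∑ i, dirDeriv X (coord p i) x *
      pderiv i (fun u => f ((extChartAt (𝓡 m) p).symm u)) (extChartAt (𝓡 m) p x) := by
  rw [dirDeriv_eq_fderiv hx hf, fderiv_eq_sum_pderiv]
  simp only [chartField_apply hx]

theorem dirDeriv_comp_chart {p x : M} (hx : x ∈ (extChartAt (𝓡 m) p).source)
    {F : EuclideanSpace ℝ (Fin m) → ℝ} (hF : ContDiffAt ℝ ∞ F (extChartAt (𝓡 m) p x))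
    (X : (x : M) → TangentSpace (𝓡 m) x) :
    dirDeriv X (fun y => F (extChartAt (𝓡 m) p y)) x =
      ∑ i, dirDeriv X (coord p i) x * pderiv i F (extChartAt (𝓡 m) p x) := by
  rw [dirDeriv_eq_sum_pderiv hx ((contMDiffAt_comp_chart hx hF).mdifferentiableAt (by simp))]
  simp only [pderiv_congr (comp_chart_comp_symm hx F)]

/-- The components `X(Y(f))` of second derivatives in a chart. -/
theorem dirDeriv_dirDeriv_eq {p x : M} (hx : x ∈ (extChartAt (𝓡 m) p).source) {f : M → ℝ}
    (hf : ContMDiffAt (𝓡 m) 𝓘(ℝ, ℝ) ∞ f x) (X : (x : M) → TangentSpace (𝓡 m) x)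
    {Y : (x : M) → TangentSpace (𝓡 m) x}
    (hY : ContMDiffAt (𝓡 m) (𝓡 m).tangent ∞ (fun x => (⟨x, Y x⟩ : TangentBundle (𝓡 m) M)) x) :
    dirDeriv X (dirDeriv Y f) x =
      ∑ k, dirDeriv X (dirDeriv Y (coord p k)) x *
          pderiv k (fun u => f ((extChartAt (𝓡 m) p).symm u)) (extChartAt (𝓡 m) p x) +
      ∑ i, ∑ k, dirDeriv X (coord p i) x * dirDeriv Y (coord p k) x *
          pderiv i (pderiv k (fun u => f ((extChartAt (𝓡 m) p).symm u))) (extChartAt (𝓡 m) p x) := by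
  have hF := contDiffAt_comp_symm hx hf
  set F := fun u => f ((extChartAt (𝓡 m) p).symm u) with hFdef
  have h1 : dirDeriv Y f =ᶠ[nhds x] fun y => ∑ k, dirDeriv Y (coord p k) y *
      pderiv k F (extChartAt (𝓡 m) p y) := by
    filter_upwards [source_mem_nhds hx, eventually_mdifferentiableAt hf] with y hy hy'
    exact dirDeriv_eq_sum_pderiv hy hy' Y
  have h2 : ∀ k, ContMDiffAt (𝓡 m) 𝓘(ℝ, ℝ) ∞ (dirDeriv Y (coord p k)) x :=
    fun k => contMDiffAt_dirDeriv (contMDiffAt_coord hx k) hY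
  have h3 : ∀ k, ContMDiffAt (𝓡 m) 𝓘(ℝ, ℝ) ∞ (fun y => pderiv k F (extChartAt (𝓡 m) p y)) x :=
    fun k => contMDiffAt_comp_chart hx (contDiffAt_pderiv hF k)
  rw [dirDeriv_congr h1, dirDeriv_sum _ fun k _ => contMDiffAt_mul (h2 k) (h3 k)]
  simp only [dirDeriv_mul (h2 _) (h3 _), dirDeriv_comp_chart hx (contDiffAt_pderiv hF _),
    Finset.sum_add_distrib, Finset.mul_sum]
  congr 1
  rw [Finset.sum_comm]
  exact Finset.sum_congr rfl fun i _ => Finset.sum_congr rfl fun j _ => by ring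

variable [RiemannianBundle (fun x : M => TangentSpace (𝓡 m) x)]

theorem inner_eq_sum_metricMatrix {p x : M} (hx : x ∈ (extChartAt (𝓡 m) p).source)
    (v w : TangentSpace (𝓡 m) x) :
    inner ℝ v w = ∑ i, ∑ j, metricMatrix p (extChartAt (𝓡 m) p x) i j *
      chartComp p x v i * chartComp p x w j := by
  obtain ⟨u, hu, rfl⟩ : ∃ u ∈ (extChartAt (𝓡 m) p).target, (extChartAt (𝓡 m) p).symm u = x :=
    ⟨_, (extChartAt (𝓡 m) p).map_source hx, (extChartAt (𝓡 m) p).left_inv hx⟩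
  -- Apply the derivative of the inverse chart to the expansion, in the standard basis, of the image
  -- of `v` under the derivative of the chart.
  have key : ∀ v : TangentSpace (𝓡 m) ((extChartAt (𝓡 m) p).symm u),
      v = ∑ i, chartComp p _ v i • coordVec p u i := by
    intro v
    have h1 := congrArg (fun L => L v)
      (mfderivWithin_extChartAt_symm_comp_mfderiv_extChartAt (I := 𝓡 m) hu)
    rw [ModelWithCorners.range_eq_univ, mfderivWithin_univ] at h1
    refine h1.symm.trans ?_
    have h2 := (EuclideanSpace.basisFun (Fin m) ℝ).sum_repr
      (mfderiv (𝓡 m) 𝓘(ℝ, EuclideanSpace ℝ (Fin m)) (extChartAt (𝓡 m) p)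
        ((extChartAt (𝓡 m) p).symm u) v)
    refine (congrArg (fun z : EuclideanSpace ℝ (Fin m) =>
      (mfderiv (𝓡 m) (𝓡 m) (extChartAt (𝓡 m) p).symm u z)) h2.symm).trans ?_
    refine (map_sum (mfderiv (𝓡 m) (𝓡 m) (extChartAt (𝓡 m) p).symm u) _ _).trans ?_
    refine Finset.sum_congr rfl fun i _ => ?_
    refine (map_smul (mfderiv (𝓡 m) (𝓡 m) (extChartAt (𝓡 m) p).symm u) _ _).trans ?_
    simp only [EuclideanSpace.basisFun_apply]
    rfl
  rw [(extChartAt (𝓡 m) p).right_inv hu]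
  conv_lhs => rw [key v, key w]
  simp only [sum_inner, inner_sum, inner_smul_left, inner_smul_right, Finset.mul_sum]
  rw [Finset.sum_comm]
  exact Finset.sum_congr rfl fun i _ => Finset.sum_congr rfl fun j _ => by
    simp only [metricMatrix, Matrix.of_apply, RCLike.conj_to_real]; ring

/-- A smooth orthonormal frame `e` on the open set `U` with
`[e a, e b] = ∑ d, c a b d • e d`. -/
structure IsFrame (U : Set M) (e : Fin m → (x : M) → TangentSpace (𝓡 m) x)
    (c : Fin m → Fin m → Fin m → M → ℝ) : Prop where
  isOpen : IsOpen U
  smooth : ∀ a, ∀ x ∈ U, ContMDiffAt (𝓡 m) (𝓡 m).tangent ∞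
    (fun x => (⟨x, e a x⟩ : TangentBundle (𝓡 m) M)) x
  orthonormal : ∀ x ∈ U, Orthonormal ℝ (fun a => e a x)
  smooth_coeff : ∀ a b d, ∀ x ∈ U, ContMDiffAt (𝓡 m) 𝓘(ℝ, ℝ) ∞ (c a b d) x
  bracket : ∀ a b, ∀ x ∈ U,
    VectorField.mlieBracket (𝓡 m) (e a) (e b) x = ∑ d, c a b d x • e d x

variable {U : Set M} {e : Fin m → (x : M) → TangentSpace (𝓡 m) x}
  {c : Fin m → Fin m → Fin m → M → ℝ}

/-- The bracket hypothesis in the form used later: applied to coordinates it is torsion-freeness,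
and applied to e_b(x^k) it commutes derivatives in the curvature computation. -/
theorem IsFrame.commutator (hfr : IsFrame U e c) {x : M} (hx : x ∈ U) {f : M → ℝ}
    (hf : ContMDiffAt (𝓡 m) 𝓘(ℝ, ℝ) ∞ f x) (a b : Fin m) :
    dirDeriv (e a) (dirDeriv (e b) f) x - dirDeriv (e b) (dirDeriv (e a) f) x =
      ∑ d, c a b d x * dirDeriv (e d) f x := by
  rw [← dirDeriv_mlieBracket hf (hfr.smooth a x hx) (hfr.smooth b x hx)]
  unfold dirDeriv
  rw [hfr.bracket a b x hx]
  refine (map_sum _ _ _).trans (Finset.sum_congr rfl fun d _ => map_smul _ _ _)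

theorem IsFrame.sum_metric (hfr : IsFrame U e c) {p x : M}
    (hp : x ∈ (extChartAt (𝓡 m) p).source) (hx : x ∈ U) (a b : Fin m) :
    ∑ i, ∑ j, metricMatrix p (extChartAt (𝓡 m) p x) i j * dirDeriv (e a) (coord p i) x *
      dirDeriv (e b) (coord p j) x = if a = b then 1 else 0 := by
  rw [← (orthonormal_iff_ite.1 (hfr.orthonormal x hx)) a b, inner_eq_sum_metricMatrix hp]
  simp only [dirDeriv_coord hp]

theorem metricMatrix_symm (p : M) (u : EuclideanSpace ℝ (Fin m)) (i j : Fin m) :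
    metricMatrix p u i j = metricMatrix p u j i := by
  simp only [metricMatrix, Matrix.of_apply]
  exact real_inner_comm _ _

theorem IsFrame.metric_inv (hfr : IsFrame U e c) {p x : M}
    (hp : x ∈ (extChartAt (𝓡 m) p).source) (hx : x ∈ U) (i j : Fin m) :
    (metricMatrix p (extChartAt (𝓡 m) p x))⁻¹ i j =
      ∑ a, dirDeriv (e a) (coord p i) x * dirDeriv (e a) (coord p j) x := by
  rw [(inv_eq_sum_of_orthonormal (hfr.sum_metric hp hx)).1]
  rfl

/-- The smooth frame determines the metric: its matrix is the inverse of Eᵀ E, whose entries are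
smooth and whose determinant is a unit. -/
theorem IsFrame.contMDiffAt_metric (hfr : IsFrame U e c) {p x : M}
    (hp : x ∈ (extChartAt (𝓡 m) p).source) (hx : x ∈ U) (i j : Fin m) :
    ContMDiffAt (𝓡 m) 𝓘(ℝ, ℝ) ∞ (fun y => metricMatrix p (extChartAt (𝓡 m) p y) i j) x := by
  have h1 : ∀ y, y ∈ (extChartAt (𝓡 m) p).source → y ∈ U →
      metricMatrix p (extChartAt (𝓡 m) p y) =
      (Matrix.of fun i j : Fin m => ∑ a, dirDeriv (e a) (coord p i) y * dirDeriv (e a) (coord p j) y)⁻¹ ∧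
      IsUnit (Matrix.of fun i j : Fin m => ∑ a, dirDeriv (e a) (coord p i) y *
        dirDeriv (e a) (coord p j) y).det := by
    intro y hy hyU
    obtain ⟨-, h2, h3⟩ := inv_eq_sum_of_orthonormal (hfr.sum_metric hy hyU)
    exact ⟨(Matrix.inv_eq_left_inv h2).symm, Matrix.isUnit_det_of_left_inverse h2⟩
  have h2 : ContMDiffAt (𝓡 m) 𝓘(ℝ, ℝ) ∞ (fun y => (Matrix.of fun i j : Fin m => ∑ a,
      dirDeriv (e a) (coord p i) y * dirDeriv (e a) (coord p j) y)⁻¹ i j) x := by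
    have h3 : ∀ k l, ContMDiffAt (𝓡 m) 𝓘(ℝ, ℝ) ∞ (fun y =>
        (Matrix.of fun i j : Fin m => ∑ a, dirDeriv (e a) (coord p i) y *
          dirDeriv (e a) (coord p j) y) k l) x := by
      intro k l
      simp only [Matrix.of_apply]
      exact contMDiffAt_sum _ fun a _ => contMDiffAt_mul
        (contMDiffAt_dirDeriv (contMDiffAt_coord hp k) (hfr.smooth a x hx))
        (contMDiffAt_dirDeriv (contMDiffAt_coord hp l) (hfr.smooth a x hx))
    exact contMDiffAt_matrix_inv h3 (h1 x hp hx).2.ne_zero i j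
  refine h2.congr_of_eventuallyEq ?_
  filter_upwards [source_mem_nhds hp, hfr.isOpen.mem_nhds hx] with y hy hyU
  rw [(h1 y hy hyU).1]

theorem IsFrame.contDiffAt_metric (hfr : IsFrame U e c) {p x : M}
    (hp : x ∈ (extChartAt (𝓡 m) p).source) (hx : x ∈ U) (i j : Fin m) :
    ContDiffAt ℝ ∞ (fun u => metricMatrix p u i j) (extChartAt (𝓡 m) p x) :=
  (contDiffAt_comp_symm hp (hfr.contMDiffAt_metric hp hx i j)).congr_of_eventuallyEq
    (comp_chart_comp_symm hp fun u => metricMatrix p u i j).symm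

/-- The Koszul formula: the Levi-Civita connection of a chart in an orthonormal frame. -/
theorem IsFrame.koszul (hfr : IsFrame U e c) {p x : M}
    (hp : x ∈ (extChartAt (𝓡 m) p).source) (hx : x ∈ U) (a b k : Fin m) :
    dirDeriv (e a) (dirDeriv (e b) (coord p k)) x +
      ∑ i, ∑ j, christoffel p (extChartAt (𝓡 m) p x) k i j * dirDeriv (e a) (coord p i) x *
        dirDeriv (e b) (coord p j) x =
      ∑ d, connCoeff c a b d x * dirDeriv (e d) (coord p k) x := by
  have hE : ∀ a k, ContMDiffAt (𝓡 m) 𝓘(ℝ, ℝ) ∞ (dirDeriv (e a) (coord p k)) x :=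
    fun a k => contMDiffAt_dirDeriv (contMDiffAt_coord hp k) (hfr.smooth a x hx)
  have hγ := hfr.contMDiffAt_metric hp hx
  refine koszul_algebra (γ := metricMatrix p (extChartAt (𝓡 m) p x))
    (E := fun a i => dirDeriv (e a) (coord p i) x)
    (T := fun a b k => dirDeriv (e a) (dirDeriv (e b) (coord p k)) x)
    (dγ := fun k i j => pderiv k (fun w => metricMatrix p w i j) (extChartAt (𝓡 m) p x))
    (c := fun a b d => c a b d x) (hfr.sum_metric hp hx) (metricMatrix_symm p _) ?_ ?_ a b k
  -- The relation γ(e_b, e_d) = δ holds near `x`, so its derivative along e_a vanishes; the product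
  -- rule gives metric compatibility.
  · intro a b d
    have h0 : (fun y => ∑ i, ∑ j, metricMatrix p (extChartAt (𝓡 m) p y) i j *
        dirDeriv (e b) (coord p i) y * dirDeriv (e d) (coord p j) y) =ᶠ[nhds x]
        fun _ => if b = d then 1 else 0 := by
      filter_upwards [source_mem_nhds hp, hfr.isOpen.mem_nhds hx] with y hy hyU
      exact hfr.sum_metric hy hyU b d
    have h1 := dirDeriv_congr h0 (e a)
    rw [dirDeriv_const, dirDeriv_sum _ fun i _ => contMDiffAt_sum _ fun j _ =>
      contMDiffAt_mul (contMDiffAt_mul (hγ i j) (hE b i)) (hE d j)] at h1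
    simp only [dirDeriv_sum _ fun j _ =>
        contMDiffAt_mul (contMDiffAt_mul (hγ _ j) (hE b _)) (hE d j),
      dirDeriv_mul (contMDiffAt_mul (hγ _ _) (hE b _)) (hE d _), dirDeriv_mul (hγ _ _) (hE b _),
      dirDeriv_comp_chart hp (hfr.contDiffAt_metric hp hx _ _)] at h1
    have h2 : ∀ X : Fin m → Fin m → Fin m → ℝ,
        ∑ k, ∑ i, ∑ j, X k i j = ∑ i, ∑ j, ∑ k, X k i j := by
      intro X
      rw [Finset.sum_comm]
      exact Finset.sum_congr rfl fun i _ => Finset.sum_comm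
    rw [← h1, h2]
    simp only [← Finset.sum_add_distrib]
    refine Finset.sum_congr rfl fun i _ => Finset.sum_congr rfl fun j _ => ?_
    rw [add_mul, Finset.sum_mul, Finset.sum_mul]
  · intro a b k
    exact hfr.commutator hx (contMDiffAt_coord hp k) a b

/-- The trace of the Hessian of a function, in a chart and in an orthonormal frame. -/
theorem IsFrame.trace_hessian (hfr : IsFrame U e c) {p x : M}
    (hp : x ∈ (extChartAt (𝓡 m) p).source) (hx : x ∈ U) {f : M → ℝ}
    (hf : ContMDiffAt (𝓡 m) 𝓘(ℝ, ℝ) ∞ f x) :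
    ∑ i, ∑ j, (metricMatrix p (extChartAt (𝓡 m) p x))⁻¹ i j *
      (pderiv i (pderiv j fun w => f ((extChartAt (𝓡 m) p).symm w)) (extChartAt (𝓡 m) p x) -
        ∑ k, christoffel p (extChartAt (𝓡 m) p x) k i j *
          pderiv k (fun w => f ((extChartAt (𝓡 m) p).symm w)) (extChartAt (𝓡 m) p x)) =
      ∑ s, (dirDeriv (e s) (dirDeriv (e s) f) x -
        ∑ d, connCoeff c s s d x * dirDeriv (e d) f x) := by
  simp only [dirDeriv_dirDeriv_eq hp hf _ (hfr.smooth _ x hx),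
    dirDeriv_eq_sum_pderiv hp (hf.mdifferentiableAt (by simp)), hfr.metric_inv hp hx]
  set F : EuclideanSpace ℝ (Fin m) → ℝ := fun w => f ((extChartAt (𝓡 m) p).symm w)
  set u := extChartAt (𝓡 m) p x
  set E : Fin m → Fin m → ℝ := fun a i => dirDeriv (e a) (coord p i) x with hE
  -- By Koszul the connection term is the coordinate derivative of e_s along itself plus a
  -- Christoffel term. The former cancels the first-order part of e_s(e_s f), so only the coordinate
  -- Hessian contracted with e_s ⊗ e_s remains.
  have hk : ∀ s, ∑ d, connCoeff c s s d x * ∑ i, E d i * pderiv i F u =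
      ∑ k, (dirDeriv (e s) (dirDeriv (e s) (coord p k)) x +
        ∑ i, ∑ j, christoffel p u k i j * E s i * E s j) * pderiv k F u := by
    intro s
    simp only [hE, u, hfr.koszul hp hx, Finset.mul_sum, Finset.sum_mul]
    rw [Finset.sum_comm]
    exact Finset.sum_congr rfl fun i _ => Finset.sum_congr rfl fun j _ => by ring
  change _ = ∑ s, (_ - ∑ d, connCoeff c s s d x * ∑ i, E d i * pderiv i F u)
  simp only [hk]
  have h1 : ∀ s, ∑ k, dirDeriv (e s) (dirDeriv (e s) (coord p k)) x * pderiv k F u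
      + ∑ i, ∑ k, E s i * E s k * pderiv i (pderiv k F) u
      - ∑ k, (dirDeriv (e s) (dirDeriv (e s) (coord p k)) x +
        ∑ i, ∑ j, christoffel p u k i j * E s i * E s j) * pderiv k F u
      = ∑ i, ∑ j, E s i * E s j * (pderiv i (pderiv j F) u
        - ∑ k, christoffel p u k i j * pderiv k F u) := by
    intro s
    have h2 : ∑ k, (∑ i, ∑ j, christoffel p u k i j * E s i * E s j) * pderiv k F u =
        ∑ i, ∑ j, E s i * E s j * ∑ k, christoffel p u k i j * pderiv k F u := by
      simp only [Finset.mul_sum, Finset.sum_mul]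
      rw [Finset.sum_comm]
      refine Finset.sum_congr rfl fun i _ => ?_
      rw [Finset.sum_comm]
      exact Finset.sum_congr rfl fun j _ => Finset.sum_congr rfl fun k _ => by ring
    simp only [add_mul, Finset.sum_add_distrib, mul_sub, Finset.sum_sub_distrib, h2]
    ring
  refine Eq.trans ?_ (Finset.sum_congr rfl fun s _ => (h1 s).symm)
  conv_rhs => rw [Finset.sum_comm]
  refine Finset.sum_congr rfl fun i _ => ?_
  conv_rhs => rw [Finset.sum_comm]
  refine Finset.sum_congr rfl fun j _ => ?_
  rw [Finset.sum_mul]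

theorem IsFrame.laplacian_eq (hfr : IsFrame U e c) {x : M} (hx : x ∈ U) {f : M → ℝ}
    (hf : ContMDiffAt (𝓡 m) 𝓘(ℝ, ℝ) ∞ f x) :
    laplacian (m := m) f x = ∑ s, (dirDeriv (e s) (dirDeriv (e s) f) x -
        ∑ d, connCoeff c s s d x * dirDeriv (e d) f x) :=
  hfr.trace_hessian (mem_extChartAt_source x) hx hf
end Frame

/-! ### Gauss curvature of a surface in an orthonormal frame -/

section Christoffel

variable {m : ℕ} {M : Type*} [TopologicalSpace M] [ChartedSpace (EuclideanSpace ℝ (Fin m)) M]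

theorem contMDiffAt_add {f g : M → ℝ} {x : M} (hf : ContMDiffAt (𝓡 m) 𝓘(ℝ, ℝ) ∞ f x)
    (hg : ContMDiffAt (𝓡 m) 𝓘(ℝ, ℝ) ∞ g x) :
    ContMDiffAt (𝓡 m) 𝓘(ℝ, ℝ) ∞ (fun y => f y + g y) x := hf.add hg

theorem contMDiffAt_sub {f g : M → ℝ} {x : M} (hf : ContMDiffAt (𝓡 m) 𝓘(ℝ, ℝ) ∞ f x)
    (hg : ContMDiffAt (𝓡 m) 𝓘(ℝ, ℝ) ∞ g x) :
    ContMDiffAt (𝓡 m) 𝓘(ℝ, ℝ) ∞ (fun y => f y - g y) x := hf.sub hg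

theorem contMDiffAt_const_mul (r : ℝ) {f : M → ℝ} {x : M}
    (hf : ContMDiffAt (𝓡 m) 𝓘(ℝ, ℝ) ∞ f x) :
    ContMDiffAt (𝓡 m) 𝓘(ℝ, ℝ) ∞ (fun y => r * f y) x := contMDiffAt_const.mul hf

variable [RiemannianBundle (fun x : M => TangentSpace (𝓡 m) x)] [IsManifold (𝓡 m) ∞ M]
  {U : Set M} {e : Fin m → (x : M) → TangentSpace (𝓡 m) x} {c : Fin m → Fin m → Fin m → M → ℝ}

theorem IsFrame.contMDiffAt_connCoeff (hfr : IsFrame U e c) {x : M} (hx : x ∈ U)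
    (a b d : Fin m) : ContMDiffAt (𝓡 m) 𝓘(ℝ, ℝ) ∞ (connCoeff c a b d) x :=
  contMDiffAt_const_mul _ (contMDiffAt_add (contMDiffAt_add (hfr.smooth_coeff _ _ _ x hx)
    (hfr.smooth_coeff _ _ _ x hx)) (hfr.smooth_coeff _ _ _ x hx))

theorem IsFrame.contMDiffAt_comp (hfr : IsFrame U e c) {p x : M}
    (hp : x ∈ (extChartAt (𝓡 m) p).source) (hx : x ∈ U) (a k : Fin m) :
    ContMDiffAt (𝓡 m) 𝓘(ℝ, ℝ) ∞ (dirDeriv (e a) (coord p k)) x :=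
  contMDiffAt_dirDeriv (contMDiffAt_coord hp k) (hfr.smooth a x hx)

theorem IsFrame.contMDiffAt_christoffel (hfr : IsFrame U e c) {p x : M}
    (hp : x ∈ (extChartAt (𝓡 m) p).source) (hx : x ∈ U) (k i j : Fin m) :
    ContMDiffAt (𝓡 m) 𝓘(ℝ, ℝ) ∞ (fun y => christoffel p (extChartAt (𝓡 m) p y) k i j) x := by
  have h1 : ∀ l i j, ContMDiffAt (𝓡 m) 𝓘(ℝ, ℝ) ∞ (fun y =>
      pderiv l (fun w => metricMatrix p w i j) (extChartAt (𝓡 m) p y)) x := fun l i j =>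
    contMDiffAt_comp_chart hp (contDiffAt_pderiv (hfr.contDiffAt_metric hp hx i j) l)
  have h2 : ∀ l, ContMDiffAt (𝓡 m) 𝓘(ℝ, ℝ) ∞ (fun y =>
      (metricMatrix p (extChartAt (𝓡 m) p y))⁻¹ k l) x := by
    intro l
    refine (contMDiffAt_sum Finset.univ fun a _ => contMDiffAt_mul (hfr.contMDiffAt_comp hp hx a k)
      (hfr.contMDiffAt_comp hp hx a l)).congr_of_eventuallyEq ?_
    filter_upwards [source_mem_nhds hp, hfr.isOpen.mem_nhds hx] with y hy hyU
    exact hfr.metric_inv hy hyU k l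
  exact contMDiffAt_const_mul _ (contMDiffAt_sum _ fun l _ => contMDiffAt_mul (h2 l)
    (contMDiffAt_sub (contMDiffAt_add (h1 _ _ _) (h1 _ _ _)) (h1 _ _ _)))

theorem IsFrame.contDiffAt_christoffel (hfr : IsFrame U e c) {p x : M}
    (hp : x ∈ (extChartAt (𝓡 m) p).source) (hx : x ∈ U) (k i j : Fin m) :
    ContDiffAt ℝ ∞ (fun u => christoffel p u k i j) (extChartAt (𝓡 m) p x) :=
  (contDiffAt_comp_symm hp (hfr.contMDiffAt_christoffel hp hx k i j)).congr_of_eventuallyEq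
    (comp_chart_comp_symm hp fun u => christoffel p u k i j).symm

/-- The derivative of the Koszul formula along a frame vector. -/
theorem IsFrame.dirDeriv_koszul (hfr : IsFrame U e c) {p x : M}
    (hp : x ∈ (extChartAt (𝓡 m) p).source) (hx : x ∈ U) (f a b k : Fin m) :
    dirDeriv (e f) (dirDeriv (e a) (dirDeriv (e b) (coord p k))) x +
      ∑ i, ∑ j, (((∑ s, dirDeriv (e f) (coord p s) x *
          pderiv s (fun w => christoffel p w k i j) (extChartAt (𝓡 m) p x)) *
            dirDeriv (e a) (coord p i) x +
        christoffel p (extChartAt (𝓡 m) p x) k i j *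
          dirDeriv (e f) (dirDeriv (e a) (coord p i)) x) * dirDeriv (e b) (coord p j) x +
        christoffel p (extChartAt (𝓡 m) p x) k i j * dirDeriv (e a) (coord p i) x *
          dirDeriv (e f) (dirDeriv (e b) (coord p j)) x) =
      ∑ d, (dirDeriv (e f) (connCoeff c a b d) x * dirDeriv (e d) (coord p k) x +
        connCoeff c a b d x * dirDeriv (e f) (dirDeriv (e d) (coord p k)) x) := by
  have h0 : (fun y => dirDeriv (e a) (dirDeriv (e b) (coord p k)) y +
      ∑ i, ∑ j, christoffel p (extChartAt (𝓡 m) p y) k i j * dirDeriv (e a) (coord p i) y *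
        dirDeriv (e b) (coord p j) y) =ᶠ[nhds x]
      fun y => ∑ d, connCoeff c a b d y * dirDeriv (e d) (coord p k) y := by
    filter_upwards [source_mem_nhds hp, hfr.isOpen.mem_nhds hx] with y hy hyU
    exact hfr.koszul hy hyU a b k
  have hE := hfr.contMDiffAt_comp hp hx
  have hΓ := hfr.contMDiffAt_christoffel hp hx
  have h1 := dirDeriv_congr h0 (e f)
  have h3 : ∀ i j, ContMDiffAt (𝓡 m) 𝓘(ℝ, ℝ) ∞ (fun y =>
      christoffel p (extChartAt (𝓡 m) p y) k i j * dirDeriv (e a) (coord p i) y *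
        dirDeriv (e b) (coord p j) y) x := fun i j =>
    contMDiffAt_mul (contMDiffAt_mul (hΓ k i j) (hE a i)) (hE b j)
  rw [dirDeriv_add (contMDiffAt_dirDeriv (hE b k) (hfr.smooth a x hx))
      (contMDiffAt_sum _ fun i _ => contMDiffAt_sum _ fun j _ => h3 i j),
    dirDeriv_sum _ (fun i _ => contMDiffAt_sum _ fun j _ => h3 i j),
    dirDeriv_sum _ (fun d _ => contMDiffAt_mul (hfr.contMDiffAt_connCoeff hx a b d) (hE d k))] at h1
  simp only [dirDeriv_sum _ (fun j _ => h3 _ j),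
    dirDeriv_mul (hfr.contMDiffAt_connCoeff hx _ _ _) (hE _ _),
    dirDeriv_mul (contMDiffAt_mul (hΓ _ _ _) (hE _ _)) (hE _ _),
    dirDeriv_mul (hΓ _ _ _) (hE _ _),
    dirDeriv_comp_chart hp (hfr.contDiffAt_christoffel hp hx _ _ _)] at h1
  exact h1

end Christoffel

/-- The structure equation of a surface, as an identity between values at a point. -/
theorem surface_curvature_algebra {E : Fin 2 → Fin 2 → ℝ} {T S0 S1 Γ : Fin 2 → Fin 2 → Fin 2 → ℝ}
    {dΓ : Fin 2 → Fin 2 → Fin 2 → Fin 2 → ℝ} 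
    {w : Fin 2 → Fin 2 → Fin 2 → ℝ} {dw : Fin 2 → Fin 2 → Fin 2 → Fin 2 → ℝ}
    {c : Fin 2 → ℝ} {R : Fin 2 → Fin 2 → ℝ} 
    (hR : ∀ j k, R j k = dΓ 0 k 1 j - dΓ 1 k 0 j + ∑ s, (Γ k 0 s * Γ s 1 j - Γ k 1 s * Γ s 0 j))
    (hT : ∀ a b k, T a b k + ∑ i, ∑ j, Γ k i j * E a i * E b j = ∑ d, w a b d * E d k)
    (h0 : ∀ b k, S0 1 b k + ∑ i, ∑ j, (((∑ s, E 0 s * dΓ s k i j) * E 1 i + Γ k i j * T 0 1 i) * E b j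
      + Γ k i j * E 1 i * T 0 b j) = ∑ d, (dw 0 1 b d * E d k + w 1 b d * T 0 d k))
    (h1 : ∀ b k, S1 0 b k + ∑ i, ∑ j, (((∑ s, E 1 s * dΓ s k i j) * E 0 i + Γ k i j * T 1 0 i) * E b j
      + Γ k i j * E 0 i * T 1 b j) = ∑ d, (dw 1 0 b d * E d k + w 0 b d * T 1 d k))
    (htor : ∀ k, T 0 1 k - T 1 0 k = ∑ d, c d * E d k)
    (hcom : ∀ b k, S0 1 b k - S1 0 b k = ∑ d, c d * T d b k)
    (b k : Fin 2) :
    (E 0 0 * E 1 1 - E 0 1 * E 1 0) * ∑ j, R j k * E b j = ∑ g, (dw 0 1 b g - dw 1 0 b g +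
      ∑ d, (w 1 b d * w 0 d g - w 0 b d * w 1 d g - c d * w d b g)) * E g k := by
  simp only [hR]
  have a0 := h0 b k
  have a1 := h1 b k
  have ac := hcom b k
  have t0 := htor 0
  have t1 := htor 1
  have k00 := hT 0 b 0
  have k01 := hT 0 b 1
  have k10 := hT 1 b 0
  have k11 := hT 1 b 1
  have l00 := hT 0 0 k
  have l01 := hT 0 1 k
  have l10 := hT 1 0 k
  have l11 := hT 1 1 k
  have m0 := hT 0 b k
  have m1 := hT 1 b k
  simp only [Fin.sum_univ_two] at *
  -- Subtract the two differentiated Koszul formulas. `ac` removes the third derivatives, `t0` and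
  -- `t1` the torsion of the differentiated frame, and the Koszul formulas `k`, `l`, `m` the
  -- remaining first derivatives `T`. The factor on the left is the determinant of E, by which
  -- R(e_0, e_1) differs from R(∂_0, ∂_1).
  linear_combination a0 - a1 - ac - (Γ k 0 0 * E b 0 + Γ k 0 1 * E b 1) * t0
    - (Γ k 1 0 * E b 0 + Γ k 1 1 * E b 1) * t1
    - (Γ k 0 0 * E 1 0 + Γ k 1 0 * E 1 1) * k00 - (Γ k 0 1 * E 1 0 + Γ k 1 1 * E 1 1) * k01
    + (Γ k 0 0 * E 0 0 + Γ k 1 0 * E 0 1) * k10 + (Γ k 0 1 * E 0 0 + Γ k 1 1 * E 0 1) * k11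
    + w 1 b 0 * l00 + w 1 b 1 * l01 - w 0 b 0 * l10 - w 0 b 1 * l11
    - c 0 * m0 - c 1 * m1
/-- The alternating symbol in two indices. -/
def alt (a b : Fin 2) : ℝ := ![![0, 1], ![-1, 0]] a b

@[simp] theorem alt_zero_zero : alt 0 0 = 0 := rfl
@[simp] theorem alt_zero_one : alt 0 1 = 1 := rfl
@[simp] theorem alt_one_zero : alt 1 0 = -1 := rfl
@[simp] theorem alt_one_one : alt 1 1 = 0 := rfl

section Surface

variable {N : Type*} [TopologicalSpace N] [ChartedSpace (EuclideanSpace ℝ (Fin 2)) N]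

/-- The structure functions of a frame of a surface with `[ε 0, ε 1] = F 0 • ε 0 + F 1 • ε 1`. -/
noncomputable def surfaceCoeff (F : Fin 2 → N → ℝ) (a b d : Fin 2) (y : N) : ℝ := alt a b * F d y

/-- On a surface the connection is a single 1-form times the rotation by a right angle, and that
1-form takes the value F_a on ε_a. -/
theorem connCoeff_surfaceCoeff (F : Fin 2 → N → ℝ) (a b d : Fin 2) :
    connCoeff (surfaceCoeff F) a b d = fun y => alt d b * F a y := by
  funext y
  simp only [connCoeff, surfaceCoeff]
  fin_cases a <;> fin_cases b <;> fin_cases d <;> simp <;> ring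

theorem dirDeriv_const_mul {m : ℕ} {M : Type*} [TopologicalSpace M]
    [ChartedSpace (EuclideanSpace ℝ (Fin m)) M] (r : ℝ) {f : M → ℝ} {x : M}
    (hf : ContMDiffAt (𝓡 m) 𝓘(ℝ, ℝ) ∞ f x) (X : (x : M) → TangentSpace (𝓡 m) x) :
    dirDeriv X (fun y => r * f y) x = r * dirDeriv X f x := by
  rw [dirDeriv_mul contMDiffAt_const hf, dirDeriv_const]
  ring

variable [RiemannianBundle (fun y : N => TangentSpace (𝓡 2) y)] [IsManifold (𝓡 2) ∞ N]
  {V : Set N} {ε : Fin 2 → (y : N) → TangentSpace (𝓡 2) y} {F : Fin 2 → N → ℝ}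

/-- The Gauss curvature of a surface in an orthonormal frame. -/
theorem IsFrame.gaussCurvature_eq (hfr : IsFrame V ε (surfaceCoeff F))
    (hF : ∀ a, ∀ y ∈ V, ContMDiffAt (𝓡 2) 𝓘(ℝ, ℝ) ∞ (F a) y) {y : N} (hy : y ∈ V) :
    gaussCurvature y = dirDeriv (ε 0) (F 1) y - dirDeriv (ε 1) (F 0) y - F 0 y ^ 2 - F 1 y ^ 2 := by
  have hp := mem_extChartAt_source (I := 𝓡 2) y
  set K := dirDeriv (ε 0) (F 1) y - dirDeriv (ε 1) (F 0) y - F 0 y ^ 2 - F 1 y ^ 2 with hK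
  set u := extChartAt (𝓡 2) y y with hu
  set E : Fin 2 → Fin 2 → ℝ := fun a i => dirDeriv (ε a) (coord y i) y with hE
  set R : Fin 2 → Fin 2 → ℝ := fun j k => curvatureCoeff y u 0 1 j k with hR
  -- In frame terms, R(ε_0, ε_1) is `K` times the rotation: ε_1 goes to `K` ε_0 and ε_0 goes to -`K`
  -- ε_1.
  have key : ∀ b k, (E 0 0 * E 1 1 - E 0 1 * E 1 0) * ∑ j, R j k * E b j =
      K * ∑ g, alt g b * E g k := by
    intro b k
    rw [surface_curvature_algebra (E := E)
      (T := fun a b k => dirDeriv (ε a) (dirDeriv (ε b) (coord y k)) y)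
      (S0 := fun a b k => dirDeriv (ε 0) (dirDeriv (ε a) (dirDeriv (ε b) (coord y k))) y)
      (S1 := fun a b k => dirDeriv (ε 1) (dirDeriv (ε a) (dirDeriv (ε b) (coord y k))) y)
      (Γ := fun k i j => christoffel y u k i j)
      (dΓ := fun s k i j => pderiv s (fun w => christoffel y w k i j) u)
      (w := fun a b d => connCoeff (surfaceCoeff F) a b d y)
      (dw := fun f a b d => dirDeriv (ε f) (connCoeff (surfaceCoeff F) a b d) y)
      (c := fun d => surfaceCoeff F 0 1 d y) (R := R) (fun j k => rfl)
      (hfr.koszul hp hy) (fun b k => hfr.dirDeriv_koszul hp hy 0 1 b k)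
      (fun b k => hfr.dirDeriv_koszul hp hy 1 0 b k)
      (fun k => hfr.commutator hy (contMDiffAt_coord hp k) 0 1)
      (fun b k => hfr.commutator hy (hfr.contMDiffAt_comp hp hy b k) 0 1) b k]
    simp only [connCoeff_surfaceCoeff, dirDeriv_const_mul _ (hF _ y hy), surfaceCoeff]
    fin_cases b <;> simp [Fin.sum_univ_two, hK] <;> ring
  have hdetE : (E 0 0 * E 1 1 - E 0 1 * E 1 0) ^ 2 * (metricMatrix y u).det = 1 := by
    have hd : (Matrix.of E).det ^ 2 * (metricMatrix y u).det = 1 := by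
      have : Matrix.of E * metricMatrix y u * (Matrix.of E).transpose = 1 := by
        ext a b
        rw [Matrix.one_apply, ← hfr.sum_metric hp hy a b, Matrix.mul_assoc]
        simp only [Matrix.mul_apply, Matrix.of_apply, Matrix.transpose_apply, Finset.mul_sum]
        exact Finset.sum_congr rfl fun i _ => Finset.sum_congr rfl fun j _ => by
          simp only [hE]; ring
      have := congrArg Matrix.det this
      rw [Matrix.det_mul, Matrix.det_mul, Matrix.det_transpose, Matrix.det_one] at this
      rw [← this]; ring
    rw [Matrix.det_fin_two (Matrix.of E)] at hd
    exact hd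
  have hinv := hfr.metric_inv hp hy
  -- Solve for R(∂_0, ∂_1)∂_1: combining `key` for b = 1 and b = 0 with weights E_00 and -E_10
  -- eliminates ∂_0 and assembles the entry of the inverse metric on the right.
  have hR1 : ∀ k, (E 0 0 * E 1 1 - E 0 1 * E 1 0) ^ 2 * R 1 k =
      K * (metricMatrix y u)⁻¹ k 0 := by
    intro k
    rw [hinv k 0]
    have k0 := key 0 k
    have k1 := key 1 k
    simp only [Fin.sum_univ_two, alt_zero_zero, alt_one_zero, alt_zero_one, alt_one_one] at k0 k1 ⊢
    change _ = K * (E 0 k * E 0 0 + E 1 k * E 1 0)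
    linear_combination E 0 0 * k1 - E 1 0 * k0
  have hdet0 : (metricMatrix y u).det ≠ 0 := right_ne_zero_of_mul_eq_one hdetE
  have hD0 : (E 0 0 * E 1 1 - E 0 1 * E 1 0) ^ 2 ≠ 0 := left_ne_zero_of_mul_eq_one hdetE
  have hmul : ∑ l, (metricMatrix y u)⁻¹ l 0 * metricMatrix y u l 0 = 1 := by
    have := congrFun (congrFun (Matrix.mul_nonsing_inv (metricMatrix y u)
      (isUnit_iff_ne_zero.2 hdet0)) 0) 0
    rw [Matrix.mul_apply, Matrix.one_apply_eq] at this
    rw [← this]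
    exact Finset.sum_congr rfl fun l _ => by rw [metricMatrix_symm y u l 0, mul_comm]
  have hnum : (E 0 0 * E 1 1 - E 0 1 * E 1 0) ^ 2 * ∑ l, R 1 l * metricMatrix y u l 0 = K := by
    rw [Finset.mul_sum]
    calc _ = ∑ l, K * ((metricMatrix y u)⁻¹ l 0 * metricMatrix y u l 0) :=
          Finset.sum_congr rfl fun l _ => by rw [← mul_assoc, hR1]; ring
      _ = K := by rw [← Finset.mul_sum, hmul, mul_one]
  change (∑ l, R 1 l * metricMatrix y u l 0) / (metricMatrix y u).det = K
  rw [div_eq_iff hdet0]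
  refine mul_left_cancel₀ hD0 ?_
  rw [hnum]
  linear_combination -K * hdetE

end Surface

/-! ### The tension field in orthonormal frames -/

theorem sum_rotate {ι κ τ : Type*} [Fintype ι] [Fintype κ] [Fintype τ] (X : ι → κ → τ → ℝ) :
    ∑ i, ∑ j, ∑ s, X i j s = ∑ s, ∑ i, ∑ j, X i j s := by
  conv_rhs => rw [Finset.sum_comm]
  exact Finset.sum_congr rfl fun i _ => Finset.sum_comm

theorem sum_mul_sum_mul_sum {ι : Type*} [Fintype ι] (g : ℝ) (p q : ι → ℝ) :
    g * (∑ i, p i) * (∑ j, q j) = ∑ i, ∑ j, g * p i * q j := by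
  rw [mul_assoc, Finset.sum_mul_sum, Finset.mul_sum]
  exact Finset.sum_congr rfl fun i _ => by
    rw [Finset.mul_sum]
    exact Finset.sum_congr rfl fun j _ => (mul_assoc _ _ _).symm

/-- Used with γ⁻¹ = Eᵀ E: the coordinate trace of the target Christoffel term becomes a sum over the
frame of the source. -/
theorem sum_quadratic_of_factor {ι κ τ : Type*} [Fintype ι] [Fintype κ] [Fintype τ]
    (E : τ → ι → ℝ) (G : κ → κ → ℝ) (P : ι → κ → ℝ) :
    ∑ i, ∑ j, (∑ s, E s i * E s j) * ∑ b, ∑ d, G b d * P i b * P j d =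
      ∑ s, ∑ b, ∑ d, G b d * (∑ i, E s i * P i b) * (∑ i, E s i * P i d) := by
  simp only [sum_mul_sum_mul_sum]
  simp only [Finset.sum_mul]
  simp only [Finset.mul_sum]
  rw [sum_rotate]
  refine Finset.sum_congr rfl fun s _ => ?_
  rw [sum_rotate]
  refine Finset.sum_congr rfl fun b _ => ?_
  rw [sum_rotate]
  exact Finset.sum_congr rfl fun d _ => Finset.sum_congr rfl fun i _ =>
    Finset.sum_congr rfl fun j _ => by ring

/-- Matches the Christoffel term that Koszul's formula produces on the target with the one in the
definition of the tension field, so that they cancel. -/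
theorem sum_quadratic {ι κ : Type*} [Fintype ι] [Fintype κ]
    (A : ι → ℝ) (G : κ → κ → ℝ) (y : ι → κ → ℝ) :
    ∑ a, A a * ∑ d, A d * ∑ i, ∑ j, G i j * y d i * y a j =
      ∑ b, ∑ d, G b d * (∑ a, A a * y a b) * (∑ a, A a * y a d) := by
  simp only [sum_mul_sum_mul_sum]
  simp only [Finset.mul_sum]
  rw [Finset.sum_comm, sum_rotate]
  refine Finset.sum_congr rfl fun b _ => ?_
  rw [sum_rotate]
  exact Finset.sum_congr rfl fun d _ => Finset.sum_congr rfl fun i _ =>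
    Finset.sum_congr rfl fun j _ => by ring

theorem sum_connection {ι : Type*} [Fintype ι] (A z : ι → ℝ) (w : ι → ι → ι → ℝ) :
    ∑ a, A a * ∑ d, A d * ∑ g, w d a g * z g =
      ∑ g, (∑ b, ∑ d, w b d g * A b * A d) * z g := by
  simp only [Finset.sum_mul]
  simp only [Finset.mul_sum]
  rw [Finset.sum_comm, sum_rotate]
  exact Finset.sum_congr rfl fun d _ => Finset.sum_congr rfl fun i _ =>
    Finset.sum_congr rfl fun j _ => by ring

section Tension

variable {m n : ℕ} {M : Type*} [TopologicalSpace M] [ChartedSpace (EuclideanSpace ℝ (Fin m)) M]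
  [RiemannianBundle (fun x : M => TangentSpace (𝓡 m) x)] [IsManifold (𝓡 m) ∞ M]
  {U : Set M} {e : Fin m → (x : M) → TangentSpace (𝓡 m) x} {c : Fin m → Fin m → Fin m → M → ℝ}
  {N : Type*} [TopologicalSpace N] [ChartedSpace (EuclideanSpace ℝ (Fin n)) N]
  [RiemannianBundle (fun y : N => TangentSpace (𝓡 n) y)] [IsManifold (𝓡 n) ∞ N]
  {V : Set N} {ε : Fin n → (y : N) → TangentSpace (𝓡 n) y} {c' : Fin n → Fin n → Fin n → N → ℝ}

/-- The tension field in the frames `e`, `ε`, for a map `φ` with `dφ(e s) = ∑ a, A s a • ε a ∘ φ`. -/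
noncomputable def frameTension (e : Fin m → (x : M) → TangentSpace (𝓡 m) x)
    (c : Fin m → Fin m → Fin m → M → ℝ) (c' : Fin n → Fin n → Fin n → N → ℝ)
    (φ : M → N) (A : Fin m → Fin n → M → ℝ) (a : Fin n) (x : M) : ℝ :=
  ∑ s, (dirDeriv (e s) (A s a) x + ∑ b, ∑ d, connCoeff c' b d a (φ x) * A s b x * A s d x
    - ∑ r, connCoeff c s s r x * A r a x)

theorem eventually_dirDeriv_comp {φ : M → N} {x : M} (hφ : ContMDiffAt (𝓡 m) (𝓡 n) ∞ φ x)
    {A : Fin m → Fin n → M → ℝ}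
    (hdφ : ∀ᶠ z in nhds x, ∀ s, mfderiv (𝓡 m) (𝓡 n) φ z (e s z) = ∑ a, A s a z • ε a (φ z))
    {f : N → ℝ} (hf : ContMDiffAt (𝓡 n) 𝓘(ℝ, ℝ) ∞ f (φ x)) :
    ∀ᶠ z in nhds x, ∀ s,
      dirDeriv (e s) (fun z => f (φ z)) z = ∑ a, A s a z * dirDeriv (ε a) f (φ z) := by
  have h1 : ContMDiffAt (𝓡 m) (𝓡 n) 1 φ x := hφ.of_le (by simp)
  filter_upwards [hdφ, (contMDiffAt_iff_contMDiffAt_nhds (by simp)).1 h1,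
    hφ.continuousAt.eventually (eventually_mdifferentiableAt hf)] with z hz hφz hfz s
  have h2 : mfderiv (𝓡 m) 𝓘(ℝ, ℝ) (fun z => f (φ z)) z =
      (mfderiv (𝓡 n) 𝓘(ℝ, ℝ) f (φ z)).comp (mfderiv (𝓡 m) (𝓡 n) φ z) :=
    mfderiv_comp z hfz (hφz.mdifferentiableAt (by simp))
  unfold dirDeriv
  rw [h2]
  refine (congrArg (mfderiv (𝓡 n) 𝓘(ℝ, ℝ) f (φ z)) (hz s)).trans ?_
  exact (map_sum _ _ _).trans (Finset.sum_congr rfl fun d _ => map_smul _ _ _)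

/-- The part without target Christoffel symbols is the Laplacian of y^k ∘ φ, computed in the frame
`e`. Differentiating e_s(y^k ∘ φ) = Σ A_s^a ε_a(y^k) ∘ φ once more produces ε_d(ε_a y^k). Koszul's
formula on the target replaces these by connection coefficients minus a Christoffel term, which
cancels the quadratic term of the tension field. -/
theorem tensionIn_eq (hfr : IsFrame U e c) (hfr' : IsFrame V ε c') {φ : M → N} {x : M}
    (hx : x ∈ U) (hφ : ContMDiffAt (𝓡 m) (𝓡 n) ∞ φ x) (hφV : φ x ∈ V)
    {A : Fin m → Fin n → M → ℝ} (hA : ∀ s a, ContMDiffAt (𝓡 m) 𝓘(ℝ, ℝ) ∞ (A s a) x)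
    (hdφ : ∀ᶠ z in nhds x, ∀ s, mfderiv (𝓡 m) (𝓡 n) φ z (e s z) = ∑ a, A s a z • ε a (φ z))
    (k : Fin n) :
    tensionIn (m := m) (n := n) x (φ x) φ x k =
      ∑ a, frameTension e c c' φ A a x * dirDeriv (ε a) (coord (φ x) k) (φ x) := by
  have hp := mem_extChartAt_source (I := 𝓡 m) x
  have hq := mem_extChartAt_source (I := 𝓡 n) (φ x)
  set q := φ x with hq_def
  have hcomp : ∀ (f : N → ℝ), ContMDiffAt (𝓡 n) 𝓘(ℝ, ℝ) ∞ f q →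
      ContMDiffAt (𝓡 m) 𝓘(ℝ, ℝ) ∞ (fun z => f (φ z)) x := fun f hf =>
    ContMDiffAt.comp x (I' := 𝓡 n) hf hφ
  have hA' : ∀ b, ∀ᶠ z in nhds x, ∀ s, dirDeriv (e s) (fun z => coord q b (φ z)) z =
      ∑ a, A s a z * dirDeriv (ε a) (coord q b) (φ z) := fun b =>
    eventually_dirDeriv_comp hφ hdφ (contMDiffAt_coord hq b)
  have hy : ∀ b, ContMDiffAt (𝓡 m) 𝓘(ℝ, ℝ) ∞ (fun z => coord q b (φ z)) x := fun b =>
    hcomp _ (contMDiffAt_coord hq b)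
  have hεy : ∀ a b, ContMDiffAt (𝓡 m) 𝓘(ℝ, ℝ) ∞ (fun z => dirDeriv (ε a) (coord q b) (φ z)) x :=
    fun a b => hcomp _ (hfr'.contMDiffAt_comp hq hφV a b)
  have hsecond : ∀ s, dirDeriv (e s) (dirDeriv (e s) fun z => coord q k (φ z)) x =
      ∑ a, (dirDeriv (e s) (A s a) x * dirDeriv (ε a) (coord q k) q +
        A s a x * ∑ d, A s d x * dirDeriv (ε d) (dirDeriv (ε a) (coord q k)) q) := by
    intro s
    have h1 : dirDeriv (e s) (fun z => coord q k (φ z)) =ᶠ[nhds x]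
        fun z => ∑ a, A s a z * dirDeriv (ε a) (coord q k) (φ z) := by
      filter_upwards [hA' k] with z hz using hz s
    rw [dirDeriv_congr h1, dirDeriv_sum _ fun a _ => contMDiffAt_mul (hA s a) (hεy a k)]
    refine Finset.sum_congr rfl fun a _ => ?_
    rw [dirDeriv_mul (hA s a) (hεy a k),
      (eventually_dirDeriv_comp hφ hdφ (hfr'.contMDiffAt_comp hq hφV a k)).self_of_nhds s]
  -- The two sums are the Laplacian of the coordinate function y^k ∘ φ and the Christoffel term of
  -- the target.
  have hsplit : tensionIn (m := m) (n := n) x q φ x k =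
      ∑ s, (dirDeriv (e s) (dirDeriv (e s) fun z => coord q k (φ z)) x -
        ∑ d, connCoeff c s s d x * dirDeriv (e d) (fun z => coord q k (φ z)) x) +
      ∑ s, ∑ b, ∑ d, christoffel q (extChartAt (𝓡 n) q q) k b d *
        dirDeriv (e s) (fun z => coord q b (φ z)) x *
        dirDeriv (e s) (fun z => coord q d (φ z)) x := by
    rw [← hfr.trace_hessian hp hx (hy k)]
    simp only [dirDeriv_eq_sum_pderiv hp ((hy _).mdifferentiableAt (by simp))]
    unfold tensionIn
    simp only [mul_add, Finset.sum_add_distrib]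
    congr 1
    simp only [hfr.metric_inv hp hx]
    exact sum_quadratic_of_factor (fun s i => dirDeriv (e s) (coord x i) x) _ _
  rw [hsplit]
  simp only [hsecond, (hA' _).self_of_nhds]
  have hk := fun d a => hfr'.koszul hq hφV d a k
  simp only [← eq_sub_iff_add_eq] at hk
  simp only [hk]
  have h1 : ∀ s, ∑ a, (dirDeriv (e s) (A s a) x * dirDeriv (ε a) (coord q k) q +
        A s a x * ∑ d, A s d x * (∑ g, connCoeff c' d a g q * dirDeriv (ε g) (coord q k) q -
          ∑ i, ∑ j, christoffel q (extChartAt (𝓡 n) q q) k i j * dirDeriv (ε d) (coord q i) q *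
            dirDeriv (ε a) (coord q j) q)) =
      ∑ a, (dirDeriv (e s) (A s a) x + ∑ b, ∑ d, connCoeff c' b d a q * A s b x * A s d x) *
        dirDeriv (ε a) (coord q k) q -
      ∑ b, ∑ d, christoffel q (extChartAt (𝓡 n) q q) k b d *
        (∑ a, A s a x * dirDeriv (ε a) (coord q b) q) *
        (∑ a, A s a x * dirDeriv (ε a) (coord q d) q) := by
    intro s
    rw [← sum_quadratic (fun a => A s a x)]
    simp only [mul_sub, Finset.sum_sub_distrib, Finset.sum_add_distrib, add_mul]
    rw [sum_connection (fun a => A s a x)]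
    ring
  have h2 : ∀ s, ∑ d, connCoeff c s s d x * ∑ a, A d a x * dirDeriv (ε a) (coord q k) q =
      ∑ a, (∑ r, connCoeff c s s r x * A r a x) * dirDeriv (ε a) (coord q k) q := by
    intro s
    simp only [Finset.sum_mul, Finset.mul_sum]
    rw [Finset.sum_comm]
    exact Finset.sum_congr rfl fun i _ => Finset.sum_congr rfl fun j _ => by ring
  rw [← Finset.sum_add_distrib]
  unfold frameTension
  simp only [Finset.sum_mul]
  rw [Finset.sum_comm]
  refine Finset.sum_congr rfl fun s _ => ?_
  rw [← hq_def, h1, h2]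
  simp only [sub_mul, Finset.sum_sub_distrib]
  ring

/-- Orthonormality of ε removes the metric coefficients, which vary with the point φ(x). For a
variation only the components then have to be differentiated in t. -/
theorem tensionNormSq_eq (hfr : IsFrame U e c) (hfr' : IsFrame V ε c') {φ : M → N} {x : M}
    (hx : x ∈ U) (hφ : ContMDiffAt (𝓡 m) (𝓡 n) ∞ φ x) (hφV : φ x ∈ V)
    {A : Fin m → Fin n → M → ℝ} (hA : ∀ s a, ContMDiffAt (𝓡 m) 𝓘(ℝ, ℝ) ∞ (A s a) x)
    (hdφ : ∀ᶠ z in nhds x, ∀ s, mfderiv (𝓡 m) (𝓡 n) φ z (e s z) = ∑ a, A s a z • ε a (φ z)) :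
    tensionNormSq (m := m) (n := n) φ x = ∑ a, frameTension e c c' φ A a x ^ 2 := by
  have hq := mem_extChartAt_source (I := 𝓡 n) (φ x)
  unfold tensionNormSq
  simp only [tensionIn_eq hfr hfr' hx hφ hφV hA hdφ]
  simp only [sum_mul_sum_mul_sum]
  rw [sum_rotate]
  have h1 := hfr'.sum_metric hq hφV
  have h2 : ∀ a, ∑ i, ∑ j, ∑ d, metricMatrix (φ x) (extChartAt (𝓡 n) (φ x) (φ x)) i j *
      (frameTension e c c' φ A a x * dirDeriv (ε a) (coord (φ x) i) (φ x)) *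
      (frameTension e c c' φ A d x * dirDeriv (ε d) (coord (φ x) j) (φ x)) =
      frameTension e c c' φ A a x ^ 2 := by
    intro a
    rw [sum_rotate]
    calc _ = ∑ d, frameTension e c c' φ A a x * frameTension e c c' φ A d x *
          ∑ i, ∑ j, metricMatrix (φ x) (extChartAt (𝓡 n) (φ x) (φ x)) i j *
          dirDeriv (ε a) (coord (φ x) i) (φ x) * dirDeriv (ε d) (coord (φ x) j) (φ x) := by
          simp only [Finset.mul_sum]
          exact Finset.sum_congr rfl fun d _ => Finset.sum_congr rfl fun i _ =>
            Finset.sum_congr rfl fun j _ => by ring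
      _ = _ := by
          simp only [h1]
          simp [sq]
  simp only [← h2]
  
end Tension

/-! ### Functions depending on a parameter -/

section Parameter

variable {m : ℕ} {M : Type*} [TopologicalSpace M] [ChartedSpace (EuclideanSpace ℝ (Fin m)) M]

/-- Joint smoothness of `h t x` at `(t, x)`. -/
def JointSmoothAt (h : ℝ → M → ℝ) (t : ℝ) (x : M) : Prop :=
  ContMDiffAt (𝓘(ℝ, ℝ).prod (𝓡 m)) 𝓘(ℝ, ℝ) ∞ (fun z : ℝ × M => h z.1 z.2) (t, x)

theorem JointSmoothAt.mul {h k : ℝ → M → ℝ} {t : ℝ} {x : M} (hh : JointSmoothAt (m := m) h t x)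
    (hk : JointSmoothAt (m := m) k t x) : JointSmoothAt (m := m) (fun t x => h t x * k t x) t x :=
  ContMDiffAt.mul hh hk

theorem JointSmoothAt.add {h k : ℝ → M → ℝ} {t : ℝ} {x : M} (hh : JointSmoothAt (m := m) h t x)
    (hk : JointSmoothAt (m := m) k t x) : JointSmoothAt (m := m) (fun t x => h t x + k t x) t x :=
  ContMDiffAt.add hh hk

theorem JointSmoothAt.sub {h k : ℝ → M → ℝ} {t : ℝ} {x : M} (hh : JointSmoothAt (m := m) h t x)
    (hk : JointSmoothAt (m := m) k t x) : JointSmoothAt (m := m) (fun t x => h t x - k t x) t x :=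
  ContMDiffAt.sub hh hk

theorem JointSmoothAt.sum {ι : Type*} (s : Finset ι) {h : ι → ℝ → M → ℝ} {t : ℝ} {x : M}
    (hh : ∀ i ∈ s, JointSmoothAt (m := m) (h i) t x) :
    JointSmoothAt (m := m) (fun t x => ∑ i ∈ s, h i t x) t x :=
  ContMDiffAt.sum hh

theorem JointSmoothAt.of_space {f : M → ℝ} {x : M} (hf : ContMDiffAt (𝓡 m) 𝓘(ℝ, ℝ) ∞ f x)
    (t : ℝ) : JointSmoothAt (m := m) (fun _ => f) t x :=
  ContMDiffAt.comp (t, x) (I' := 𝓡 m) (g := f) hf contMDiffAt_snd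

theorem JointSmoothAt.congr {h k : ℝ → M → ℝ} {t : ℝ} {x : M} (hh : JointSmoothAt (m := m) h t x)
    (e : ∀ᶠ z : ℝ × M in nhds (t, x), k z.1 z.2 = h z.1 z.2) : JointSmoothAt (m := m) k t x :=
  ContMDiffAt.congr_of_eventuallyEq hh e

theorem JointSmoothAt.continuousAt {h : ℝ → M → ℝ} {t : ℝ} {x : M}
    (hh : JointSmoothAt (m := m) h t x) : ContinuousAt (fun z : ℝ × M => h z.1 z.2) (t, x) :=
  ContMDiffAt.continuousAt hh

theorem JointSmoothAt.slice {h : ℝ → M → ℝ} {t : ℝ} {x : M} (hh : JointSmoothAt (m := m) h t x) :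
    ContMDiffAt (𝓡 m) 𝓘(ℝ, ℝ) ∞ (h t) x :=
  ContMDiffAt.comp x (I' := 𝓘(ℝ, ℝ).prod (𝓡 m)) (g := fun z : ℝ × M => h z.1 z.2)
    (f := fun y => (t, y)) hh (contMDiffAt_const.prodMk contMDiffAt_id)

theorem JointSmoothAt.contDiffAt_time {h : ℝ → M → ℝ} {t : ℝ} {x : M}
    (hh : JointSmoothAt (m := m) h t x) : ContDiffAt ℝ ∞ (fun s => h s x) t := by
  rw [← contMDiffAt_iff_contDiffAt]
  exact ContMDiffAt.comp t (I' := 𝓘(ℝ, ℝ).prod (𝓡 m)) (g := fun z : ℝ × M => h z.1 z.2)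
    (f := fun s => (s, x)) hh (contMDiffAt_id.prodMk contMDiffAt_const)

theorem JointSmoothAt.hasDerivAt {h : ℝ → M → ℝ} {t : ℝ} {x : M}
    (hh : JointSmoothAt (m := m) h t x) : HasDerivAt (fun s => h s x) (deriv (fun s => h s x) t) t :=
  (hh.contDiffAt_time.differentiableAt (by simp)).hasDerivAt

variable [IsManifold (𝓡 m) ∞ M]

theorem JointSmoothAt.comp_symm {h : ℝ → M → ℝ} {t : ℝ} {p x : M}
    (hx : x ∈ (extChartAt (𝓡 m) p).source) (hh : JointSmoothAt (m := m) h t x) :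
    ContDiffAt ℝ ∞ (fun z : ℝ × EuclideanSpace ℝ (Fin m) => h z.1 ((extChartAt (𝓡 m) p).symm z.2))
      (t, extChartAt (𝓡 m) p x) := by
  rw [← contMDiffAt_iff_contDiffAt]
  have h1 : ContMDiffAt 𝓘(ℝ, ℝ × EuclideanSpace ℝ (Fin m)) (𝓘(ℝ, ℝ).prod (𝓡 m)) ∞
      (fun z : ℝ × EuclideanSpace ℝ (Fin m) => (z.1, (extChartAt (𝓡 m) p).symm z.2))
      (t, extChartAt (𝓡 m) p x) :=
    contDiff_fst.contMDiff.contMDiffAt.prodMk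
      (ContMDiffAt.comp (t, extChartAt (𝓡 m) p x) (I' := 𝓘(ℝ, EuclideanSpace ℝ (Fin m)))
        (contMDiffAt_symm hx) contDiff_snd.contMDiff.contMDiffAt)
  refine ContMDiffAt.comp (t, extChartAt (𝓡 m) p x) (I' := 𝓘(ℝ, ℝ).prod (𝓡 m))
    (g := fun z : ℝ × M => h z.1 z.2) ?_ h1
  change ContMDiffAt _ _ ∞ _ (t, (extChartAt (𝓡 m) p).symm (extChartAt (𝓡 m) p x))
  rw [(extChartAt (𝓡 m) p).left_inv hx]
  exact hh

theorem JointSmoothAt.of_chart {H : ℝ × EuclideanSpace ℝ (Fin m) → ℝ} {t : ℝ} {p x : M}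
    (hx : x ∈ (extChartAt (𝓡 m) p).source) (hH : ContDiffAt ℝ ∞ H (t, extChartAt (𝓡 m) p x)) :
    JointSmoothAt (m := m) (fun t y => H (t, extChartAt (𝓡 m) p y)) t x := by
  have h1 : ContMDiffAt (𝓘(ℝ, ℝ).prod (𝓡 m)) 𝓘(ℝ, ℝ × EuclideanSpace ℝ (Fin m)) ∞
      (fun z : ℝ × M => (z.1, extChartAt (𝓡 m) p z.2)) (t, x) :=
    contMDiffAt_fst.prodMk_space
      (ContMDiffAt.comp (t, x) (I' := 𝓡 m) (contMDiffAt_chart hx) contMDiffAt_snd)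
  exact ContMDiffAt.comp (t, x) (I' := 𝓘(ℝ, ℝ × EuclideanSpace ℝ (Fin m)))
    (g := H) hH.contMDiffAt h1

/-- Time and space derivatives are values of one Fréchet derivative of the coordinate expression on
ℝ × ℝ^m. Joint smoothness of both, and their commutation, follow from this. -/
theorem eventually_dirDeriv_eq_fderiv {h : ℝ → M → ℝ} {t : ℝ} {p x : M}
    (hx : x ∈ (extChartAt (𝓡 m) p).source) (hh : JointSmoothAt (m := m) h t x) :
    ∀ᶠ z : ℝ × M in nhds (t, x), ∀ X : (x : M) → TangentSpace (𝓡 m) x,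
      dirDeriv X (h z.1) z.2 = fderiv ℝ (fun z : ℝ × EuclideanSpace ℝ (Fin m) =>
        h z.1 ((extChartAt (𝓡 m) p).symm z.2)) (z.1, extChartAt (𝓡 m) p z.2)
        (0, chartField p X (extChartAt (𝓡 m) p z.2)) ∧
      deriv (fun s => h s z.2) z.1 = fderiv ℝ (fun z : ℝ × EuclideanSpace ℝ (Fin m) =>
        h z.1 ((extChartAt (𝓡 m) p).symm z.2)) (z.1, extChartAt (𝓡 m) p z.2) (1, 0) := by
  have h1 : ContDiffAt ℝ 1 (fun z : ℝ × EuclideanSpace ℝ (Fin m) =>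
      h z.1 ((extChartAt (𝓡 m) p).symm z.2)) (t, extChartAt (𝓡 m) p x) :=
    (hh.comp_symm hx).of_le (by simp)
  have hc : ContinuousAt (fun z : ℝ × M => (z.1, extChartAt (𝓡 m) p z.2)) (t, x) :=
    continuousAt_fst.prodMk ((continuousAt_extChartAt' (I := 𝓡 m) hx).comp' continuousAt_snd)
  filter_upwards [hc.eventually (h1.eventually (by simp)),
    continuousAt_snd.eventually (source_mem_nhds hx)] with z hz hzs X
  have hd : DifferentiableAt ℝ (fun z : ℝ × EuclideanSpace ℝ (Fin m) =>
    h z.1 ((extChartAt (𝓡 m) p).symm z.2)) (z.1, extChartAt (𝓡 m) p z.2) :=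
    hz.differentiableAt (by simp)
  have hd1 : HasFDerivAt (fun u => h z.1 ((extChartAt (𝓡 m) p).symm u)) _ (extChartAt (𝓡 m) p z.2) :=
    hd.hasFDerivAt.comp (extChartAt (𝓡 m) p z.2)
      (hasFDerivAt_prodMk_right z.1 (extChartAt (𝓡 m) p z.2))
  have hm : MDifferentiableAt (𝓡 m) 𝓘(ℝ, ℝ) (h z.1) z.2 := by
    refine MDifferentiableAt.congr_of_eventuallyEq ?_ (eq_comp_symm hzs (h z.1))
    exact MDifferentiableAt.comp z.2 (I' := 𝓘(ℝ, EuclideanSpace ℝ (Fin m)))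
      hd1.differentiableAt.mdifferentiableAt ((contMDiffAt_chart hzs).mdifferentiableAt (by simp))
  constructor
  · rw [dirDeriv_eq_fderiv hzs hm, hd1.fderiv]
    simp
  · have hd3 : HasDerivAt (fun s : ℝ => (s, extChartAt (𝓡 m) p z.2)) (1, 0) z.1 :=
      (hasDerivAt_id z.1).prodMk (hasDerivAt_const z.1 (extChartAt (𝓡 m) p z.2))
    have hd2 := hd.hasFDerivAt.comp_hasDerivAt z.1 hd3
    simp only [Function.comp_def] at hd2
    rw [(extChartAt (𝓡 m) p).left_inv hzs] at hd2
    exact hd2.deriv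

theorem JointSmoothAt.dirDeriv {h : ℝ → M → ℝ} {t : ℝ} {x : M}
    (hh : JointSmoothAt (m := m) h t x) {X : (x : M) → TangentSpace (𝓡 m) x}
    (hX : ContMDiffAt (𝓡 m) (𝓡 m).tangent ∞ (fun x => (⟨x, X x⟩ : TangentBundle (𝓡 m) M)) x) :
    JointSmoothAt (m := m) (fun t => dirDeriv X (h t)) t x := by
  have hx := mem_extChartAt_source (I := 𝓡 m) x
  refine JointSmoothAt.congr (JointSmoothAt.of_chart (H := fun z => fderiv ℝ
    (fun z : ℝ × EuclideanSpace ℝ (Fin m) => h z.1 ((extChartAt (𝓡 m) x).symm z.2)) z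
      (0, chartField x X z.2)) hx ?_) ?_
  · refine ((hh.comp_symm hx).fderiv_right (by simp)).clm_apply (contDiffAt_const.prodMk ?_)
    exact (contDiffAt_chartField hx hX).comp (t, extChartAt (𝓡 m) x x) contDiffAt_snd
  · filter_upwards [eventually_dirDeriv_eq_fderiv hx hh] with z hz using (hz X).1

theorem JointSmoothAt.deriv {h : ℝ → M → ℝ} {t : ℝ} {x : M} (hh : JointSmoothAt (m := m) h t x) :
    JointSmoothAt (m := m) (fun t x => deriv (fun s => h s x) t) t x := by
  have hx := mem_extChartAt_source (I := 𝓡 m) x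
  refine JointSmoothAt.congr (JointSmoothAt.of_chart (H := fun z => fderiv ℝ
    (fun z : ℝ × EuclideanSpace ℝ (Fin m) => h z.1 ((extChartAt (𝓡 m) x).symm z.2)) z (1, 0))
    hx ?_) ?_
  · exact ((hh.comp_symm hx).fderiv_right (by simp)).clm_apply contDiffAt_const
  · filter_upwards [eventually_dirDeriv_eq_fderiv hx hh] with z hz using (hz fun _ => 0).2

/-- Both sides are the second derivative of the coordinate expression in the directions (1, 0) and
(0, X), and the second derivative is symmetric. -/
theorem JointSmoothAt.deriv_dirDeriv {h : ℝ → M → ℝ} {t : ℝ} {x : M}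
    (hh : JointSmoothAt (m := m) h t x) (X : (x : M) → TangentSpace (𝓡 m) x) :
    _root_.deriv (fun s => RiemSubm.dirDeriv X (h s) x) t =
      RiemSubm.dirDeriv X (fun y => _root_.deriv (fun s => h s y) t) x := by
  have hx := mem_extChartAt_source (I := 𝓡 m) x
  have hH := hh.comp_symm hx
  set u := extChartAt (𝓡 m) x x with hu
  set H := fun z : ℝ × EuclideanSpace ℝ (Fin m) => h z.1 ((extChartAt (𝓡 m) x).symm z.2) with hHdef
  have hev := eventually_dirDeriv_eq_fderiv hx hh
  have hdd : HasFDerivAt (fderiv ℝ H) (fderiv ℝ (fderiv ℝ H) (t, u)) (t, u) :=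
    ((hH.fderiv_right (m := ∞) (by simp)).differentiableAt (by simp)).hasFDerivAt
  have e1 : (fun s => RiemSubm.dirDeriv X (h s) x) =ᶠ[nhds t]
      fun s => fderiv ℝ H (s, u) (0, chartField x X u) := by
    have hc : ContinuousAt (fun s : ℝ => (s, x)) t := continuousAt_id.prodMk continuousAt_const
    filter_upwards [hc.eventually hev] with s hs using (hs X).1
  have e2 : (fun y => _root_.deriv (fun s => h s y) t) =ᶠ[nhds x]
      fun y => (fun v => fderiv ℝ H (t, v) (1, 0)) (extChartAt (𝓡 m) x y) := by
    have hc : ContinuousAt (fun y : M => (t, y)) x := continuousAt_const.prodMk continuousAt_id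
    filter_upwards [hc.eventually hev] with y hy using (hy X).2
  have hL : HasDerivAt (fun s => fderiv ℝ H (s, u) (0, chartField x X u))
      (fderiv ℝ (fderiv ℝ H) (t, u) (1, 0) (0, chartField x X u)) t := by
    have h1 : HasDerivAt (fun s => fderiv ℝ H (s, u)) (fderiv ℝ (fderiv ℝ H) (t, u) (1, 0)) t :=
      HasFDerivAt.comp_hasDerivAt t hdd ((hasDerivAt_id t).prodMk (hasDerivAt_const t u))
    simpa using h1.clm_apply (hasDerivAt_const t ((0 : ℝ), chartField x X u))
  have hG : ContDiffAt ℝ ∞ (fun v => fderiv ℝ H (t, v) (1, 0)) u := by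
    have h1 : ContDiffAt ℝ ∞ (fun v => fderiv ℝ H (t, v)) u :=
      ContDiffAt.comp u (hH.fderiv_right (m := ∞) (by simp))
        (contDiffAt_const.prodMk contDiffAt_id)
    exact h1.clm_apply contDiffAt_const
  have hR : HasFDerivAt (fun v => fderiv ℝ H (t, v) (1, 0))
      ((ContinuousLinearMap.apply ℝ ℝ ((1 : ℝ), (0 : EuclideanSpace ℝ (Fin m)))).comp
        ((fderiv ℝ (fderiv ℝ H) (t, u)).comp (ContinuousLinearMap.inr ℝ ℝ _))) u :=
    (ContinuousLinearMap.apply ℝ ℝ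
      ((1 : ℝ), (0 : EuclideanSpace ℝ (Fin m)))).hasFDerivAt.comp u
        (hdd.comp u (hasFDerivAt_prodMk_right t u))
  have e3 := dirDeriv_eq_fderiv hx ((contMDiffAt_comp_chart hx hG).mdifferentiableAt (by simp)) X
  rw [e1.deriv_eq, hL.deriv, dirDeriv_congr e2, e3,
    (comp_chart_comp_symm hx fun v => fderiv ℝ H (t, v) (1, 0)).fderiv_eq, ← hu, hR.fderiv]
  have hs : IsSymmSndFDerivAt ℝ H (t, u) :=
    hH.isSymmSndFDerivAt (by simpa using WithTop.coe_le_coe.2 (le_top : (2 : ℕ∞) ≤ ⊤))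
  simpa using hs (1, 0) (0, chartField x X u)

end Parameter

/-! ### The Riemannian measure in a chart -/

section Volume

open MeasureTheory

variable {m : ℕ} {M : Type*} [TopologicalSpace M] [ChartedSpace (EuclideanSpace ℝ (Fin m)) M]

theorem measurableSet_target_inter_preimage [MeasurableSpace M] [BorelSpace M] (p : M) {S : Set M}
    (hS : MeasurableSet S) :
    MeasurableSet ((extChartAt (𝓡 m) p).target ∩ (extChartAt (𝓡 m) p).symm ⁻¹' S) := by
  have ht := (isOpen_extChartAt_target (I := 𝓡 m) p).measurableSet
  have h1 : Measurable ((extChartAt (𝓡 m) p).target.domRestrict (extChartAt (𝓡 m) p).symm) :=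
    (continuousOn_iff_continuous_domRestrict.1 (continuousOn_extChartAt_symm p)).measurable
  have h2 := ht.subtype_image (h1 hS)
  convert h2 using 1
  ext u
  simp only [Set.mem_inter_iff, Set.mem_preimage, Set.mem_image, Subtype.exists,
    exists_and_right, exists_eq_right]
  exact ⟨fun h => ⟨h.1, h.2⟩, fun ⟨h, h'⟩ => ⟨h, h'⟩⟩

variable {U : Set M}

/-- The part of the chart at `p` over `U`. -/
def chartPart (p : M) (U : Set M) : Set (EuclideanSpace ℝ (Fin m)) :=
  (extChartAt (𝓡 m) p).target ∩ (extChartAt (𝓡 m) p).symm ⁻¹' U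

theorem isOpen_chartPart (p : M) (hU : IsOpen U) : IsOpen (chartPart (m := m) p U) :=
  (continuousOn_extChartAt_symm p).isOpen_inter_preimage (isOpen_extChartAt_target p) hU

theorem exists_eq_chart {p : M} {u : EuclideanSpace ℝ (Fin m)} (hu : u ∈ chartPart (m := m) p U) :
    ∃ x ∈ U, x ∈ (extChartAt (𝓡 m) p).source ∧ extChartAt (𝓡 m) p x = u :=
  ⟨(extChartAt (𝓡 m) p).symm u, hu.2, (extChartAt (𝓡 m) p).map_target hu.1,
    (extChartAt (𝓡 m) p).right_inv hu.1⟩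

variable [RiemannianBundle (fun x : M => TangentSpace (𝓡 m) x)]

/-- The density of the Riemannian measure in the chart at `p`. -/
noncomputable def volDensity (p : M) (u : EuclideanSpace ℝ (Fin m)) : ℝ :=
  Real.sqrt (metricMatrix p u).det

theorem chartVolume_apply [MeasurableSpace M] [BorelSpace M] (p : M) {S : Set M}
    (hS : MeasurableSet S) :
    chartVolume (m := m) p S = ∫⁻ u in (extChartAt (𝓡 m) p).target ∩
      (extChartAt (𝓡 m) p).symm ⁻¹' S, ENNReal.ofReal (volDensity p u) := by
  have ht := (isOpen_extChartAt_target (I := 𝓡 m) p).measurableSet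
  have hm : AEMeasurable (extChartAt (𝓡 m) p).symm
      (volume.restrict (extChartAt (𝓡 m) p).target) :=
    (continuousOn_extChartAt_symm p).aemeasurable ht
  unfold chartVolume
  rw [Measure.map_apply_of_aemeasurable (hm.mono_ac (withDensity_absolutelyContinuous _ _)) hS,
    withDensity_apply', Measure.restrict_restrict' ht, Set.inter_comm]
  rfl

/-! ### Change of chart, and the Riemannian volume computed in one chart. -/

variable [IsManifold (𝓡 m) ∞ M]

/-- If J is the Jacobian of the transition map, the metric matrices satisfy g_q = Jᵀ g_p J. -/
theorem metricMatrix_det_change {p q : M} {u : EuclideanSpace ℝ (Fin m)}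
    (hu : u ∈ (extChartAt (𝓡 m) q).target)
    (hp : (extChartAt (𝓡 m) q).symm u ∈ (extChartAt (𝓡 m) p).source) :
    (metricMatrix q u).det =
      (fderiv ℝ (fun v => extChartAt (𝓡 m) p ((extChartAt (𝓡 m) q).symm v)) u).det ^ 2 *
      (metricMatrix p (extChartAt (𝓡 m) p ((extChartAt (𝓡 m) q).symm u))).det := by
  set T := fun v => extChartAt (𝓡 m) p ((extChartAt (𝓡 m) q).symm v) with hT
  set x := (extChartAt (𝓡 m) q).symm u with hx
  have hs : MDifferentiableAt 𝓘(ℝ, EuclideanSpace ℝ (Fin m)) (𝓡 m) (extChartAt (𝓡 m) q).symm u := by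
    have := contMDiffAt_symm ((extChartAt (𝓡 m) q).map_target hu)
    rw [(extChartAt (𝓡 m) q).right_inv hu] at this
    exact this.mdifferentiableAt (by simp)
  have hcv : ∀ i k, chartComp p x (coordVec q u i) k =
      fderiv ℝ T u (EuclideanSpace.single i 1) k := by
    intro i k
    have h1 : mfderiv 𝓘(ℝ, EuclideanSpace ℝ (Fin m)) 𝓘(ℝ, EuclideanSpace ℝ (Fin m)) T u = _ :=
      mfderiv_comp u ((contMDiffAt_chart hp).mdifferentiableAt (by simp)) hs
    rw [← mfderiv_eq_fderiv, h1]
    rfl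
  set J : Matrix (Fin m) (Fin m) ℝ :=
    LinearMap.toMatrix (EuclideanSpace.basisFun (Fin m) ℝ).toBasis
      (EuclideanSpace.basisFun (Fin m) ℝ).toBasis (fderiv ℝ T u : _ →ₗ[ℝ] _) with hJ
  have hJdet : J.det = (fderiv ℝ T u).det := LinearMap.det_toMatrix _ _
  have hJe : ∀ i k, J k i = fderiv ℝ T u (EuclideanSpace.single i 1) k := by
    intro i k
    rw [hJ, LinearMap.toMatrix_apply]
    simp
  have hg : metricMatrix q u = J.transpose * metricMatrix p (extChartAt (𝓡 m) p x) * J := by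
    ext i j
    rw [metricMatrix, Matrix.of_apply, inner_eq_sum_metricMatrix (p := p) hp, Matrix.mul_assoc]
    simp only [Matrix.mul_apply, Matrix.transpose_apply, hJe, hcv, Finset.mul_sum]
    exact Finset.sum_congr rfl fun i _ => Finset.sum_congr rfl fun j _ => by ring
  rw [hg, Matrix.det_mul, Matrix.det_mul, Matrix.det_transpose, hJdet]
  ring

/-- Change of variables under the transition map: its Jacobian factor |det J| is exactly the ratio
of the two densities √det g. -/
theorem chartVolume_eq_of_subset [MeasurableSpace M] [BorelSpace M] (p q : M) {S : Set M}
    (hS : MeasurableSet S) (hSp : S ⊆ (extChartAt (𝓡 m) p).source)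
    (hSq : S ⊆ (extChartAt (𝓡 m) q).source) :
    chartVolume (m := m) p S = chartVolume (m := m) q S := by
  rw [chartVolume_apply p hS, chartVolume_apply q hS]
  set T := fun v => extChartAt (𝓡 m) p ((extChartAt (𝓡 m) q).symm v) with hT
  set A := (extChartAt (𝓡 m) q).target ∩ (extChartAt (𝓡 m) q).symm ⁻¹' S with hA
  have himg : (extChartAt (𝓡 m) p).target ∩ (extChartAt (𝓡 m) p).symm ⁻¹' S = T '' A := by
    ext v
    constructor
    · rintro ⟨hv, hvS⟩
      have hvS' : (extChartAt (𝓡 m) p).symm v ∈ S := hvS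
      refine ⟨extChartAt (𝓡 m) q ((extChartAt (𝓡 m) p).symm v),
        ⟨(extChartAt (𝓡 m) q).map_source (hSq hvS'), ?_⟩, ?_⟩
      · rwa [Set.mem_preimage, (extChartAt (𝓡 m) q).left_inv (hSq hvS')]
      · simp only [hT]
        rw [(extChartAt (𝓡 m) q).left_inv (hSq hvS'), (extChartAt (𝓡 m) p).right_inv hv]
    · rintro ⟨u, ⟨hu, huS⟩, rfl⟩
      have huS' : (extChartAt (𝓡 m) q).symm u ∈ S := huS
      refine ⟨(extChartAt (𝓡 m) p).map_source (hSp huS'), ?_⟩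
      simp only [Set.mem_preimage, hT]
      rwa [(extChartAt (𝓡 m) p).left_inv (hSp huS')]
  have hinj : Set.InjOn T A := by
    rintro u ⟨hu, huS⟩ v ⟨hv, hvS⟩ huv
    exact (extChartAt (𝓡 m) q).symm.injOn hu hv
      ((extChartAt (𝓡 m) p).injOn (hSp huS) (hSp hvS) huv)
  have hder : ∀ u ∈ A, HasFDerivWithinAt T (fderiv ℝ T u) A u := by
    rintro u ⟨hu, huS⟩
    have h1 := contMDiffAt_symm ((extChartAt (𝓡 m) q).map_target hu)
    rw [(extChartAt (𝓡 m) q).right_inv hu] at h1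
    have h2 : ContMDiffAt 𝓘(ℝ, EuclideanSpace ℝ (Fin m)) 𝓘(ℝ, EuclideanSpace ℝ (Fin m)) ∞ T u :=
      ContMDiffAt.comp u (I' := 𝓡 m) (contMDiffAt_chart (hSp huS)) h1
    exact (h2.contDiffAt.differentiableAt (by simp)).hasFDerivAt.hasFDerivWithinAt
  rw [himg, lintegral_image_eq_lintegral_abs_det_fderiv_mul volume
    (measurableSet_target_inter_preimage q hS) hder hinj]
  refine setLIntegral_congr_fun (measurableSet_target_inter_preimage q hS) ?_
  rintro u ⟨hu, huS⟩
  simp only [volDensity]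
  rw [metricMatrix_det_change (p := p) hu (hSp huS), Real.sqrt_mul (sq_nonneg _),
    Real.sqrt_sq_eq_abs, ENNReal.ofReal_mul (abs_nonneg _)]

variable {e : Fin m → (x : M) → TangentSpace (𝓡 m) x} {c : Fin m → Fin m → Fin m → M → ℝ}

theorem IsFrame.det_metric_pos (hfr : IsFrame U e c) {p x : M}
    (hp : x ∈ (extChartAt (𝓡 m) p).source) (hx : x ∈ U) :
    (Matrix.of fun a i => dirDeriv (e a) (coord p i) x).det ^ 2 *
        (metricMatrix p (extChartAt (𝓡 m) p x)).det = 1 ∧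
      0 < (metricMatrix p (extChartAt (𝓡 m) p x)).det := by
  set E : Matrix (Fin m) (Fin m) ℝ := Matrix.of fun a i => dirDeriv (e a) (coord p i) x with hE
  have h1 : E.det ^ 2 * (metricMatrix p (extChartAt (𝓡 m) p x)).det = 1 := by
    have : E * metricMatrix p (extChartAt (𝓡 m) p x) * E.transpose = 1 := by
      ext a b
      rw [Matrix.one_apply, ← hfr.sum_metric hp hx a b, Matrix.mul_assoc]
      simp only [Matrix.mul_apply, Matrix.transpose_apply, Finset.mul_sum]
      exact Finset.sum_congr rfl fun i _ => Finset.sum_congr rfl fun j _ => by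
        simp only [hE, Matrix.of_apply]; ring
    have := congrArg Matrix.det this
    rw [Matrix.det_mul, Matrix.det_mul, Matrix.det_transpose, Matrix.det_one] at this
    rw [← this]; ring
  refine ⟨h1, ?_⟩
  by_contra hneg
  push Not at hneg
  nlinarith [mul_nonneg_of_nonpos_of_nonpos (neg_nonpos.2 (sq_nonneg E.det)) hneg]

theorem IsFrame.contDiffAt_volDensity (hfr : IsFrame U e c) {p : M}
    {u : EuclideanSpace ℝ (Fin m)} (hu : u ∈ chartPart (m := m) p U) :
    ContDiffAt ℝ ∞ (volDensity p) u ∧ 0 < volDensity p u := by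
  obtain ⟨x, hxU, hx, rfl⟩ := exists_eq_chart hu
  have hpos := (hfr.det_metric_pos hx hxU).2
  refine ⟨ContDiffAt.sqrt ?_ hpos.ne', Real.sqrt_pos.2 hpos⟩
  have h1 := contDiffAt_comp_symm hx (contMDiffAt_det fun i j => hfr.contMDiffAt_metric hx hxU i j)
  exact h1.congr_of_eventuallyEq (comp_chart_comp_symm hx fun u => (metricMatrix p u).det).symm

variable [SecondCountableTopology M] [MeasurableSpace M] [BorelSpace M]

/-- Each piece of `S` cut out by the cover is measured in its own chart, hence equally well in the
chart at `p`; the pieces are disjoint and exhaust `S`. -/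
theorem riemannianVolume_apply_of_subset (p : M) {S : Set M} (hS : MeasurableSet S)
    (hSp : S ⊆ (extChartAt (𝓡 m) p).source) :
    riemannianVolume m M S = chartVolume (m := m) p S := by
  have hne : Nonempty M := ⟨p⟩
  unfold riemannianVolume
  rw [dif_pos hne]
  set c := (exists_chart_cover (m := m) M).choose with hc
  have hcov := (exists_chart_cover (m := m) M).choose_spec
  simp only
  set D := disjointed (fun k => (extChartAt (𝓡 m) (c k)).source) with hD
  have hDm : ∀ n, MeasurableSet (D n) := fun n => MeasurableSet.disjointed
    (fun k => (isOpen_extChartAt_source (I := 𝓡 m) (c k)).measurableSet) n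
  have hDU : ⋃ n, D n = Set.univ := by rw [hD, iUnion_disjointed]; exact hcov
  rw [Measure.sum_apply _ hS]
  have h1 : ∀ n, (chartVolume (m := m) (c n)).restrict (D n) S = chartVolume (m := m) p (S ∩ D n) := by
    intro n
    rw [Measure.restrict_apply hS]
    exact chartVolume_eq_of_subset _ _ (hS.inter (hDm n))
      (Set.inter_subset_right.trans (disjointed_subset _ n)) (Set.inter_subset_left.trans hSp)
  simp only [h1]
  rw [← measure_iUnion (fun i j hij => ((disjoint_disjointed _ hij).mono Set.inter_subset_right
    Set.inter_subset_right)) fun n => hS.inter (hDm n), ← Set.inter_iUnion, hDU, Set.inter_univ]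

theorem restrict_riemannianVolume (hU : IsOpen U) (p : M) :
    (riemannianVolume m M).restrict ((extChartAt (𝓡 m) p).source ∩ U) =
      ((volume.restrict (chartPart (m := m) p U)).withDensity
        fun u => ENNReal.ofReal (volDensity p u)).map (extChartAt (𝓡 m) p).symm := by
  have hsm := ((isOpen_extChartAt_source (I := 𝓡 m) p).inter hU).measurableSet
  have hWm := (isOpen_chartPart (m := m) p hU).measurableSet
  have hm : AEMeasurable (extChartAt (𝓡 m) p).symm (volume.restrict (chartPart (m := m) p U)) :=
    ((continuousOn_extChartAt_symm p).mono Set.inter_subset_left).aemeasurable hWm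
  ext S hS
  rw [Measure.restrict_apply hS, riemannianVolume_apply_of_subset p (hS.inter hsm)
    (Set.inter_subset_right.trans Set.inter_subset_left), chartVolume_apply p (hS.inter hsm),
    Measure.map_apply_of_aemeasurable (hm.mono_ac (withDensity_absolutelyContinuous _ _)) hS,
    withDensity_apply', Measure.restrict_restrict' hWm]
  congr 2
  ext u
  simp only [chartPart, Set.mem_inter_iff, Set.mem_preimage]
  constructor
  · rintro ⟨h1, h2, h3, h4⟩
    exact ⟨h2, h1, h4⟩
  · rintro ⟨h2, h1, h4⟩
    exact ⟨h1, h2, (extChartAt (𝓡 m) p).map_target h1, h4⟩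

theorem IsFrame.setIntegral_chart (hfr : IsFrame U e c) (p : M) {f : M → ℝ}
    (hf : ContinuousOn f U) :
    ∫ x in (extChartAt (𝓡 m) p).source ∩ U, f x ∂(riemannianVolume m M) =
      ∫ u in chartPart (m := m) p U, volDensity p u * f ((extChartAt (𝓡 m) p).symm u) := by
  have hsm := ((isOpen_extChartAt_source (I := 𝓡 m) p).inter hfr.isOpen).measurableSet
  have hWm := (isOpen_chartPart (m := m) p hfr.isOpen).measurableSet
  have hm : AEMeasurable (extChartAt (𝓡 m) p).symm (volume.restrict (chartPart (m := m) p U)) :=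
    ((continuousOn_extChartAt_symm p).mono Set.inter_subset_left).aemeasurable hWm
  have hfm : AEStronglyMeasurable f
      ((riemannianVolume m M).restrict ((extChartAt (𝓡 m) p).source ∩ U)) :=
    (hf.mono Set.inter_subset_right).aestronglyMeasurable hsm
  rw [restrict_riemannianVolume hfr.isOpen] at hfm ⊢
  rw [integral_map (hm.mono_ac (withDensity_absolutelyContinuous _ _)) hfm]
  have hρ : AEMeasurable (fun u => Real.toNNReal (volDensity p u))
      (volume.restrict (chartPart (m := m) p U)) := by
    refine AEMeasurable.real_toNNReal (ContinuousOn.aemeasurable (fun u hu => ?_) hWm)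
    exact (hfr.contDiffAt_volDensity hu).1.continuousAt.continuousWithinAt
  have h1 := integral_withDensity_eq_integral_smul₀ hρ
    (fun u => f ((extChartAt (𝓡 m) p).symm u))
  refine h1.trans (setIntegral_congr_fun hWm fun u hu => ?_)
  simp only [NNReal.smul_def, smul_eq_mul]
  rw [Real.coe_toNNReal _ (hfr.contDiffAt_volDensity hu).2.le]

/-- Near a point of `U` the density is bounded on a small coordinate ball, which has finite Lebesgue
measure; compactness does the rest. -/
theorem IsFrame.measure_lt_top (hfr : IsFrame U e c) {K : Set M} (hK : IsCompact K) (hKU : K ⊆ U) :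
    riemannianVolume m M K < ⊤ := by
  refine hK.measure_lt_top_of_nhdsWithin fun x hx => ?_
  have hxs := mem_extChartAt_source (I := 𝓡 m) x
  have hu : extChartAt (𝓡 m) x x ∈ chartPart (m := m) x U := by
    refine ⟨mem_extChartAt_target x, ?_⟩
    rw [Set.mem_preimage, (extChartAt (𝓡 m) x).left_inv hxs]
    exact hKU hx
  have hb : ∀ᶠ u in nhds (extChartAt (𝓡 m) x x), u ∈ chartPart (m := m) x U ∧
      volDensity x u < volDensity x (extChartAt (𝓡 m) x x) + 1 :=
    ((isOpen_chartPart x hfr.isOpen).eventually_mem hu).and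
      ((hfr.contDiffAt_volDensity hu).1.continuousAt.eventually_lt continuousAt_const (by simp))
  obtain ⟨r, hr, hball⟩ := Metric.eventually_nhds_iff_ball.1 hb
  set S := (extChartAt (𝓡 m) x).source ∩ (extChartAt (𝓡 m) x) ⁻¹'
    (Metric.ball (extChartAt (𝓡 m) x x) r) with hS
  have hSo : IsOpen S :=
    (continuousOn_extChartAt x).isOpen_inter_preimage (isOpen_extChartAt_source x) Metric.isOpen_ball
  refine ⟨S, mem_nhdsWithin_of_mem_nhds (hSo.mem_nhds ⟨hxs, Metric.mem_ball_self hr⟩), ?_⟩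
  rw [riemannianVolume_apply_of_subset x hSo.measurableSet Set.inter_subset_left,
    chartVolume_apply x hSo.measurableSet]
  have hsub : (extChartAt (𝓡 m) x).target ∩ (extChartAt (𝓡 m) x).symm ⁻¹' S ⊆
      Metric.ball (extChartAt (𝓡 m) x x) r := by
    rintro u ⟨hu, -, hu2⟩
    rwa [Set.mem_preimage, (extChartAt (𝓡 m) x).right_inv hu] at hu2
  calc _ ≤ ∫⁻ u in Metric.ball (extChartAt (𝓡 m) x x) r, ENNReal.ofReal (volDensity x u) :=
        lintegral_mono_set hsub
    _ ≤ ∫⁻ u in Metric.ball (extChartAt (𝓡 m) x x) r,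
        ENNReal.ofReal (volDensity x (extChartAt (𝓡 m) x x) + 1) :=
        setLIntegral_mono' Metric.isOpen_ball.measurableSet fun u hu =>
          ENNReal.ofReal_le_ofReal (hball u hu).2.le
    _ < ⊤ := by
        rw [setLIntegral_const]
        exact ENNReal.mul_lt_top ENNReal.ofReal_lt_top measure_ball_lt_top

theorem IsFrame.measure_pos (hfr : IsFrame U e c) {S : Set M} (hS : IsOpen S) (hSU : S ⊆ U)
    {x : M} (hx : x ∈ S) : 0 < riemannianVolume m M S := by
  have hxs := mem_extChartAt_source (I := 𝓡 m) x
  set S' := (extChartAt (𝓡 m) x).source ∩ S with hS'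
  have hS'o : IsOpen S' := (isOpen_extChartAt_source x).inter hS
  refine lt_of_lt_of_le ?_ (measure_mono (Set.inter_subset_right : S' ⊆ S))
  rw [riemannianVolume_apply_of_subset x hS'o.measurableSet Set.inter_subset_left,
    chartVolume_apply x hS'o.measurableSet]
  change 0 < ∫⁻ u in chartPart (m := m) x S', ENNReal.ofReal (volDensity x u)
  have hWo : IsOpen (chartPart (m := m) x S') := isOpen_chartPart x hS'o
  have hsub : ∀ u ∈ chartPart (m := m) x S', u ∈ chartPart (m := m) x U := fun u hu =>
    ⟨hu.1, hSU hu.2.2⟩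
  have hmeas : AEMeasurable (fun u => ENNReal.ofReal (volDensity x u))
      (volume.restrict (chartPart (m := m) x S')) := by
    refine AEMeasurable.ennreal_ofReal (ContinuousOn.aemeasurable (fun u hu => ?_) hWo.measurableSet)
    exact (hfr.contDiffAt_volDensity (hsub u hu)).1.continuousAt.continuousWithinAt
  rw [pos_iff_ne_zero]
  intro h0
  rw [lintegral_eq_zero_iff' hmeas] at h0
  have h1 : ∀ᵐ u ∂(volume.restrict (chartPart (m := m) x S')), False := by
    filter_upwards [h0, ae_restrict_mem hWo.measurableSet] with u hu huW
    have := (hfr.contDiffAt_volDensity (hsub u huW)).2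
    simp only [Pi.zero_apply, ENNReal.ofReal_eq_zero] at hu
    linarith
  rw [ae_iff] at h1
  simp only [not_false_eq_true, Set.ofPred_true, Measure.restrict_apply_univ] at h1
  have hne : (chartPart (m := m) x S').Nonempty := by
    refine ⟨extChartAt (𝓡 m) x x, mem_extChartAt_target x, ?_⟩
    rw [Set.mem_preimage, (extChartAt (𝓡 m) x).left_inv hxs]
    exact ⟨hxs, hx⟩
  exact (hWo.measure_pos volume hne).ne' h1

end Volume

/-! ### The divergence theorem for an orthonormal frame -/

section Divergence

open MeasureTheory

/-- Integration by parts against the constant function 1. -/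
theorem integral_pderiv_eq_zero {m : ℕ} {G : EuclideanSpace ℝ (Fin m) → ℝ} (hG : ContDiff ℝ 1 G)
    (hc : HasCompactSupport G) (k : Fin m) : ∫ u, pderiv k G u = 0 := by
  have hd : Continuous fun u => fderiv ℝ G u (EuclideanSpace.single k 1) :=
    (hG.continuous_fderiv (by simp)).clm_apply continuous_const
  have hdc : HasCompactSupport fun u => fderiv ℝ G u (EuclideanSpace.single k 1) :=
    hc.fderiv_apply (𝕜 := ℝ) _
  have h := integral_mul_fderiv_eq_neg_fderiv_mul_of_integrable (μ := volume) (𝕜 := ℝ)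
    (f := fun _ : EuclideanSpace ℝ (Fin m) => (1 : ℝ)) (g := G) (v := EuclideanSpace.single k 1)
    (by simp) (by simpa using hd.integrable_of_hasCompactSupport hdc)
    (by simpa using hG.continuous.integrable_of_hasCompactSupport hc)
    (fun _ _ => differentiableAt_const _) (fun u _ => hG.differentiable (by simp) u)
  simpa [pderiv] using h

theorem dirDeriv_sub {m : ℕ} {M : Type*} [TopologicalSpace M]
    [ChartedSpace (EuclideanSpace ℝ (Fin m)) M] {f g : M → ℝ} {x : M}
    (hf : ContMDiffAt (𝓡 m) 𝓘(ℝ, ℝ) ∞ f x) (hg : ContMDiffAt (𝓡 m) 𝓘(ℝ, ℝ) ∞ g x)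
    (X : (x : M) → TangentSpace (𝓡 m) x) :
    dirDeriv X (fun y => f y - g y) x = dirDeriv X f x - dirDeriv X g x := by
  have h1 := dirDeriv_add hf (contMDiffAt_const_mul (-1) hg) X
  rw [dirDeriv_const_mul (-1) hg X] at h1
  simpa [sub_eq_add_neg] using h1

/-- The derivative of the determinant of a matrix of functions, for `3 × 3` matrices. -/
theorem dirDeriv_det_three {M : Type*} [TopologicalSpace M]
    [ChartedSpace (EuclideanSpace ℝ (Fin 3)) M] {A : M → Matrix (Fin 3) (Fin 3) ℝ} {x : M}
    (hA : ∀ i j, ContMDiffAt (𝓡 3) 𝓘(ℝ, ℝ) ∞ (fun y => A y i j) x)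
    (X : (x : M) → TangentSpace (𝓡 3) x) {B C : Matrix (Fin 3) (Fin 3) ℝ}
    (hB : ∀ i j, dirDeriv X (fun y => A y i j) x = ∑ l, A x i l * B l j + ∑ d, C i d * A x d j) :
    dirDeriv X (fun y => (A y).det) x = (A x).det * (B.trace + C.trace) := by
  simp only [Matrix.det_fin_three]
  have h2 : ∀ i j k l, ContMDiffAt (𝓡 3) 𝓘(ℝ, ℝ) ∞ (fun y => A y i j * A y k l) x :=
    fun i j k l => contMDiffAt_mul (hA i j) (hA k l)
  have h3 : ∀ i j k l s t, ContMDiffAt (𝓡 3) 𝓘(ℝ, ℝ) ∞ (fun y => A y i j * A y k l * A y s t) x :=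
    fun i j k l s t => contMDiffAt_mul (h2 i j k l) (hA s t)
  rw [dirDeriv_sub (contMDiffAt_add (contMDiffAt_add (contMDiffAt_sub (contMDiffAt_sub
      (h3 _ _ _ _ _ _) (h3 _ _ _ _ _ _)) (h3 _ _ _ _ _ _)) (h3 _ _ _ _ _ _)) (h3 _ _ _ _ _ _))
      (h3 _ _ _ _ _ _),
    dirDeriv_add (contMDiffAt_add (contMDiffAt_sub (contMDiffAt_sub
      (h3 _ _ _ _ _ _) (h3 _ _ _ _ _ _)) (h3 _ _ _ _ _ _)) (h3 _ _ _ _ _ _)) (h3 _ _ _ _ _ _),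
    dirDeriv_add (contMDiffAt_sub (contMDiffAt_sub
      (h3 _ _ _ _ _ _) (h3 _ _ _ _ _ _)) (h3 _ _ _ _ _ _)) (h3 _ _ _ _ _ _),
    dirDeriv_sub (contMDiffAt_sub (h3 _ _ _ _ _ _) (h3 _ _ _ _ _ _)) (h3 _ _ _ _ _ _),
    dirDeriv_sub (h3 _ _ _ _ _ _) (h3 _ _ _ _ _ _)]
  simp only [dirDeriv_mul (h2 _ _ _ _) (hA _ _), dirDeriv_mul (hA _ _) (hA _ _), hB,
    Fin.sum_univ_three, Matrix.trace, Matrix.diag_apply]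
  ring

variable {M : Type*} [TopologicalSpace M] [ChartedSpace (EuclideanSpace ℝ (Fin 3)) M]
  [IsManifold (𝓡 3) ∞ M] [RiemannianBundle (fun x : M => TangentSpace (𝓡 3) x)]
  {U : Set M} {e : Fin 3 → (x : M) → TangentSpace (𝓡 3) x} {c : Fin 3 → Fin 3 → Fin 3 → M → ℝ}

/-- The divergence of `ρ • e i` in a chart, where `ρ` is the density of the Riemannian measure. -/
theorem IsFrame.sum_pderiv_density (hfr : IsFrame U e c) {p x : M}
    (hp : x ∈ (extChartAt (𝓡 3) p).source) (hx : x ∈ U) (i : Fin 3) :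
    volDensity p (extChartAt (𝓡 3) p x) *
        ∑ k, pderiv k (fun u => chartField p (e i) u k) (extChartAt (𝓡 3) p x) +
      ∑ k, dirDeriv (e i) (coord p k) x * pderiv k (volDensity p) (extChartAt (𝓡 3) p x) =
    -(∑ j, c i j j x) * volDensity p (extChartAt (𝓡 3) p x) := by
  have hu : extChartAt (𝓡 3) p x ∈ chartPart (m := 3) p U :=
    ⟨(extChartAt (𝓡 3) p).map_source hp, by
      rwa [Set.mem_preimage, (extChartAt (𝓡 3) p).left_inv hp]⟩
  obtain ⟨hρ, hρ0⟩ := hfr.contDiffAt_volDensity hu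
  have hE := hfr.contMDiffAt_comp hp hx
  set A : M → Matrix (Fin 3) (Fin 3) ℝ := fun y => Matrix.of fun a k => dirDeriv (e a) (coord p k) y
    with hA
  have hAs : ∀ a k, ContMDiffAt (𝓡 3) 𝓘(ℝ, ℝ) ∞ (fun y => A y a k) x := hE
  have hrep : ∀ k, (fun y => chartField p (e i) (extChartAt (𝓡 3) p y) k) =ᶠ[nhds x]
      dirDeriv (e i) (coord p k) := by
    intro k
    filter_upwards [source_mem_nhds hp] with y hy using chartField_apply hy (e i) k
  have hcf : ∀ k, ContDiffAt ℝ ∞ (fun u => chartField p (e i) u k) (extChartAt (𝓡 3) p x) := fun k =>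
    (EuclideanSpace.proj (𝕜 := ℝ) k).contDiff.contDiffAt.comp _
      (contDiffAt_chartField hp (hfr.smooth i x hx))
  -- The commutator trades e_i(e_j x^k) for e_j(e_i x^k) plus structure terms. Since e_i x^k is a
  -- function of the coordinates, this reads e_i(A) = A B + C A, with B the Jacobian of the field
  -- e_i and C its structure constants.
  have hB : ∀ j k, dirDeriv (e i) (fun y => A y j k) x =
      ∑ l, A x j l * (Matrix.of fun l k => pderiv l (fun u => chartField p (e i) u k)
        (extChartAt (𝓡 3) p x)) l k + ∑ d, (Matrix.of fun j d => c i j d x) j d * A x d k := by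
    intro j k
    have h1 := hfr.commutator hx (contMDiffAt_coord hp k) i j
    have h2 := dirDeriv_comp_chart hp (hcf k) (e j)
    rw [dirDeriv_congr (hrep k)] at h2
    rw [h2] at h1
    simp only [Matrix.of_apply, hA]
    linear_combination h1
  have hdet := dirDeriv_det_three hAs (e i) hB
  have hρM : ContMDiffAt (𝓡 3) 𝓘(ℝ, ℝ) ∞ (fun y => volDensity p (extChartAt (𝓡 3) p y)) x :=
    contMDiffAt_comp_chart hp hρ
  have hΔ := contMDiffAt_det hAs
  -- ρ² (det A)² = 1 near `x`. Differentiating along e_i, with e_i(det A) = det A (tr B + tr C),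
  -- gives e_i(ρ) = -ρ (tr B + tr C).
  have hone : (fun y => (volDensity p (extChartAt (𝓡 3) p y) * volDensity p (extChartAt (𝓡 3) p y)) *
      ((A y).det * (A y).det)) =ᶠ[nhds x] fun _ => 1 := by
    filter_upwards [source_mem_nhds hp, hfr.isOpen.mem_nhds hx] with y hy hyU
    obtain ⟨h1, h2⟩ := hfr.det_metric_pos hy hyU
    rw [volDensity, Real.mul_self_sqrt h2.le, ← h1]
    ring
  have h1 := dirDeriv_congr hone (e i)
  rw [dirDeriv_const, dirDeriv_mul (contMDiffAt_mul hρM hρM) (contMDiffAt_mul hΔ hΔ),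
    dirDeriv_mul hρM hρM, dirDeriv_mul hΔ hΔ, hdet, dirDeriv_comp_chart hp hρ] at h1
  have hone' := hone.self_of_nhds
  simp only at hone'
  simp only [Matrix.trace, Matrix.diag_apply, Matrix.of_apply] at h1
  set ρ := volDensity p (extChartAt (𝓡 3) p x)
  set D := ∑ k, dirDeriv (e i) (coord p k) x * pderiv k (volDensity p) (extChartAt (𝓡 3) p x)
  set B := ∑ k, pderiv k (fun u => chartField p (e i) u k) (extChartAt (𝓡 3) p x)
  set S := ∑ j, c i j j x
  have h2 : 2 * (ρ * (A x).det ^ 2) * (D + ρ * (B + S)) = 0 := by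
    linear_combination h1
  have h3 : 2 * (ρ * (A x).det ^ 2) ≠ 0 := by
    intro h0
    have : 2 * (ρ * (A x).det ^ 2) * ρ = 2 := by linear_combination 2 * hone'
    rw [h0] at this
    norm_num at this
  have h4 := (mul_eq_zero.1 h2).resolve_left h3
  linear_combination h4

variable [T2Space M] [SecondCountableTopology M] [MeasurableSpace M] [BorelSpace M]

/-- In coordinates ρ times the integrand is Σ_k ∂_k(ρ h E_i^k), by `IsFrame.sum_pderiv_density`, and
each summand integrates to zero because the functions ρ h E_i^k are compactly supported. -/
theorem IsFrame.integral_divergence_chart (hfr : IsFrame U e c) {p : M} {h : M → ℝ} {K : Set M}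
    (hK : IsCompact K) (hKU : K ⊆ U) (hKp : K ⊆ (extChartAt (𝓡 3) p).source)
    (hh : ∀ x ∈ U, ContMDiffAt (𝓡 3) 𝓘(ℝ, ℝ) ∞ h x) (hhK : ∀ x ∉ K, h x = 0) (i : Fin 3) :
    ∫ x in U, (dirDeriv (e i) h x - (∑ j, c i j j x) * h x) ∂(riemannianVolume 3 M) = 0 := by
  have hoff : ∀ x ∉ K, dirDeriv (e i) h x = 0 := by
    intro x hx
    have : h =ᶠ[nhds x] fun _ => 0 := by
      filter_upwards [hK.isClosed.isOpen_compl.mem_nhds hx] with y hy using hhK y hy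
    rw [dirDeriv_congr this, dirDeriv_const]
  have hUm := hfr.isOpen.measurableSet
  have hred : ∫ x in U, (dirDeriv (e i) h x - (∑ j, c i j j x) * h x) ∂(riemannianVolume 3 M) =
      ∫ x in (extChartAt (𝓡 3) p).source ∩ U, (dirDeriv (e i) h x - (∑ j, c i j j x) * h x)
        ∂(riemannianVolume 3 M) := by
    refine setIntegral_eq_of_subset_of_forall_sdiff_eq_zero hUm Set.inter_subset_right ?_
    rintro x ⟨hxU, hx⟩
    have hxK : x ∉ K := fun hxK => hx ⟨hKp hxK, hxU⟩
    simp [hoff x hxK, hhK x hxK]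
  rw [hred]
  rw [hfr.setIntegral_chart p fun x hx => ?_]
  swap
  · refine ContinuousAt.continuousWithinAt ?_
    refine (contMDiffAt_dirDeriv (hh x hx) (hfr.smooth i x hx)).continuousAt.sub ?_
    exact (contMDiffAt_mul (contMDiffAt_sum Finset.univ fun j _ =>
      hfr.smooth_coeff i j j x hx) (hh x hx)).continuousAt
  set W := chartPart (m := 3) p U with hW
  have hWo : IsOpen W := isOpen_chartPart p hfr.isOpen
  set K' := extChartAt (𝓡 3) p '' K with hK'
  have hK'c : IsCompact K' := hK.image_of_continuousOn ((continuousOn_extChartAt p).mono hKp)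
  set G : Fin 3 → EuclideanSpace ℝ (Fin 3) → ℝ := fun k u =>
    volDensity p u * (h ((extChartAt (𝓡 3) p).symm u) * chartField p (e i) u k) with hG
  have hGs : ∀ k, ∀ u ∈ W, ContDiffAt ℝ ∞ (G k) u := by
    intro k u hu
    obtain ⟨x, hxU, hx, rfl⟩ := exists_eq_chart hu
    refine (hfr.contDiffAt_volDensity hu).1.mul ((contDiffAt_comp_symm hx (hh x hxU)).mul ?_)
    exact (EuclideanSpace.proj (𝕜 := ℝ) k).contDiff.contDiffAt.comp _
      (contDiffAt_chartField hx (hfr.smooth i x hxU))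
  have hGW : ∀ k, ∀ u ∈ W, W.indicator (G k) =ᶠ[nhds u] G k := by
    intro k u hu
    filter_upwards [hWo.mem_nhds hu] with v hv using Set.indicator_of_mem hv _
  have hGK : ∀ k, ∀ u ∉ K', W.indicator (G k) u = 0 := by
    intro k u hu
    by_cases huW : u ∈ W
    · rw [Set.indicator_of_mem huW]
      have : h ((extChartAt (𝓡 3) p).symm u) = 0 := by
        refine hhK _ fun hmem => hu ⟨_, hmem, (extChartAt (𝓡 3) p).right_inv huW.1⟩
      change volDensity p u * (h ((extChartAt (𝓡 3) p).symm u) * _) = 0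
      rw [this]
      ring
    · exact Set.indicator_of_notMem huW _
  -- Extension by zero is smooth: points of `K'` are interior to `W`, and off the closed set `K'`
  -- the extension vanishes in a neighbourhood.
  have hcd : ∀ k, ContDiff ℝ 1 (W.indicator (G k)) := by
    intro k
    rw [contDiff_iff_contDiffAt]
    intro u
    by_cases hu : u ∈ K'
    · have huW : u ∈ W := by
        obtain ⟨x, hxK, rfl⟩ := hu
        refine ⟨(extChartAt (𝓡 3) p).map_source (hKp hxK), ?_⟩
        rw [Set.mem_preimage, (extChartAt (𝓡 3) p).left_inv (hKp hxK)]
        exact hKU hxK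
      exact ((hGs k u huW).congr_of_eventuallyEq (hGW k u huW)).of_le (by simp)
    · have : W.indicator (G k) =ᶠ[nhds u] fun _ => 0 := by
        filter_upwards [hK'c.isClosed.isOpen_compl.mem_nhds hu] with v hv using hGK k v hv
      exact contDiffAt_const.congr_of_eventuallyEq this
  have hcs : ∀ k, HasCompactSupport (W.indicator (G k)) := fun k =>
    HasCompactSupport.intro hK'c (hGK k)
  have hpt : ∀ u ∈ W, volDensity p u * (dirDeriv (e i) h ((extChartAt (𝓡 3) p).symm u) -
      (∑ j, c i j j ((extChartAt (𝓡 3) p).symm u)) * h ((extChartAt (𝓡 3) p).symm u)) =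
      ∑ k, pderiv k (W.indicator (G k)) u := by
    intro u hu
    simp only [fun k => pderiv_congr (hGW k u hu) k]
    obtain ⟨x, hxU, hx, rfl⟩ := exists_eq_chart hu
    have hcf : ∀ k, ContDiffAt ℝ ∞ (fun u => chartField p (e i) u k) (extChartAt (𝓡 3) p x) :=
      fun k => (EuclideanSpace.proj (𝕜 := ℝ) k).contDiff.contDiffAt.comp _
        (contDiffAt_chartField hx (hfr.smooth i x hxU))
    have hpm : ∀ (k : Fin 3) (F H : EuclideanSpace ℝ (Fin 3) → ℝ) (v : EuclideanSpace ℝ (Fin 3)),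
        ContDiffAt ℝ ∞ F v → ContDiffAt ℝ ∞ H v →
        pderiv k (fun u => F u * H u) v = F v * pderiv k H v + H v * pderiv k F v := by
      intro k F H v hF hH
      unfold pderiv
      rw [fderiv_fun_mul (hF.differentiableAt (by simp)) (hH.differentiableAt (by simp))]
      simp
    have hhs := contDiffAt_comp_symm hx (hh x hxU)
    have hρ := (hfr.contDiffAt_volDensity hu).1
    have e1 : ∀ k, pderiv k (G k) (extChartAt (𝓡 3) p x) =
        volDensity p (extChartAt (𝓡 3) p x) *
          (h x * pderiv k (fun u => chartField p (e i) u k) (extChartAt (𝓡 3) p x) +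
           dirDeriv (e i) (coord p k) x *
            pderiv k (fun u => h ((extChartAt (𝓡 3) p).symm u)) (extChartAt (𝓡 3) p x)) +
        h x * dirDeriv (e i) (coord p k) x * pderiv k (volDensity p) (extChartAt (𝓡 3) p x) := by
      intro k
      have h1 := hpm k (volDensity p) (fun u => h ((extChartAt (𝓡 3) p).symm u) *
        chartField p (e i) u k) _ hρ (hhs.mul (hcf k))
      rw [hpm k _ _ _ hhs (hcf k), (extChartAt (𝓡 3) p).left_inv hx, chartField_apply hx] at h1
      exact h1
    simp only [e1]
    rw [(extChartAt (𝓡 3) p).left_inv hx,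
      dirDeriv_eq_sum_pderiv hx ((hh x hxU).mdifferentiableAt (by simp))]
    have h2 := hfr.sum_pderiv_density hx hxU i
    simp only [Fin.sum_univ_three] at h2 ⊢
    linear_combination -(h x) * h2
  rw [setIntegral_congr_fun hWo.measurableSet hpt]
  have hint : ∀ k, Integrable (pderiv k (W.indicator (G k))) := fun k =>
    (((hcd k).continuous_fderiv (by simp)).clm_apply
      continuous_const).integrable_of_hasCompactSupport ((hcs k).fderiv_apply (𝕜 := ℝ) _)
  rw [integral_finsetSum _ fun k _ => (hint k).integrableOn]
  refine Finset.sum_eq_zero fun k _ => ?_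
  rw [setIntegral_eq_integral_of_forall_compl_eq_zero, integral_pderiv_eq_zero (hcd k) (hcs k)]
  intro u hu
  have huK : u ∉ K' := by
    rintro ⟨x, hxK, rfl⟩
    refine hu ⟨(extChartAt (𝓡 3) p).map_source (hKp hxK), ?_⟩
    rw [Set.mem_preimage, (extChartAt (𝓡 3) p).left_inv (hKp hxK)]
    exact hKU hxK
  have : W.indicator (G k) =ᶠ[nhds u] fun _ => 0 := by
    filter_upwards [hK'c.isClosed.isOpen_compl.mem_nhds huK] with v hv using hGK k v hv
  rw [pderiv_congr this]
  simp [pderiv]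

theorem IsFrame.integrableOn (hfr : IsFrame U e c) {Ω : Set M} (hΩ : IsCompact Ω) (hΩU : Ω ⊆ U)
    {f : M → ℝ} (hf : ContinuousOn f U) : IntegrableOn f Ω (riemannianVolume 3 M) := by
  obtain ⟨C, hC⟩ := hΩ.exists_bound_of_continuousOn (hf.mono hΩU)
  exact IntegrableOn.of_bound (hfr.measure_lt_top hΩ hΩU)
    ((hf.mono hΩU).aestronglyMeasurable hΩ.isClosed.measurableSet) C
    ((ae_restrict_iff' hΩ.isClosed.measurableSet).2 (Filter.Eventually.of_forall hC))

/-- The divergence theorem: `∫ div (h • e i) = 0` if `h` vanishes off a compact set. -/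
theorem IsFrame.integral_divergence (hfr : IsFrame U e c) {h : M → ℝ} {Ω : Set M}
    (hΩ : IsCompact Ω) (hΩU : Ω ⊆ U)
    (hh : ∀ x ∈ U, ContMDiffAt (𝓡 3) 𝓘(ℝ, ℝ) ∞ h x) (hhΩ : ∀ x ∉ Ω, h x = 0) (i : Fin 3) :
    ∫ x in Ω, (dirDeriv (e i) h x - (∑ j, c i j j x) * h x) ∂(riemannianVolume 3 M) = 0 := by
  have hUm := hfr.isOpen.measurableSet
  have hoff : ∀ (k : M → ℝ), (∀ x ∉ Ω, k x = 0) → ∀ x ∉ Ω, dirDeriv (e i) k x = 0 := by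
    intro k hk x hx
    have : k =ᶠ[nhds x] fun _ => 0 := by
      filter_upwards [hΩ.isClosed.isOpen_compl.mem_nhds hx] with y hy using hk y hy
    rw [dirDeriv_congr this, dirDeriv_const]
  have hred : ∀ (k : M → ℝ), (∀ x ∉ Ω, k x = 0) →
      ∫ x in Ω, (dirDeriv (e i) k x - (∑ j, c i j j x) * k x) ∂(riemannianVolume 3 M) =
      ∫ x in U, (dirDeriv (e i) k x - (∑ j, c i j j x) * k x) ∂(riemannianVolume 3 M) := by
    intro k hk
    refine (setIntegral_eq_of_subset_of_forall_sdiff_eq_zero hUm hΩU ?_).symm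
    rintro x ⟨-, hx⟩
    simp [hoff k hk x hx, hk x hx]
  have : LocallyCompactSpace M := ChartedSpace.locallyCompactSpace (EuclideanSpace ℝ (Fin 3)) M
  obtain ⟨t, -, ht⟩ := hΩ.elim_nhds_subcover (fun p : M => (extChartAt (𝓡 3) p).source)
    fun p _ => extChartAt_source_mem_nhds p
  -- Split `h` by a partition of unity over finitely many chart domains covering `Ω`; each piece
  -- vanishes off a compact subset of one domain.
  obtain ⟨ρ, hρ⟩ := SmoothPartitionOfUnity.exists_isSubordinate (𝓡 3) hΩ.isClosed
    (fun p : t => (extChartAt (𝓡 3) (p : M)).source)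
    (fun p => isOpen_extChartAt_source _) (by simpa [Set.iUnion_subtype] using ht)
  have hsm : ∀ p : t, ∀ x ∈ U, ContMDiffAt (𝓡 3) 𝓘(ℝ, ℝ) ∞ (fun y => ρ p y * h y) x :=
    fun p x hx => contMDiffAt_mul (ρ p).contMDiff.contMDiffAt (hh x hx)
  have hsum : h = fun x => ∑ p : t, ρ p x * h x := by
    funext x
    by_cases hx : x ∈ Ω
    · rw [← Finset.sum_mul, ← finsum_eq_sum_of_fintype, ρ.sum_eq_one hx, one_mul]
    · simp [hhΩ x hx]
  have hpt : ∀ x ∈ Ω, dirDeriv (e i) h x - (∑ j, c i j j x) * h x =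
      ∑ p : t, (dirDeriv (e i) (fun y => ρ p y * h y) x -
        (∑ j, c i j j x) * (ρ p x * h x)) := by
    intro x hx
    rw [Finset.sum_sub_distrib, ← Finset.mul_sum, ← congrFun hsum x,
      ← dirDeriv_sum Finset.univ (fun p _ => hsm p x (hΩU hx)), ← hsum]
  rw [setIntegral_congr_fun hΩ.isClosed.measurableSet hpt, integral_finsetSum]
  · refine Finset.sum_eq_zero fun p _ => ?_
    rw [hred (fun y => ρ p y * h y) fun x hx => by simp [hhΩ x hx]]
    have hcl : IsClosed (tsupport (ρ p)) := isClosed_tsupport _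
    refine hfr.integral_divergence_chart (p := p) (hΩ.inter_right hcl)
      (Set.inter_subset_left.trans hΩU) (Set.inter_subset_right.trans (hρ p)) (hsm p) ?_ i
    intro x hx
    by_cases hxΩ : x ∈ Ω
    · rw [image_eq_zero_of_notMem_tsupport fun hx' => hx ⟨hxΩ, hx'⟩, zero_mul]
    · rw [hhΩ x hxΩ, mul_zero]
  · intro p _
    refine hfr.integrableOn hΩ hΩU fun x hx => ContinuousAt.continuousWithinAt ?_
    refine (contMDiffAt_dirDeriv (hsm p x hx) (hfr.smooth i x hx)).continuousAt.sub ?_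
    exact (contMDiffAt_mul (contMDiffAt_sum Finset.univ fun j _ =>
      hfr.smooth_coeff i j j x hx) (hsm p x hx)).continuousAt

end Divergence

/-! ### Variations of a map in orthonormal frames -/

section Variation

theorem sum_inner_smul_of_orthonormal {n : ℕ} {N : Type*} [TopologicalSpace N]
    [ChartedSpace (EuclideanSpace ℝ (Fin n)) N]
    [RiemannianBundle (fun y : N => TangentSpace (𝓡 n) y)] {y : N}
    {b : Fin n → TangentSpace (𝓡 n) y} (hb : Orthonormal ℝ b) (v : TangentSpace (𝓡 n) y) :
    ∑ a, inner ℝ (b a) v • b a = v := by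
  -- The inner product on the tangent space is that of the bundle, but the underlying vector space
  -- is ℝⁿ, which supplies the dimension; n orthonormal vectors then form a basis.
  have hfin : FiniteDimensional ℝ (TangentSpace (𝓡 n) y) :=
    inferInstanceAs (FiniteDimensional ℝ (EuclideanSpace ℝ (Fin n)))
  have hcard : Fintype.card (Fin n) = Module.finrank ℝ (TangentSpace (𝓡 n) y) :=
    (finrank_euclideanSpace (𝕜 := ℝ) (ι := Fin n)).symm
  have hspan : ⊤ ≤ Submodule.span ℝ (Set.range b) :=
    (hb.linearIndependent.span_eq_top_of_card_eq_finrank' hcard).ge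
  simpa using (OrthonormalBasis.mk hb hspan).sum_repr' v

variable {m n : ℕ}
  {M : Type*} [TopologicalSpace M] [ChartedSpace (EuclideanSpace ℝ (Fin m)) M]
  {e : Fin m → (x : M) → TangentSpace (𝓡 m) x}
  {N : Type*} [TopologicalSpace N] [ChartedSpace (EuclideanSpace ℝ (Fin n)) N]
  {V : Set N} {ε : Fin n → (y : N) → TangentSpace (𝓡 n) y} {c' : Fin n → Fin n → Fin n → N → ℝ}
  {Φ : ℝ → M → N} {t : ℝ} {x : M}

/-- The inverse of the matrix of components of the frame `ε` in the chart at `q`. -/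
noncomputable def frameInv (ε : Fin n → (y : N) → TangentSpace (𝓡 n) y) (q : N) (b a : Fin n)
    (y : N) : ℝ :=
  (Matrix.of fun a b => dirDeriv (ε a) (coord q b) y)⁻¹ b a

theorem ContMDiff.slice (hΦ : ContMDiff (𝓘(ℝ, ℝ).prod (𝓡 m)) (𝓡 n) ∞ fun z : ℝ × M => Φ z.1 z.2)
    (t : ℝ) : ContMDiff (𝓡 m) (𝓡 n) ∞ (Φ t) :=
  ContMDiff.comp (g := fun z : ℝ × M => Φ z.1 z.2) (f := fun y => (t, y)) hΦ
    (contMDiff_const.prodMk contMDiff_id)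

theorem ContMDiff.time (hΦ : ContMDiff (𝓘(ℝ, ℝ).prod (𝓡 m)) (𝓡 n) ∞ fun z : ℝ × M => Φ z.1 z.2)
    (x : M) : ContMDiff 𝓘(ℝ, ℝ) (𝓡 n) ∞ (fun s => Φ s x) :=
  ContMDiff.comp (g := fun z : ℝ × M => Φ z.1 z.2) (f := fun s => (s, x)) hΦ
    (contMDiff_id.prodMk contMDiff_const)

theorem JointSmoothAt.comp_variation
    (hΦ : ContMDiff (𝓘(ℝ, ℝ).prod (𝓡 m)) (𝓡 n) ∞ fun z : ℝ × M => Φ z.1 z.2) {f : N → ℝ}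
    (hf : ContMDiffAt (𝓡 n) 𝓘(ℝ, ℝ) ∞ f (Φ t x)) :
    JointSmoothAt (m := m) (fun t x => f (Φ t x)) t x :=
  ContMDiffAt.comp (t, x) (I' := 𝓡 n) (g := f) hf hΦ.contMDiffAt

theorem dirDeriv_comp_map {φ : M → N} {A : Fin n → ℝ} {X : (x : M) → TangentSpace (𝓡 m) x}
    (hφ : MDifferentiableAt (𝓡 m) (𝓡 n) φ x)
    (hdφ : mfderiv (𝓡 m) (𝓡 n) φ x (X x) = ∑ a, A a • ε a (φ x))
    {f : N → ℝ} (hf : MDifferentiableAt (𝓡 n) 𝓘(ℝ, ℝ) f (φ x)) :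
    dirDeriv X (fun z => f (φ z)) x = ∑ a, A a * dirDeriv (ε a) f (φ x) := by
  have h2 : mfderiv (𝓡 m) 𝓘(ℝ, ℝ) (fun z => f (φ z)) x =
      (mfderiv (𝓡 n) 𝓘(ℝ, ℝ) f (φ x)).comp (mfderiv (𝓡 m) (𝓡 n) φ x) := mfderiv_comp x hf hφ
  unfold dirDeriv
  rw [h2]
  refine (congrArg (mfderiv (𝓡 n) 𝓘(ℝ, ℝ) f (φ x)) hdφ).trans ?_
  exact (map_sum _ _ _).trans (Finset.sum_congr rfl fun d _ => map_smul _ _ _)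

theorem deriv_comp_curve {γ : ℝ → N} {B : Fin n → ℝ} (hγ : MDifferentiableAt 𝓘(ℝ, ℝ) (𝓡 n) γ t)
    (hdγ : mfderiv 𝓘(ℝ, ℝ) (𝓡 n) γ t (1 : ℝ) = ∑ a, B a • ε a (γ t))
    {f : N → ℝ} (hf : MDifferentiableAt (𝓡 n) 𝓘(ℝ, ℝ) f (γ t)) :
    deriv (fun s => f (γ s)) t = ∑ a, B a * dirDeriv (ε a) f (γ t) := by
  have h2 : mfderiv 𝓘(ℝ, ℝ) 𝓘(ℝ, ℝ) (fun z => f (γ z)) t =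
      (mfderiv (𝓡 n) 𝓘(ℝ, ℝ) f (γ t)).comp (mfderiv 𝓘(ℝ, ℝ) (𝓡 n) γ t) := mfderiv_comp t hf hγ
  unfold dirDeriv
  rw [← fderiv_apply_one_eq_deriv, ← mfderiv_eq_fderiv, h2]
  refine (congrArg (mfderiv (𝓡 n) 𝓘(ℝ, ℝ) f (γ t)) hdγ).trans ?_
  exact (map_sum _ _ _).trans (Finset.sum_congr rfl fun d _ => map_smul _ _ _)

variable [RiemannianBundle (fun y : N => TangentSpace (𝓡 n) y)]

/-- The components of `dΦₜ(e s)` in the frame `ε`. -/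
noncomputable def spaceComp (e : Fin m → (x : M) → TangentSpace (𝓡 m) x)
    (ε : Fin n → (y : N) → TangentSpace (𝓡 n) y) (Φ : ℝ → M → N) (s : Fin m) (a : Fin n)
    (t : ℝ) (x : M) : ℝ :=
  inner ℝ (ε a (Φ t x)) (mfderiv (𝓡 m) (𝓡 n) (Φ t) x (e s x))

/-- The components of the velocity `∂Φ/∂t` in the frame `ε`. -/
noncomputable def timeComp (ε : Fin n → (y : N) → TangentSpace (𝓡 n) y) (Φ : ℝ → M → N)
    (a : Fin n) (t : ℝ) (x : M) : ℝ :=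
  inner ℝ (ε a (Φ t x)) (mfderiv 𝓘(ℝ, ℝ) (𝓡 n) (fun s => Φ s x) t (1 : ℝ))

variable [IsManifold (𝓡 n) ∞ N]

theorem IsFrame.isUnit_det_comp (hfr : IsFrame V ε c') {q y : N}
    (hq : y ∈ (extChartAt (𝓡 n) q).source) (hy : y ∈ V) :
    IsUnit (Matrix.of fun a b => dirDeriv (ε a) (coord q b) y).det := by
  have h := (hfr.det_metric_pos hq hy).1
  refine isUnit_iff_ne_zero.2 fun h0 => ?_
  rw [h0] at h
  norm_num at h

theorem IsFrame.contMDiffAt_frameInv (hfr : IsFrame V ε c') {q y : N}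
    (hq : y ∈ (extChartAt (𝓡 n) q).source) (hy : y ∈ V) (b a : Fin n) :
    ContMDiffAt (𝓡 n) 𝓘(ℝ, ℝ) ∞ (frameInv ε q b a) y :=
  contMDiffAt_matrix_inv (A := fun y => Matrix.of fun a b => dirDeriv (ε a) (coord q b) y)
    (hfr.contMDiffAt_comp hq hy) (hfr.isUnit_det_comp hq hy).ne_zero b a

/-- Frame components are recovered linearly from coordinate components. This gives their smoothness,
and shows that a vector with zero coordinates has zero frame components. -/
theorem IsFrame.eq_sum_frameInv (hfr : IsFrame V ε c') {q y : N}
    (hq : y ∈ (extChartAt (𝓡 n) q).source) (hy : y ∈ V) {A X : Fin n → ℝ}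
    (h : ∀ b, X b = ∑ a, A a * dirDeriv (ε a) (coord q b) y) (a : Fin n) :
    A a = ∑ b, X b * frameInv ε q b a y := by
  set E : Matrix (Fin n) (Fin n) ℝ := Matrix.of fun a b => dirDeriv (ε a) (coord q b) y with hE
  have h1 : X = Matrix.vecMul A E := funext h
  have h2 : Matrix.vecMul X E⁻¹ = A := by
    rw [h1, Matrix.vecMul_vecMul, Matrix.mul_nonsing_inv _ (hfr.isUnit_det_comp hq hy),
      Matrix.vecMul_one]
  exact (congrFun h2 a).symm

theorem IsFrame.mfderiv_eq_sum_spaceComp (hfr : IsFrame V ε c')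
    (e : Fin m → (x : M) → TangentSpace (𝓡 m) x) (hV : Φ t x ∈ V) (s : Fin m) :
    mfderiv (𝓡 m) (𝓡 n) (Φ t) x (e s x) = ∑ a, spaceComp e ε Φ s a t x • ε a (Φ t x) :=
  (sum_inner_smul_of_orthonormal (hfr.orthonormal _ hV) _).symm

theorem IsFrame.mfderiv_eq_sum_timeComp (hfr : IsFrame V ε c') (hV : Φ t x ∈ V) :
    mfderiv 𝓘(ℝ, ℝ) (𝓡 n) (fun s => Φ s x) t (1 : ℝ) = ∑ a, timeComp ε Φ a t x • ε a (Φ t x) :=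
  (sum_inner_smul_of_orthonormal (hfr.orthonormal _ hV) _).symm

theorem IsFrame.dirDeriv_variation (hfr : IsFrame V ε c')
    (hΦ : ContMDiff (𝓘(ℝ, ℝ).prod (𝓡 m)) (𝓡 n) ∞ fun z : ℝ × M => Φ z.1 z.2) (hV : Φ t x ∈ V)
    {f : N → ℝ} (hf : MDifferentiableAt (𝓡 n) 𝓘(ℝ, ℝ) f (Φ t x)) (s : Fin m) :
    dirDeriv (e s) (fun z => f (Φ t z)) x =
      ∑ a, spaceComp e ε Φ s a t x * dirDeriv (ε a) f (Φ t x) :=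
  dirDeriv_comp_map ((ContMDiff.slice hΦ t).mdifferentiableAt (by simp))
    (hfr.mfderiv_eq_sum_spaceComp e hV s) hf

theorem IsFrame.deriv_variation (hfr : IsFrame V ε c')
    (hΦ : ContMDiff (𝓘(ℝ, ℝ).prod (𝓡 m)) (𝓡 n) ∞ fun z : ℝ × M => Φ z.1 z.2) (hV : Φ t x ∈ V)
    {f : N → ℝ} (hf : MDifferentiableAt (𝓡 n) 𝓘(ℝ, ℝ) f (Φ t x)) :
    deriv (fun s => f (Φ s x)) t = ∑ a, timeComp ε Φ a t x * dirDeriv (ε a) f (Φ t x) :=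
  deriv_comp_curve (γ := fun s => Φ s x) ((ContMDiff.time hΦ x).mdifferentiableAt (by simp))
    (hfr.mfderiv_eq_sum_timeComp hV) hf

theorem IsFrame.eventually_mem (hfr : IsFrame V ε c')
    (hΦ : ContMDiff (𝓘(ℝ, ℝ).prod (𝓡 m)) (𝓡 n) ∞ fun z : ℝ × M => Φ z.1 z.2) (hV : Φ t x ∈ V) :
    ∀ᶠ z : ℝ × M in nhds (t, x), Φ z.1 z.2 ∈ V :=
  hΦ.continuous.continuousAt.eventually (hfr.isOpen.mem_nhds hV)

variable [IsManifold (𝓡 m) ∞ M]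

/-- Near the given point the components are products of e_s(y^b ∘ Φ_t) with entries of the inverse
frame matrix, all jointly smooth. -/
theorem IsFrame.jointSmoothAt_spaceComp (hfr : IsFrame V ε c')
    (hΦ : ContMDiff (𝓘(ℝ, ℝ).prod (𝓡 m)) (𝓡 n) ∞ fun z : ℝ × M => Φ z.1 z.2) (hV : Φ t x ∈ V)
    {s : Fin m} (he : ContMDiffAt (𝓡 m) (𝓡 m).tangent ∞
      (fun x => (⟨x, e s x⟩ : TangentBundle (𝓡 m) M)) x) (a : Fin n) :
    JointSmoothAt (m := m) (spaceComp e ε Φ s a) t x := by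
  set q := Φ t x with hqdef
  have hq : q ∈ (extChartAt (𝓡 n) q).source := mem_extChartAt_source q
  have hc : ∀ᶠ z : ℝ × M in nhds (t, x), Φ z.1 z.2 ∈ (extChartAt (𝓡 n) q).source :=
    hΦ.continuous.continuousAt.eventually (source_mem_nhds hq)
  refine JointSmoothAt.congr (JointSmoothAt.sum Finset.univ fun b _ => JointSmoothAt.mul
    (JointSmoothAt.dirDeriv (JointSmoothAt.comp_variation hΦ (contMDiffAt_coord hq b)) he)
    (JointSmoothAt.comp_variation hΦ (hfr.contMDiffAt_frameInv hq hV b a))) ?_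
  filter_upwards [hc, hfr.eventually_mem hΦ hV] with z hz hzV
  exact hfr.eq_sum_frameInv hz hzV (fun b => hfr.dirDeriv_variation hΦ hzV
    ((contMDiffAt_coord hz b).mdifferentiableAt (by simp)) s) a

theorem IsFrame.jointSmoothAt_timeComp (hfr : IsFrame V ε c')
    (hΦ : ContMDiff (𝓘(ℝ, ℝ).prod (𝓡 m)) (𝓡 n) ∞ fun z : ℝ × M => Φ z.1 z.2) (hV : Φ t x ∈ V)
    (a : Fin n) : JointSmoothAt (m := m) (timeComp ε Φ a) t x := by
  set q := Φ t x with hqdef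
  have hq : q ∈ (extChartAt (𝓡 n) q).source := mem_extChartAt_source q
  have hc : ∀ᶠ z : ℝ × M in nhds (t, x), Φ z.1 z.2 ∈ (extChartAt (𝓡 n) q).source :=
    hΦ.continuous.continuousAt.eventually (source_mem_nhds hq)
  refine JointSmoothAt.congr (JointSmoothAt.sum Finset.univ fun b _ => JointSmoothAt.mul
    (JointSmoothAt.deriv (JointSmoothAt.comp_variation hΦ (contMDiffAt_coord hq b)))
    (JointSmoothAt.comp_variation hΦ (hfr.contMDiffAt_frameInv hq hV b a))) ?_
  filter_upwards [hc, hfr.eventually_mem hΦ hV] with z hz hzV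
  exact hfr.eq_sum_frameInv hz hzV (fun b => hfr.deriv_variation hΦ hzV
    ((contMDiffAt_coord hz b).mdifferentiableAt (by simp))) a

/-- The symmetry `∇_t dΦ(e s) = ∇_{e s} ∂Φ/∂t` in the frame `ε`. -/
theorem IsFrame.deriv_spaceComp (hfr : IsFrame V ε c')
    (hΦ : ContMDiff (𝓘(ℝ, ℝ).prod (𝓡 m)) (𝓡 n) ∞ fun z : ℝ × M => Φ z.1 z.2) (hV : Φ t x ∈ V)
    {s : Fin m} (he : ContMDiffAt (𝓡 m) (𝓡 m).tangent ∞
      (fun x => (⟨x, e s x⟩ : TangentBundle (𝓡 m) M)) x) (d : Fin n) :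
    deriv (fun r => spaceComp e ε Φ s d r x) t =
      dirDeriv (e s) (timeComp ε Φ d t) x -
        ∑ a, ∑ b, spaceComp e ε Φ s a t x * timeComp ε Φ b t x * c' b a d (Φ t x) := by
  set q := Φ t x with hqdef
  have hq : q ∈ (extChartAt (𝓡 n) q).source := mem_extChartAt_source q
  have hA := hfr.jointSmoothAt_spaceComp (e := e) hΦ hV he
  have hB := hfr.jointSmoothAt_timeComp hΦ hV
  have hmem := hfr.eventually_mem hΦ hV
  have hct : ContinuousAt (fun s : ℝ => (s, x)) t := continuousAt_id.prodMk continuousAt_const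
  have hcx : ContinuousAt (fun y : M => (t, y)) x := continuousAt_const.prodMk continuousAt_id
  have hsrc : ∀ᶠ z : ℝ × M in nhds (t, x), Φ z.1 z.2 ∈ (extChartAt (𝓡 n) q).source :=
    hΦ.continuous.continuousAt.eventually (source_mem_nhds hq)
  -- Test the claim on a coordinate y^k. The operators ∂_t and e_s commute on y^k ∘ Φ; the chain
  -- rule on both sides leaves second derivatives of y^k in the two orders, and their difference is
  -- the bracket term.
  have key : ∀ k : Fin n, ∑ a, (deriv (fun r => spaceComp e ε Φ s a r x) t -
      dirDeriv (e s) (timeComp ε Φ a t) x +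
      ∑ g, ∑ b, spaceComp e ε Φ s g t x * timeComp ε Φ b t x * c' b g a q) *
        dirDeriv (ε a) (coord q k) q = 0 := by
    intro k
    have hf : ContMDiffAt (𝓡 n) 𝓘(ℝ, ℝ) ∞ (coord q k) q := contMDiffAt_coord hq k
    have hεf : ∀ a, ContMDiffAt (𝓡 n) 𝓘(ℝ, ℝ) ∞ (dirDeriv (ε a) (coord q k)) q :=
      fun a => contMDiffAt_dirDeriv hf (hfr.smooth a q hV)
    have hJ := fun a => JointSmoothAt.comp_variation hΦ (hεf a)
    have h1 := JointSmoothAt.deriv_dirDeriv (JointSmoothAt.comp_variation hΦ hf) (e s)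
    have h2 : (fun r => dirDeriv (e s) (fun z => coord q k (Φ r z)) x) =ᶠ[nhds t]
        fun r => ∑ a, spaceComp e ε Φ s a r x * dirDeriv (ε a) (coord q k) (Φ r x) := by
      filter_upwards [hct.eventually hmem, hct.eventually hsrc] with r hr hrs
      exact hfr.dirDeriv_variation hΦ hr ((contMDiffAt_coord hrs k).mdifferentiableAt (by simp)) s
    have h3 : (fun y => deriv (fun s => coord q k (Φ s y)) t) =ᶠ[nhds x]
        fun y => ∑ a, timeComp ε Φ a t y * dirDeriv (ε a) (coord q k) (Φ t y) := by
      filter_upwards [hcx.eventually hmem, hcx.eventually hsrc] with y hy hys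
      exact hfr.deriv_variation hΦ hy ((contMDiffAt_coord hys k).mdifferentiableAt (by simp))
    rw [h2.deriv_eq, dirDeriv_congr h3, dirDeriv_sum _ fun a _ =>
      contMDiffAt_mul (hB a).slice (hJ a).slice,
      (HasDerivAt.fun_sum fun a _ => (hA a).hasDerivAt.fun_mul (hJ a).hasDerivAt).deriv] at h1
    simp only [dirDeriv_mul (hB _).slice (hJ _).slice,
      hfr.dirDeriv_variation hΦ hV ((hεf _).mdifferentiableAt (by simp)),
      hfr.deriv_variation hΦ hV ((hεf _).mdifferentiableAt (by simp))] at h1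
    have h4 := fun b a => hfr.commutator hV hf b a
    rw [← hqdef] at h1
    have h5 : ∑ a, (∑ g, ∑ b, spaceComp e ε Φ s g t x * timeComp ε Φ b t x * c' b g a q) *
        dirDeriv (ε a) (coord q k) q = ∑ g, ∑ b, spaceComp e ε Φ s g t x * timeComp ε Φ b t x *
          (dirDeriv (ε b) (dirDeriv (ε g) (coord q k)) q -
            dirDeriv (ε g) (dirDeriv (ε b) (coord q k)) q) := by
      simp only [h4, Finset.sum_mul, Finset.mul_sum]
      rw [Finset.sum_comm]
      refine Finset.sum_congr rfl fun g _ => ?_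
      rw [Finset.sum_comm]
      exact Finset.sum_congr rfl fun b _ => Finset.sum_congr rfl fun a _ => by ring
    have h6 : ∑ g, ∑ b, spaceComp e ε Φ s g t x * timeComp ε Φ b t x *
          dirDeriv (ε g) (dirDeriv (ε b) (coord q k)) q = ∑ b, timeComp ε Φ b t x *
          ∑ g, spaceComp e ε Φ s g t x * dirDeriv (ε g) (dirDeriv (ε b) (coord q k)) q := by
      rw [Finset.sum_comm]
      simp only [Finset.mul_sum]
      exact Finset.sum_congr rfl fun b _ => Finset.sum_congr rfl fun a _ => by ring
    have h7 : ∑ g, ∑ b, spaceComp e ε Φ s g t x * timeComp ε Φ b t x *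
          dirDeriv (ε b) (dirDeriv (ε g) (coord q k)) q = ∑ g, spaceComp e ε Φ s g t x *
          ∑ b, timeComp ε Φ b t x * dirDeriv (ε b) (dirDeriv (ε g) (coord q k)) q := by
      simp only [Finset.mul_sum]
      exact Finset.sum_congr rfl fun b _ => Finset.sum_congr rfl fun a _ => by ring
    simp only [add_mul, sub_mul, Finset.sum_add_distrib, Finset.sum_sub_distrib]
    rw [h5]
    simp only [mul_sub, Finset.sum_sub_distrib]
    rw [h6, h7]
    simp only [Finset.sum_add_distrib] at h1
    linear_combination h1
  -- A vector all of whose coordinates vanish has zero frame components.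
  have h0 := hfr.eq_sum_frameInv hq hV (X := fun _ => 0) (fun k => (key k).symm) d
  simp only [zero_mul, Finset.sum_const_zero] at h0
  linear_combination h0

end Variation

/-! ### The first variation of the bienergy -/

section FirstVariation

open MeasureTheory

/-- The time derivative is jointly continuous, hence bounded on the compact set [-δ, δ] × Ω; that
constant is the dominating function. -/
theorem hasDerivAt_setIntegral_of_jointSmoothAt {m : ℕ} {M : Type*} [TopologicalSpace M]
    [ChartedSpace (EuclideanSpace ℝ (Fin m)) M] [IsManifold (𝓡 m) ∞ M] [T2Space M]
    [SecondCountableTopology M] [MeasurableSpace M] [BorelSpace M] {μ : Measure M} {Ω : Set M}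
    (hΩ : IsCompact Ω) (hμ : μ Ω < ⊤) {δ : ℝ} (hδ : 0 < δ) {G : ℝ → M → ℝ}
    (hG : ∀ t ∈ Set.Icc (-δ) δ, ∀ x ∈ Ω, JointSmoothAt (m := m) G t x) :
    HasDerivAt (fun t => ∫ x in Ω, G t x ∂μ) (∫ x in Ω, deriv (fun s => G s x) 0 ∂μ) 0 := by
  have h0 : (0 : ℝ) ∈ Set.Icc (-δ) δ := ⟨by linarith, hδ.le⟩
  have hΩm := hΩ.isClosed.measurableSet
  have hcG : ∀ t ∈ Set.Icc (-δ) δ, ContinuousOn (G t) Ω := fun t ht x hx =>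
    (hG t ht x hx).slice.continuousAt.continuousWithinAt
  have hcG' : ContinuousOn (fun z : ℝ × M => deriv (fun s => G s z.2) z.1) (Set.Icc (-δ) δ ×ˢ Ω) :=
    fun z hz => (hG z.1 hz.1 z.2 hz.2).deriv.continuousAt.continuousWithinAt
  obtain ⟨C, hC⟩ := (isCompact_Icc.prod hΩ).exists_bound_of_continuousOn hcG'
  obtain ⟨C₀, hC₀⟩ := hΩ.exists_bound_of_continuousOn (hcG 0 h0)
  refine (hasDerivAt_integral_of_dominated_loc_of_deriv_le (bound := fun _ => C)
    (F' := fun t x => deriv (fun s => G s x) t) (Icc_mem_nhds (neg_lt_zero.2 hδ) hδ)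
    ?_ ?_ ?_ ?_ ?_ ?_).2
  · filter_upwards [Icc_mem_nhds (by linarith : -δ < 0) hδ] with t ht
    exact (hcG t ht).aestronglyMeasurable hΩm
  · exact IntegrableOn.of_bound hμ ((hcG 0 h0).aestronglyMeasurable hΩm) C₀
      ((ae_restrict_iff' hΩm).2 (Filter.Eventually.of_forall hC₀))
  · refine ContinuousOn.aestronglyMeasurable (fun x hx => ?_) hΩm
    exact (hG 0 h0 x hx).deriv.slice.continuousAt.continuousWithinAt
  · exact (ae_restrict_iff' hΩm).2 (Filter.Eventually.of_forall fun x hx t ht => hC (t, x) ⟨ht, hx⟩)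
  · exact integrableOn_const (by simpa using hμ.ne)
  · exact (ae_restrict_iff' hΩm).2 (Filter.Eventually.of_forall fun x hx t ht =>
      (hG t ht x hx).hasDerivAt)

/-- The tube lemma. It keeps the image of `Ω` inside the domain of the frame for small t, although a
variation may leave it later. -/
theorem exists_forall_mem_of_isCompact {M N : Type*} [TopologicalSpace M] [TopologicalSpace N]
    {Φ : ℝ → M → N} (hΦ : Continuous fun z : ℝ × M => Φ z.1 z.2) {Ω : Set M} (hΩ : IsCompact Ω)
    {V : Set N} (hV : IsOpen V) (h0 : ∀ x ∈ Ω, Φ 0 x ∈ V) :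
    ∃ δ > 0, ∀ t ∈ Set.Icc (-δ) δ, ∀ x ∈ Ω, Φ t x ∈ V := by
  obtain ⟨u, v, hu, -, h0u, hΩv, huv⟩ := generalized_tube_lemma (isCompact_singleton (x := (0 : ℝ)))
    hΩ (hV.preimage hΦ) (by
      rintro ⟨t, x⟩ ⟨ht, hx⟩
      rw [Set.mem_singleton_iff] at ht
      subst ht
      exact h0 x hx)
  obtain ⟨δ, hδ, hb⟩ := Metric.isOpen_iff.1 hu 0 (h0u rfl)
  refine ⟨δ / 2, by positivity, fun t ht x hx => huv (Set.mk_mem_prod (hb ?_) (hΩv hx))⟩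
  rw [Metric.mem_ball, Real.dist_eq, sub_zero, abs_lt]
  exact ⟨by linarith [ht.1], by linarith [ht.2]⟩

variable {m n : ℕ}
  {M : Type*} [TopologicalSpace M] [ChartedSpace (EuclideanSpace ℝ (Fin m)) M]
  [IsManifold (𝓡 m) ∞ M] [RiemannianBundle (fun x : M => TangentSpace (𝓡 m) x)]
  {U : Set M} {e : Fin m → (x : M) → TangentSpace (𝓡 m) x} {c : Fin m → Fin m → Fin m → M → ℝ}
  {N : Type*} [TopologicalSpace N] [ChartedSpace (EuclideanSpace ℝ (Fin n)) N]
  [IsManifold (𝓡 n) ∞ N] [RiemannianBundle (fun y : N => TangentSpace (𝓡 n) y)]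
  {V : Set N} {ε : Fin n → (y : N) → TangentSpace (𝓡 n) y} {c' : Fin n → Fin n → Fin n → N → ℝ}
  {Φ : ℝ → M → N} {t : ℝ} {x : M}

/-- The components in the frame `ε` of the tension fields of the maps `Φ t`. -/
noncomputable def tensionComp (e : Fin m → (x : M) → TangentSpace (𝓡 m) x)
    (c : Fin m → Fin m → Fin m → M → ℝ) (ε : Fin n → (y : N) → TangentSpace (𝓡 n) y)
    (c' : Fin n → Fin n → Fin n → N → ℝ) (Φ : ℝ → M → N) (a : Fin n) (t : ℝ) (x : M) : ℝ :=
  frameTension e c c' (Φ t) (fun s a => spaceComp e ε Φ s a t) a x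

theorem jointSmoothAt_tensionComp (hfr : IsFrame U e c) (hfr' : IsFrame V ε c')
    (hΦ : ContMDiff (𝓘(ℝ, ℝ).prod (𝓡 m)) (𝓡 n) ∞ fun z : ℝ × M => Φ z.1 z.2) (hx : x ∈ U)
    (hV : Φ t x ∈ V) (a : Fin n) : JointSmoothAt (m := m) (tensionComp e c ε c' Φ a) t x := by
  have hA := fun s => hfr'.jointSmoothAt_spaceComp hΦ hV (hfr.smooth s x hx)
  unfold tensionComp frameTension
  refine JointSmoothAt.sum (m := m) (Finset.univ : Finset (Fin m)) fun s _ => ?_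
  refine JointSmoothAt.sub (JointSmoothAt.add ((hA s a).dirDeriv (hfr.smooth s x hx)) ?_) ?_
  · refine JointSmoothAt.sum (Finset.univ : Finset (Fin n)) fun b _ =>
      JointSmoothAt.sum (Finset.univ : Finset (Fin n)) fun d _ => ?_
    exact ((JointSmoothAt.comp_variation hΦ (hfr'.contMDiffAt_connCoeff hV b d a)).mul
      (hA s b)).mul (hA s d)
  · exact JointSmoothAt.sum (Finset.univ : Finset (Fin m)) fun r _ =>
      (JointSmoothAt.of_space (hfr.contMDiffAt_connCoeff hx s s r) t).mul (hA r a)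

theorem tensionNormSq_variation (hfr : IsFrame U e c) (hfr' : IsFrame V ε c')
    (hΦ : ContMDiff (𝓘(ℝ, ℝ).prod (𝓡 m)) (𝓡 n) ∞ fun z : ℝ × M => Φ z.1 z.2) (hx : x ∈ U)
    (hV : Φ t x ∈ V) :
    tensionNormSq (m := m) (n := n) (Φ t) x = ∑ a, tensionComp e c ε c' Φ a t x ^ 2 := by
  refine tensionNormSq_eq hfr hfr' hx (ContMDiff.slice hΦ t).contMDiffAt hV
    (fun s a => (hfr'.jointSmoothAt_spaceComp hΦ hV (hfr.smooth s x hx) a).slice) ?_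
  have hcx : ContinuousAt (fun y : M => (t, y)) x := continuousAt_const.prodMk continuousAt_id
  filter_upwards [hcx.eventually (hfr'.eventually_mem hΦ hV)] with z hz s
  exact hfr'.mfderiv_eq_sum_spaceComp e hz s

/-- For small t the map Φ_t sends `Ω` into `V`, so the density is half the sum of squares of the
tension components and may be differentiated under the integral. -/
theorem hasDerivAt_bienergy [T2Space M] [SecondCountableTopology M] [MeasurableSpace M]
    [BorelSpace M] (hfr : IsFrame U e c) (hfr' : IsFrame V ε c')
    (hΦ : ContMDiff (𝓘(ℝ, ℝ).prod (𝓡 m)) (𝓡 n) ∞ fun z : ℝ × M => Φ z.1 z.2)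
    {Ω : Set M} (hΩ : IsCompact Ω) (hΩU : Ω ⊆ U) (h0 : ∀ x ∈ Ω, Φ 0 x ∈ V) :
    HasDerivAt (fun t => bienergy (m := m) (n := n) (Φ t) Ω)
      (∫ x in Ω, ∑ a, tensionComp e c ε c' Φ a 0 x *
        deriv (fun t => tensionComp e c ε c' Φ a t x) 0 ∂(riemannianVolume m M)) 0 := by
  obtain ⟨δ, hδ, hmem⟩ := exists_forall_mem_of_isCompact hΦ.continuous hΩ hfr'.isOpen h0
  have hJ : ∀ t ∈ Set.Icc (-δ) δ, ∀ x ∈ Ω, ∀ a,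
      JointSmoothAt (m := m) (tensionComp e c ε c' Φ a) t x := fun t ht x hx a =>
    jointSmoothAt_tensionComp hfr hfr' hΦ (hΩU hx) (hmem t ht x hx) a
  have hz : (0 : ℝ) ∈ Set.Icc (-δ) δ := ⟨by linarith, hδ.le⟩
  have h1 := hasDerivAt_setIntegral_of_jointSmoothAt hΩ (hfr.measure_lt_top hΩ hΩU) hδ
    (G := fun t x => ∑ a, 1 / 2 * (tensionComp e c ε c' Φ a t x * tensionComp e c ε c' Φ a t x))
    (fun t ht x hx => JointSmoothAt.sum _ fun a _ =>
      (JointSmoothAt.of_space contMDiffAt_const t).mul ((hJ t ht x hx a).mul (hJ t ht x hx a)))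
  have h2 : ∫ x in Ω, deriv (fun t => ∑ a, 1 / 2 * (tensionComp e c ε c' Φ a t x *
      tensionComp e c ε c' Φ a t x)) 0 ∂(riemannianVolume m M) =
      ∫ x in Ω, ∑ a, tensionComp e c ε c' Φ a 0 x *
        deriv (fun t => tensionComp e c ε c' Φ a t x) 0 ∂(riemannianVolume m M) := by
    refine setIntegral_congr_fun hΩ.isClosed.measurableSet fun x hx => ?_
    have hd := fun a => (hJ 0 hz x hx a).hasDerivAt
    refine ((HasDerivAt.fun_sum fun a _ =>
      ((hd a).fun_mul (hd a)).const_mul (1 / 2 : ℝ)).deriv).trans ?_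
    exact Finset.sum_congr rfl fun a _ => by ring
  rw [h2] at h1
  refine h1.congr_of_eventuallyEq ?_
  filter_upwards [Icc_mem_nhds (by linarith : -δ < 0) hδ] with t ht
  rw [bienergy, ← integral_const_mul]
  refine setIntegral_congr_fun hΩ.isClosed.measurableSet fun x hx => ?_
  simp only [tensionNormSq_variation hfr hfr' hΦ (hΩU hx) (hmem t ht x hx), Finset.mul_sum, pow_two]

end FirstVariation

/-! ### Riemannian submersions from a three-manifold to a surface -/

section Submersion

open MeasureTheory

/-- The structure functions of an adapted frame of a Riemannian submersion. -/
noncomputable def submersionCoeff {M : Type*} (f₁ f₂ κ₁ κ₂ σ : M → ℝ) (a b d : Fin 3) (x : M) : ℝ :=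
  ![![![0, 0, 0], ![f₁ x, f₂ x, -(2 * σ x)], ![0, 0, κ₁ x]],
    ![![-f₁ x, -f₂ x, 2 * σ x], ![0, 0, 0], ![0, 0, κ₂ x]],
    ![![0, 0, -κ₁ x], ![0, 0, -κ₂ x], ![0, 0, 0]]] a b d

/-- Both sides are the negative divergence of e_d: the trace of the connection in the tension field
is the same trace that occurs in the divergence theorem. -/
theorem sum_connCoeff_submersionCoeff {M : Type*} (f₁ f₂ κ₁ κ₂ σ : M → ℝ) (d : Fin 3) (x : M) :
    ∑ s, connCoeff (submersionCoeff f₁ f₂ κ₁ κ₂ σ) s s d x =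
      ∑ j, submersionCoeff f₁ f₂ κ₁ κ₂ σ d j j x := by
  fin_cases d <;> simp [connCoeff, submersionCoeff, Fin.sum_univ_three] <;> ring

/-- The function σ drops out of these traces, which are all that the variation needs from the source
connection; hence σ is absent from both equations. -/
theorem sum_submersionCoeff {M : Type*} (f₁ f₂ κ₁ κ₂ σ : M → ℝ) (d : Fin 3) (x : M) :
    ∑ j, submersionCoeff f₁ f₂ κ₁ κ₂ σ d j j x = ![f₂ x + κ₁ x, -f₁ x + κ₂ x, 0] d := by
  fin_cases d <;> simp [submersionCoeff, Fin.sum_univ_three]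

variable {M : Type*} [TopologicalSpace M] [ChartedSpace (EuclideanSpace ℝ (Fin 3)) M]
  {N : Type*} [TopologicalSpace N] [ChartedSpace (EuclideanSpace ℝ (Fin 2)) N]
  {F₁ F₂ : N → ℝ} {κ₁ κ₂ σ : M → ℝ} {e : Fin 3 → (x : M) → TangentSpace (𝓡 3) x}

theorem frameTension_zero {f₁ f₂ : M → ℝ} (φ : M → N) (A : Fin 3 → Fin 2 → M → ℝ) (x : M) :
    frameTension e (submersionCoeff f₁ f₂ κ₁ κ₂ σ) (surfaceCoeff ![F₁, F₂]) φ A 0 x =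
      ∑ s, (dirDeriv (e s) (A s 0) x +
        (F₁ (φ x) * A s 0 x + F₂ (φ x) * A s 1 x) * A s 1 x) -
      ∑ r, (∑ j, submersionCoeff f₁ f₂ κ₁ κ₂ σ r j j x) * A r 0 x := by
  simp only [← sum_connCoeff_submersionCoeff, frameTension, Finset.sum_sub_distrib,
    connCoeff_surfaceCoeff, Finset.sum_mul]
  rw [Finset.sum_comm (s := (Finset.univ : Finset (Fin 3)))]
  congr 1
  refine Finset.sum_congr rfl fun s _ => ?_
  simp [Fin.sum_univ_two]
  ring

theorem frameTension_one {f₁ f₂ : M → ℝ} (φ : M → N) (A : Fin 3 → Fin 2 → M → ℝ) (x : M) :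
    frameTension e (submersionCoeff f₁ f₂ κ₁ κ₂ σ) (surfaceCoeff ![F₁, F₂]) φ A 1 x =
      ∑ s, (dirDeriv (e s) (A s 1) x -
        (F₁ (φ x) * A s 0 x + F₂ (φ x) * A s 1 x) * A s 0 x) -
      ∑ r, (∑ j, submersionCoeff f₁ f₂ κ₁ κ₂ σ r j j x) * A r 1 x := by
  simp only [← sum_connCoeff_submersionCoeff, frameTension, Finset.sum_sub_distrib,
    connCoeff_surfaceCoeff, Finset.sum_mul]
  rw [Finset.sum_comm (s := (Finset.univ : Finset (Fin 3)))]
  congr 1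
  rw [← Finset.sum_sub_distrib]
  refine Finset.sum_congr rfl fun s _ => ?_
  simp [Fin.sum_univ_two]
  ring

variable [IsManifold (𝓡 3) ∞ M] [RiemannianBundle (fun x : M => TangentSpace (𝓡 3) x)]
  [IsManifold (𝓡 2) ∞ N] [RiemannianBundle (fun y : N => TangentSpace (𝓡 2) y)]
  {ψ : M → N} {U : Set M} {V : Set N} {ε : Fin 2 → (y : N) → TangentSpace (𝓡 2) y}

theorem IsIntegrabilityData.isFrame_base (hframe : IsAdaptedFrame ψ U V e ε)
    (hdata : IsIntegrabilityData ψ U V e ε F₁ F₂ κ₁ κ₂ σ) :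
    IsFrame V ε (surfaceCoeff ![F₁, F₂]) where
  isOpen := hframe.isOpen_target
  smooth a x hx := (hframe.smooth_base a).contMDiffAt (hframe.isOpen_target.mem_nhds hx)
  orthonormal := hframe.orthonormal_base
  smooth_coeff a b d x hx := by
    refine contMDiffAt_const_mul _ ?_
    fin_cases d
    · exact hdata.smooth_F₁.contMDiffAt (hframe.isOpen_target.mem_nhds hx)
    · exact hdata.smooth_F₂.contMDiffAt (hframe.isOpen_target.mem_nhds hx)
  bracket a b x hx := by
    have h := hdata.bracket_base x hx
    have h' : VectorField.mlieBracket (𝓡 2) (ε 1) (ε 0) x = -(F₁ x • ε 0 x + F₂ x • ε 1 x) := by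
      rw [VectorField.mlieBracket_swap_apply, h]
    fin_cases a <;> fin_cases b <;>
      simp [surfaceCoeff, Fin.sum_univ_two, h, h']

theorem IsIntegrabilityData.isFrame (hψ : ContMDiff (𝓡 3) (𝓡 2) ∞ ψ)
    (hframe : IsAdaptedFrame ψ U V e ε)
    (hdata : IsIntegrabilityData ψ U V e ε F₁ F₂ κ₁ κ₂ σ) :
    IsFrame U e (submersionCoeff (F₁ ∘ ψ) (F₂ ∘ ψ) κ₁ κ₂ σ) where
  isOpen := hframe.isOpen_source
  smooth a x hx := (hframe.smooth a).contMDiffAt (hframe.isOpen_source.mem_nhds hx)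
  orthonormal := hframe.orthonormal
  smooth_coeff a b d x hx := by
    have hU := hframe.isOpen_source.mem_nhds hx
    have hV := hframe.isOpen_target.mem_nhds (hframe.mapsTo hx)
    have h1 : ContMDiffAt (𝓡 3) 𝓘(ℝ, ℝ) ∞ (F₁ ∘ ψ) x :=
      (hdata.smooth_F₁.contMDiffAt hV).comp x hψ.contMDiffAt
    have h2 : ContMDiffAt (𝓡 3) 𝓘(ℝ, ℝ) ∞ (F₂ ∘ ψ) x :=
      (hdata.smooth_F₂.contMDiffAt hV).comp x hψ.contMDiffAt
    have h3 := hdata.smooth_κ₁.contMDiffAt hU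
    have h4 := hdata.smooth_κ₂.contMDiffAt hU
    have h5 := contMDiffAt_const_mul 2 (hdata.smooth_σ.contMDiffAt hU)
    have hneg : ∀ {f : M → ℝ}, ContMDiffAt (𝓡 3) 𝓘(ℝ, ℝ) ∞ f x →
        ContMDiffAt (𝓡 3) 𝓘(ℝ, ℝ) ∞ (fun y => -f y) x := fun hf => by
      simpa using contMDiffAt_const_mul (-1) hf
    fin_cases a <;> fin_cases b <;> fin_cases d <;>
      first
      | exact contMDiffAt_const
      | exact h1
      | exact h2
      | exact h3
      | exact h4
      | exact h5
      | exact hneg h1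
      | exact hneg h2
      | exact hneg h3
      | exact hneg h4
      | exact hneg h5
  bracket a b x hx := by
    have h01 := hdata.bracket_01 x hx
    have h02 := hdata.bracket_02 x hx
    have h12 := hdata.bracket_12 x hx
    have h10 : VectorField.mlieBracket (𝓡 3) (e 1) (e 0) x =
        -(F₁ (ψ x) • e 0 x + F₂ (ψ x) • e 1 x - (2 * σ x) • e 2 x) := by
      rw [VectorField.mlieBracket_swap_apply, h01]
    have h20 : VectorField.mlieBracket (𝓡 3) (e 2) (e 0) x = -(κ₁ x • e 2 x) := by
      rw [VectorField.mlieBracket_swap_apply, h02]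
    have h21 : VectorField.mlieBracket (𝓡 3) (e 2) (e 1) x = -(κ₂ x • e 2 x) := by
      rw [VectorField.mlieBracket_swap_apply, h12]
    fin_cases a <;> fin_cases b <;>
      simp [submersionCoeff, Fin.sum_univ_three, h01, h02, h12, h10, h20, h21] <;> abel

end Submersion

/-! ### The first variation of the bienergy of a Riemannian submersion -/

section SubmersionVariation

open MeasureTheory

variable {M : Type*} [TopologicalSpace M] [ChartedSpace (EuclideanSpace ℝ (Fin 3)) M]
  [IsManifold (𝓡 3) ∞ M] [RiemannianBundle (fun x : M => TangentSpace (𝓡 3) x)]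
  {N : Type*} [TopologicalSpace N] [ChartedSpace (EuclideanSpace ℝ (Fin 2)) N]
  [IsManifold (𝓡 2) ∞ N] [RiemannianBundle (fun y : N => TangentSpace (𝓡 2) y)]
  {ψ : M → N} {U : Set M} {V : Set N}
  {e : Fin 3 → (x : M) → TangentSpace (𝓡 3) x} {ε : Fin 2 → (y : N) → TangentSpace (𝓡 2) y}
  {F₁ F₂ : N → ℝ} {κ₁ κ₂ σ : M → ℝ} {Φ : ℝ → M → N} {x : M}

theorem spaceComp_zero (hframe : IsAdaptedFrame ψ U V e ε) (h0 : Φ 0 = ψ) (hx : x ∈ U)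
    (s : Fin 3) (a : Fin 2) :
    spaceComp e ε Φ s a 0 x = ![![1, 0], ![0, 1], ![0, 0]] s a := by
  have ho := orthonormal_iff_ite.1 (hframe.orthonormal_base _ (hframe.mapsTo hx))
  unfold spaceComp
  rw [h0]
  fin_cases s
  · simp only [Fin.zero_eta, hframe.related_zero x hx]
    rw [ho a 0]
    fin_cases a <;> simp
  · simp only [Fin.mk_one, hframe.related_one x hx]
    rw [ho a 1]
    fin_cases a <;> simp
  · simp only [Fin.reduceFinMk, hframe.vertical x hx, inner_zero_right]
    fin_cases a <;> simp

theorem deriv_spaceComp_zero (hframe : IsAdaptedFrame ψ U V e ε)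
    (hdata : IsIntegrabilityData ψ U V e ε F₁ F₂ κ₁ κ₂ σ)
    (hΦ : ContMDiff (𝓘(ℝ, ℝ).prod (𝓡 3)) (𝓡 2) ∞ fun z : ℝ × M => Φ z.1 z.2) (h0 : Φ 0 = ψ)
    (hx : x ∈ U) (s : Fin 3) (a : Fin 2) :
    deriv (fun t => spaceComp e ε Φ s a t x) 0 = dirDeriv (e s) (timeComp ε Φ a 0) x +
      ![timeComp ε Φ 1 0 x, -timeComp ε Φ 0 0 x, 0] s * ![F₁, F₂] a (ψ x) := by
  have hV : Φ 0 x ∈ V := by rw [h0]; exact hframe.mapsTo hx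
  rw [(hdata.isFrame_base hframe).deriv_spaceComp hΦ hV
    ((hframe.smooth s).contMDiffAt (hframe.isOpen_source.mem_nhds hx)) a]
  simp only [spaceComp_zero hframe h0 hx, Fin.sum_univ_two, surfaceCoeff, h0]
  fin_cases s <;> simp [sub_eq_add_neg]

/-- The components of dψ are constant, so no derivative survives. The target connection contributes
f₂ and the source trace subtracts f₂ + κ₁. -/
theorem tensionComp_zero_zero (hframe : IsAdaptedFrame ψ U V e ε) (h0 : Φ 0 = ψ) (hx : x ∈ U) :
    tensionComp e (submersionCoeff (F₁ ∘ ψ) (F₂ ∘ ψ) κ₁ κ₂ σ) ε (surfaceCoeff ![F₁, F₂]) Φ 0 0 x =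
      -κ₁ x := by
  have hc : ∀ s a, dirDeriv (e s) (spaceComp e ε Φ s a 0) x = 0 := by
    intro s a
    have : spaceComp e ε Φ s a 0 =ᶠ[nhds x] fun _ => ![![1, 0], ![0, 1], ![0, 0]] s a := by
      filter_upwards [hframe.isOpen_source.mem_nhds hx] with y hy
      exact spaceComp_zero hframe h0 hy s a
    rw [dirDeriv_congr this, dirDeriv_const]
  unfold tensionComp
  rw [frameTension_zero]
  simp only [sum_submersionCoeff]
  simp [hc, spaceComp_zero hframe h0 hx, Fin.sum_univ_three, h0]

theorem tensionComp_one_zero (hframe : IsAdaptedFrame ψ U V e ε) (h0 : Φ 0 = ψ) (hx : x ∈ U) :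
    tensionComp e (submersionCoeff (F₁ ∘ ψ) (F₂ ∘ ψ) κ₁ κ₂ σ) ε (surfaceCoeff ![F₁, F₂]) Φ 1 0 x =
      -κ₂ x := by
  have hc : ∀ s a, dirDeriv (e s) (spaceComp e ε Φ s a 0) x = 0 := by
    intro s a
    have : spaceComp e ε Φ s a 0 =ᶠ[nhds x] fun _ => ![![1, 0], ![0, 1], ![0, 0]] s a := by
      filter_upwards [hframe.isOpen_source.mem_nhds hx] with y hy
      exact spaceComp_zero hframe h0 hy s a
    rw [dirDeriv_congr this, dirDeriv_const]
  unfold tensionComp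
  rw [frameTension_one]
  simp only [sum_submersionCoeff]
  simp [hc, spaceComp_zero hframe h0 hx, Fin.sum_univ_three, h0]

/-- The first tension component linearized at the submersion. Keeping `α` folded retains the second
derivatives of the velocity in the form e_s(α_s), which the flux can absorb whole. -/
theorem deriv_tensionComp_zero (hψ : ContMDiff (𝓡 3) (𝓡 2) ∞ ψ)
    (hframe : IsAdaptedFrame ψ U V e ε)
    (hdata : IsIntegrabilityData ψ U V e ε F₁ F₂ κ₁ κ₂ σ)
    (hΦ : ContMDiff (𝓘(ℝ, ℝ).prod (𝓡 3)) (𝓡 2) ∞ fun z : ℝ × M => Φ z.1 z.2) (h0 : Φ 0 = ψ)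
    (hx : x ∈ U) {v₀ v₁ : M → ℝ} (hv₀ : v₀ = timeComp ε Φ 0 0) (hv₁ : v₁ = timeComp ε Φ 1 0)
    {α : Fin 3 → M → ℝ}
    (hα : ∀ s y, α s y = dirDeriv (e s) v₀ y + ![v₁ y, -v₀ y, 0] s * F₁ (ψ y)) :
    deriv (fun t => tensionComp e (submersionCoeff (F₁ ∘ ψ) (F₂ ∘ ψ) κ₁ κ₂ σ) ε
      (surfaceCoeff ![F₁, F₂]) Φ 0 t x) 0 =
      ∑ s, dirDeriv (e s) (α s) x + F₁ (ψ x) * (dirDeriv (e 0) v₁ x + v₁ x * F₂ (ψ x)) +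
        F₁ (ψ x) * α 1 x + 2 * (F₂ (ψ x) * (dirDeriv (e 1) v₁ x - v₀ x * F₂ (ψ x))) +
        (v₀ x * dirDeriv (ε 0) F₂ (ψ x) + v₁ x * dirDeriv (ε 1) F₂ (ψ x)) -
        ((F₂ (ψ x) + κ₁ x) * α 0 x + (-F₁ (ψ x) + κ₂ x) * α 1 x) := by
  subst hv₀ hv₁
  have hfr' := hdata.isFrame_base hframe
  have hfr := hdata.isFrame hψ hframe
  have hVm : ψ x ∈ V := hframe.mapsTo hx
  have hV : Φ 0 x ∈ V := by rw [h0]; exact hVm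
  have hA := fun s a => hfr'.jointSmoothAt_spaceComp hΦ hV (hfr.smooth s x hx) a
  have hF₁ : ContMDiffAt (𝓡 2) 𝓘(ℝ, ℝ) ∞ F₁ (Φ 0 x) :=
    hdata.smooth_F₁.contMDiffAt (hframe.isOpen_target.mem_nhds hV)
  have hF₂ : ContMDiffAt (𝓡 2) 𝓘(ℝ, ℝ) ∞ F₂ (Φ 0 x) :=
    hdata.smooth_F₂.contMDiffAt (hframe.isOpen_target.mem_nhds hV)
  have hdA : ∀ s, HasDerivAt (fun t => dirDeriv (e s) (spaceComp e ε Φ s 0 t) x)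
      (dirDeriv (e s) (α s) x) 0 := by
    intro s
    have h1 := ((hA s 0).dirDeriv (hfr.smooth s x hx)).hasDerivAt
    rw [(hA s 0).deriv_dirDeriv] at h1
    have h2 : (fun y => deriv (fun t => spaceComp e ε Φ s 0 t y) 0) =ᶠ[nhds x] α s := by
      filter_upwards [hframe.isOpen_source.mem_nhds hx] with y hy
      rw [deriv_spaceComp_zero hframe hdata hΦ h0 hy, hα]
      rfl
    rwa [dirDeriv_congr h2] at h1
  have hd₀ : ∀ s, HasDerivAt (fun t => spaceComp e ε Φ s 0 t x) (α s x) 0 := by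
    intro s
    have h1 := (hA s 0).hasDerivAt
    rw [deriv_spaceComp_zero hframe hdata hΦ h0 hx] at h1
    rw [hα]
    exact h1
  have hd₁ : ∀ s, HasDerivAt (fun t => spaceComp e ε Φ s 1 t x)
      (dirDeriv (e s) (timeComp ε Φ 1 0) x +
        ![timeComp ε Φ 1 0 x, -timeComp ε Φ 0 0 x, 0] s * F₂ (ψ x)) 0 := by
    intro s
    have h1 := (hA s 1).hasDerivAt
    rw [deriv_spaceComp_zero hframe hdata hΦ h0 hx] at h1
    exact h1
  -- This derivative needs no expansion: it is multiplied by the product of the two components of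
  -- dψ(e_s), which is zero for every s. The derivative of F₂ meets the square of the second
  -- component and survives for s = 1.
  have hdF₁ := (JointSmoothAt.comp_variation hΦ hF₁).hasDerivAt
  have hdF₂ := (JointSmoothAt.comp_variation hΦ hF₂).hasDerivAt
  rw [hfr'.deriv_variation hΦ hV (hF₂.mdifferentiableAt (by simp))] at hdF₂
  unfold tensionComp
  simp only [frameTension_zero, sum_submersionCoeff]
  refine (HasDerivAt.deriv ((HasDerivAt.fun_sum fun s _ => (hdA s).fun_add
    (((hdF₁.fun_mul (hd₀ s)).fun_add (hdF₂.fun_mul (hd₁ s))).fun_mul (hd₁ s))).fun_sub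
    (HasDerivAt.fun_sum fun r _ => (hd₀ r).const_mul _))).trans ?_
  simp only [spaceComp_zero hframe h0 hx, Fin.sum_univ_three,
    Fin.sum_univ_two, h0]
  simp
  ring

end SubmersionVariation

/-! ### The bitension field of a Riemannian submersion -/

section Bitension

open MeasureTheory

variable {M : Type*} [TopologicalSpace M] [ChartedSpace (EuclideanSpace ℝ (Fin 3)) M]
  {N : Type*} [TopologicalSpace N] [ChartedSpace (EuclideanSpace ℝ (Fin 2)) N]
  {ψ : M → N} {U : Set M} {V : Set N}
  {e : Fin 3 → (x : M) → TangentSpace (𝓡 3) x} {ε : Fin 2 → (y : N) → TangentSpace (𝓡 2) y}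
  {F₁ F₂ : N → ℝ} {κ₁ κ₂ σ : M → ℝ} {Φ : ℝ → M → N} {x : M}

/-- The components in the frame `ε` of the bitension field of a Riemannian submersion with
`κ₂ = 0`. -/
noncomputable def bitension [RiemannianBundle (fun x : M => TangentSpace (𝓡 3) x)]
    [RiemannianBundle (fun y : N => TangentSpace (𝓡 2) y)] (ψ : M → N)
    (e : Fin 3 → (x : M) → TangentSpace (𝓡 3) x) (κ f₁ f₂ : M → ℝ) : Fin 2 → M → ℝ :=
  ![fun x => -laplacian (m := 3) κ x + κ x * (-gaussCurvature (ψ x) + f₁ x ^ 2 + f₂ x ^ 2),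
    fun x => f₁ x * dirDeriv (e 0) κ x + dirDeriv (e 0) (fun z => κ z * f₁ z) x
      + f₂ x * dirDeriv (e 1) κ x + dirDeriv (e 1) (fun z => κ z * f₂ z) x - κ x ^ 2 * f₁ x]

/-- The first component of the derivative of `dψ (e i)` along a variation with velocity
`v 0 • ε 0 + v 1 • ε 1`. -/
noncomputable def variationComp (e : Fin 3 → (x : M) → TangentSpace (𝓡 3) x) (f₁ : M → ℝ)
    (v : Fin 2 → M → ℝ) (i : Fin 3) (x : M) : ℝ :=
  dirDeriv (e i) (v 0) x + ![v 1 x, -v 0 x, 0] i * f₁ x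

/-- The components of the vector field whose divergence is the difference of the first variation
of the bienergy density and the pairing of the velocity with the bitension field. -/
noncomputable def flux (e : Fin 3 → (x : M) → TangentSpace (𝓡 3) x) (κ f₁ f₂ : M → ℝ)
    (v : Fin 2 → M → ℝ) (i : Fin 3) (x : M) : ℝ :=
  v 0 x * dirDeriv (e i) κ x - κ x * variationComp e f₁ v i x -
    (![κ x * f₁ x, 0, 0] i * v 1 x + (![0, κ x * f₁ x, 0] i * v 0 x +
      ![0, 2 * (κ x * f₂ x), 0] i * v 1 x))

theorem contMDiffAt_vec_three {a b c : M → ℝ} (ha : ContMDiffAt (𝓡 3) 𝓘(ℝ, ℝ) ∞ a x)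
    (hb : ContMDiffAt (𝓡 3) 𝓘(ℝ, ℝ) ∞ b x) (hc : ContMDiffAt (𝓡 3) 𝓘(ℝ, ℝ) ∞ c x) (i : Fin 3) :
    ContMDiffAt (𝓡 3) 𝓘(ℝ, ℝ) ∞ (fun y => ![a y, b y, c y] i) x := by
  fin_cases i
  exacts [ha, hb, hc]

variable [IsManifold (𝓡 3) ∞ M]

theorem contMDiffAt_variationComp (he : ∀ i, ContMDiffAt (𝓡 3) (𝓡 3).tangent ∞
      (fun x => (⟨x, e i x⟩ : TangentBundle (𝓡 3) M)) x) {f₁ : M → ℝ} {v : Fin 2 → M → ℝ}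
    (hf₁ : ContMDiffAt (𝓡 3) 𝓘(ℝ, ℝ) ∞ f₁ x)
    (hv : ∀ a, ContMDiffAt (𝓡 3) 𝓘(ℝ, ℝ) ∞ (v a) x) (i : Fin 3) :
    ContMDiffAt (𝓡 3) 𝓘(ℝ, ℝ) ∞ (variationComp e f₁ v i) x :=
  contMDiffAt_add (contMDiffAt_dirDeriv (hv 0) (he i)) (contMDiffAt_mul
    (contMDiffAt_vec_three (hv 1) (by simpa using contMDiffAt_const_mul (-1) (hv 0))
      contMDiffAt_const i) hf₁)

theorem contMDiffAt_flux (he : ∀ i, ContMDiffAt (𝓡 3) (𝓡 3).tangent ∞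
      (fun x => (⟨x, e i x⟩ : TangentBundle (𝓡 3) M)) x) {κ f₁ f₂ : M → ℝ} {v : Fin 2 → M → ℝ}
    (hκ : ContMDiffAt (𝓡 3) 𝓘(ℝ, ℝ) ∞ κ x) (hf₁ : ContMDiffAt (𝓡 3) 𝓘(ℝ, ℝ) ∞ f₁ x)
    (hf₂ : ContMDiffAt (𝓡 3) 𝓘(ℝ, ℝ) ∞ f₂ x)
    (hv : ∀ a, ContMDiffAt (𝓡 3) 𝓘(ℝ, ℝ) ∞ (v a) x) (i : Fin 3) :
    ContMDiffAt (𝓡 3) 𝓘(ℝ, ℝ) ∞ (flux e κ f₁ f₂ v i) x := by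
  have h1 := contMDiffAt_mul hκ hf₁
  have h2 := contMDiffAt_const_mul 2 (contMDiffAt_mul hκ hf₂)
  exact contMDiffAt_sub (contMDiffAt_sub (contMDiffAt_mul (hv 0) (contMDiffAt_dirDeriv hκ (he i)))
    (contMDiffAt_mul hκ (contMDiffAt_variationComp he hf₁ hv i)))
    (contMDiffAt_add
      (contMDiffAt_mul (contMDiffAt_vec_three h1 contMDiffAt_const contMDiffAt_const i) (hv 1))
      (contMDiffAt_add
        (contMDiffAt_mul (contMDiffAt_vec_three contMDiffAt_const h1 contMDiffAt_const i) (hv 0))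
        (contMDiffAt_mul (contMDiffAt_vec_three contMDiffAt_const h2 contMDiffAt_const i) (hv 1))))

theorem dirDeriv_flux (he : ∀ i, ContMDiffAt (𝓡 3) (𝓡 3).tangent ∞
      (fun x => (⟨x, e i x⟩ : TangentBundle (𝓡 3) M)) x) {κ f₁ f₂ : M → ℝ} {v : Fin 2 → M → ℝ}
    (hκ : ContMDiffAt (𝓡 3) 𝓘(ℝ, ℝ) ∞ κ x) (hf₁ : ContMDiffAt (𝓡 3) 𝓘(ℝ, ℝ) ∞ f₁ x)
    (hf₂ : ContMDiffAt (𝓡 3) 𝓘(ℝ, ℝ) ∞ f₂ x)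
    (hv : ∀ a, ContMDiffAt (𝓡 3) 𝓘(ℝ, ℝ) ∞ (v a) x) (i : Fin 3) :
    dirDeriv (e i) (flux e κ f₁ f₂ v i) x =
      (v 0 x * dirDeriv (e i) (dirDeriv (e i) κ) x + dirDeriv (e i) κ x * dirDeriv (e i) (v 0) x) -
      (κ x * dirDeriv (e i) (variationComp e f₁ v i) x +
        variationComp e f₁ v i x * dirDeriv (e i) κ x) -
      (![κ x * f₁ x * dirDeriv (e 0) (v 1) x +
          v 1 x * (κ x * dirDeriv (e 0) f₁ x + f₁ x * dirDeriv (e 0) κ x),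
        κ x * f₁ x * dirDeriv (e 1) (v 0) x +
          v 0 x * (κ x * dirDeriv (e 1) f₁ x + f₁ x * dirDeriv (e 1) κ x) +
        (2 * (κ x * f₂ x) * dirDeriv (e 1) (v 1) x +
          v 1 x * (2 * (κ x * dirDeriv (e 1) f₂ x + f₂ x * dirDeriv (e 1) κ x))), 0] i) := by
  have h1 := contMDiffAt_mul hκ hf₁
  have h2 := contMDiffAt_mul hκ hf₂
  have h3 := contMDiffAt_const_mul 2 h2
  have h4 := contMDiffAt_vec_three h1 contMDiffAt_const contMDiffAt_const (c := fun _ => 0)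
    (b := fun _ => 0) i
  have h5 := contMDiffAt_vec_three contMDiffAt_const h1 contMDiffAt_const (c := fun _ => 0)
    (a := fun _ => 0) i
  have h6 := contMDiffAt_vec_three contMDiffAt_const h3 contMDiffAt_const (c := fun _ => 0)
    (a := fun _ => 0) i
  have hD := contMDiffAt_dirDeriv hκ (he i)
  have hα := contMDiffAt_variationComp he hf₁ hv i
  unfold flux
  rw [dirDeriv_sub (contMDiffAt_sub (contMDiffAt_mul (hv 0) hD) (contMDiffAt_mul hκ hα))
      (contMDiffAt_add (contMDiffAt_mul h4 (hv 1)) (contMDiffAt_add (contMDiffAt_mul h5 (hv 0))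
        (contMDiffAt_mul h6 (hv 1)))),
    dirDeriv_sub (contMDiffAt_mul (hv 0) hD) (contMDiffAt_mul hκ hα),
    dirDeriv_add (contMDiffAt_mul h4 (hv 1)) (contMDiffAt_add (contMDiffAt_mul h5 (hv 0))
        (contMDiffAt_mul h6 (hv 1))),
    dirDeriv_add (contMDiffAt_mul h5 (hv 0)) (contMDiffAt_mul h6 (hv 1)),
    dirDeriv_mul (hv 0) hD, dirDeriv_mul hκ hα, dirDeriv_mul h4 (hv 1), dirDeriv_mul h5 (hv 0),
    dirDeriv_mul h6 (hv 1)]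
  have h7 := fun X => dirDeriv_mul hκ hf₁ X
  have h8 := fun X => dirDeriv_mul hκ hf₂ X
  have h9 := fun X => dirDeriv_const_mul 2 h2 X
  fin_cases i
  · simp [h7, dirDeriv_const]
    ring
  · simp [h7, h8, h9, dirDeriv_const]
    ring
  · simp [dirDeriv_const]
    ring

variable [RiemannianBundle (fun x : M => TangentSpace (𝓡 3) x)]
  [IsManifold (𝓡 2) ∞ N] [RiemannianBundle (fun y : N => TangentSpace (𝓡 2) y)]

theorem dirDeriv_comp_submersion (hψ : ContMDiff (𝓡 3) (𝓡 2) ∞ ψ)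
    (hframe : IsAdaptedFrame ψ U V e ε) (hx : x ∈ U) {f : N → ℝ}
    (hf : ContMDiffOn (𝓡 2) 𝓘(ℝ, ℝ) ∞ f V) :
    dirDeriv (e 0) (f ∘ ψ) x = dirDeriv (ε 0) f (ψ x) ∧
      dirDeriv (e 1) (f ∘ ψ) x = dirDeriv (ε 1) f (ψ x) := by
  have hf' : MDifferentiableAt (𝓡 2) 𝓘(ℝ, ℝ) f (ψ x) :=
    (hf.contMDiffAt (hframe.isOpen_target.mem_nhds (hframe.mapsTo hx))).mdifferentiableAt (by simp)
  have hψ' : MDifferentiableAt (𝓡 3) (𝓡 2) ψ x := hψ.mdifferentiableAt (by simp)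
  have h0 := dirDeriv_comp_map (ε := ε) (X := e 0) (A := ![1, 0]) hψ'
    (by simp [Fin.sum_univ_two, hframe.related_zero x hx]) hf'
  have h1 := dirDeriv_comp_map (ε := ε) (X := e 1) (A := ![0, 1]) hψ'
    (by simp [Fin.sum_univ_two, hframe.related_one x hx]) hf'
  simp only [Fin.sum_univ_two] at h0 h1
  constructor
  · simpa [Function.comp_def] using h0
  · simpa [Function.comp_def] using h1

/-- Integration by parts done pointwise. The part v_0 e_i(κ) - κ α_i of the flux removes the
second-order terms, and its other parts move e_0(v_1), e_1(v_0), e_1(v_1) off the velocity. What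
multiplies the velocity is the bitension once the Laplacian and the Gauss curvature are written in
the frames. -/
theorem tension_mul_deriv_eq (hψ : ContMDiff (𝓡 3) (𝓡 2) ∞ ψ)
    (hframe : IsAdaptedFrame ψ U V e ε)
    (hdata : IsIntegrabilityData ψ U V e ε F₁ F₂ κ₁ κ₂ σ) (hκ₂ : ∀ x ∈ U, κ₂ x = 0)
    (hΦ : ContMDiff (𝓘(ℝ, ℝ).prod (𝓡 3)) (𝓡 2) ∞ fun z : ℝ × M => Φ z.1 z.2) (h0 : Φ 0 = ψ)
    (hx : x ∈ U) :
    -κ₁ x * deriv (fun t => tensionComp e (submersionCoeff (F₁ ∘ ψ) (F₂ ∘ ψ) κ₁ κ₂ σ) ε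
      (surfaceCoeff ![F₁, F₂]) Φ 0 t x) 0 =
    ∑ a, timeComp ε Φ a 0 x * bitension ψ e κ₁ (F₁ ∘ ψ) (F₂ ∘ ψ) a x +
      ∑ i, (dirDeriv (e i) (flux e κ₁ (F₁ ∘ ψ) (F₂ ∘ ψ) (fun a => timeComp ε Φ a 0) i) x -
        (∑ j, submersionCoeff (F₁ ∘ ψ) (F₂ ∘ ψ) κ₁ κ₂ σ i j j x) *
          flux e κ₁ (F₁ ∘ ψ) (F₂ ∘ ψ) (fun a => timeComp ε Φ a 0) i x) := by
  have hfr' := hdata.isFrame_base hframe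
  have hfr := hdata.isFrame hψ hframe
  have hU := hframe.isOpen_source.mem_nhds hx
  have hVm : ψ x ∈ V := hframe.mapsTo hx
  have hV : Φ 0 x ∈ V := by rw [h0]; exact hVm
  have hVo := hframe.isOpen_target.mem_nhds hVm
  have hf₁ : ContMDiffAt (𝓡 3) 𝓘(ℝ, ℝ) ∞ (F₁ ∘ ψ) x :=
    (hdata.smooth_F₁.contMDiffAt hVo).comp x hψ.contMDiffAt
  have hf₂ : ContMDiffAt (𝓡 3) 𝓘(ℝ, ℝ) ∞ (F₂ ∘ ψ) x :=
    (hdata.smooth_F₂.contMDiffAt hVo).comp x hψ.contMDiffAt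
  have hκ := hdata.smooth_κ₁.contMDiffAt hU
  have hv : ∀ a, ContMDiffAt (𝓡 3) 𝓘(ℝ, ℝ) ∞ (timeComp ε Φ a 0) x := fun a =>
    (hfr'.jointSmoothAt_timeComp hΦ hV a).slice
  have he := fun i => hfr.smooth i x hx
  have hK := hfr'.gaussCurvature_eq (fun a y hy => by
    fin_cases a
    · exact hdata.smooth_F₁.contMDiffAt (hframe.isOpen_target.mem_nhds hy)
    · exact hdata.smooth_F₂.contMDiffAt (hframe.isOpen_target.mem_nhds hy)) hVm
  have hΔ := hfr.laplacian_eq hx hκ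
  rw [Finset.sum_sub_distrib, Finset.sum_comm] at hΔ
  simp only [← Finset.sum_mul, sum_connCoeff_submersionCoeff, sum_submersionCoeff] at hΔ
  obtain ⟨d10, d11⟩ := dirDeriv_comp_submersion hψ hframe hx hdata.smooth_F₁
  obtain ⟨-, d21⟩ := dirDeriv_comp_submersion hψ hframe hx hdata.smooth_F₂
  rw [deriv_tensionComp_zero hψ hframe hdata hΦ h0 hx rfl rfl
    (α := variationComp e (F₁ ∘ ψ) fun a => timeComp ε Φ a 0) fun _ _ => rfl]
  simp only [sum_submersionCoeff]
  simp only [dirDeriv_flux he hκ hf₁ hf₂ hv, Fin.sum_univ_three,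
    Fin.sum_univ_two, bitension]
  simp only [Fin.sum_univ_three] at hΔ
  have e1 : dirDeriv (e 0) (fun z => κ₁ z * (F₁ ∘ ψ) z) x = _ := dirDeriv_mul hκ hf₁ (e 0)
  have e2 : dirDeriv (e 1) (fun z => κ₁ z * (F₂ ∘ ψ) z) x = _ := dirDeriv_mul hκ hf₂ (e 1)
  simp only [Matrix.cons_val_zero, Matrix.cons_val_one, hκ₂ x hx, flux] at hΔ ⊢
  rw [e1, e2, hK, hΔ]
  simp only [d10, d11, d21, variationComp]
  simp
  ring

end Bitension

/-! ### The criterion for biharmonicity -/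

section Criterion

open MeasureTheory

/-- In the chart at `q` the map ψ is displaced in the fixed direction `w`, weighted by a bump
function at `x₀` supported in `W`. Off the support nothing moves, so gluing with ψ outside `W` is
smooth. -/
theorem exists_variation {m n : ℕ} {M : Type*} [TopologicalSpace M] [T2Space M]
    [ChartedSpace (EuclideanSpace ℝ (Fin m)) M] [IsManifold (𝓡 m) ∞ M]
    {N : Type*} [TopologicalSpace N] [ChartedSpace (EuclideanSpace ℝ (Fin n)) N]
    [IsManifold (𝓡 n) ∞ N] {ψ : M → N} (hψ : ContMDiff (𝓡 m) (𝓡 n) ∞ ψ) {q : N} {W : Set M}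
    (hW : IsOpen W) (hWq : ∀ x ∈ W, ψ x ∈ (extChartAt (𝓡 n) q).source) {x₀ : M} (hx₀ : x₀ ∈ W)
    (w : EuclideanSpace ℝ (Fin n)) :
    ∃ (Φ : ℝ → M → N) (Ω : Set M) (η : M → ℝ),
      ContMDiff (𝓘(ℝ, ℝ).prod (𝓡 m)) (𝓡 n) ∞ (fun z : ℝ × M => Φ z.1 z.2) ∧ Φ 0 = ψ ∧
      IsCompact Ω ∧ Ω ⊆ W ∧ (∀ t, ∀ x ∉ Ω, Φ t x = ψ x) ∧ Continuous η ∧ (∀ x, 0 ≤ η x) ∧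
      0 < η x₀ ∧ (∀ x ∉ Ω, η x = 0) ∧
      ∀ x ∈ W, ∀ b, deriv (fun t => coord q b (Φ t x)) 0 = η x * w b := by
  classical
  obtain ⟨η, -, hη⟩ := (SmoothBumpFunction.nhds_basis_tsupport (I := 𝓡 m) x₀).mem_iff.1
    (hW.mem_nhds hx₀)
  have hηc : IsCompact (tsupport η) := η.hasCompactSupport
  have hη0 : ∀ x ∉ tsupport η, η x = 0 := fun x hx => image_eq_zero_of_notMem_tsupport hx
  have hKc : IsCompact ((fun x => extChartAt (𝓡 n) q (ψ x)) '' tsupport η) := by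
    refine hηc.image_of_continuousOn fun x hx => ContinuousAt.continuousWithinAt ?_
    exact (continuousAt_extChartAt' (hWq x (hη hx))).comp hψ.continuous.continuousAt
  obtain ⟨δ, hδ, hδK⟩ := hKc.exists_thickening_subset_open (isOpen_extChartAt_target (I := 𝓡 n) q)
    (by
      rintro _ ⟨x, hx, rfl⟩
      exact (extChartAt (𝓡 n) q).map_source (hWq x (hη hx)))
  -- The δ-thickening of the compact image of the support lies in the chart target, and r ‖w‖ < δ
  -- keeps the displacement inside it; the +1 covers w = 0.
  set r : ℝ := δ / (‖w‖ + 1) with hr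
  have hr0 : 0 < r := by positivity
  have hrw : r * ‖w‖ < δ := by
    rw [hr, div_mul_eq_mul_div, div_lt_iff₀ (by positivity)]
    nlinarith [norm_nonneg w]
  -- A variation is defined for every real t. The factor sin t is bounded by 1, so the curve never
  -- leaves the chart, and it has derivative 1 at t = 0.
  set G : ℝ → M → EuclideanSpace ℝ (Fin n) := fun t x =>
    extChartAt (𝓡 n) q (ψ x) + (Real.sin t * (r * η x)) • w with hG
  have hGt : ∀ t, ∀ x ∈ W, G t x ∈ (extChartAt (𝓡 n) q).target := by
    intro t x hx
    by_cases hxη : x ∈ tsupport η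
    · refine hδK (Metric.mem_thickening_iff.2 ⟨_, ⟨x, hxη, rfl⟩, ?_⟩)
      rw [hG, dist_eq_norm, add_sub_cancel_left, norm_smul, norm_mul, norm_mul]
      refine lt_of_le_of_lt ?_ hrw
      refine mul_le_mul_of_nonneg_right ?_ (norm_nonneg w)
      rw [Real.norm_of_nonneg hr0.le, Real.norm_of_nonneg η.nonneg]
      calc ‖Real.sin t‖ * (r * η x) ≤ 1 * (r * 1) :=
            mul_le_mul (Real.abs_sin_le_one t) (mul_le_mul_of_nonneg_left η.le_one hr0.le)
              (mul_nonneg hr0.le η.nonneg) zero_le_one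
        _ = r := by ring
    · simp only [hG, hη0 x hxη, mul_zero, zero_smul, add_zero]
      exact (extChartAt (𝓡 n) q).map_source (hWq x hx)
  set Φ : ℝ → M → N := fun t x => if x ∈ W then (extChartAt (𝓡 n) q).symm (G t x) else ψ x with hΦ
  have hΦW : ∀ t, ∀ x ∈ W, Φ t x = (extChartAt (𝓡 n) q).symm (G t x) := fun t x hx => if_pos hx
  have hΦη : ∀ t, ∀ x ∉ tsupport η, Φ t x = ψ x := by
    intro t x hx
    by_cases hxW : x ∈ W
    · rw [hΦW t x hxW]
      simp only [hG, hη0 x hx, mul_zero, zero_smul, add_zero]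
      exact (extChartAt (𝓡 n) q).left_inv (hWq x hxW)
    · exact if_neg hxW
  refine ⟨Φ, tsupport η, fun x => r * η x, ?_, ?_, hηc, hη, hΦη, continuous_const.mul η.continuous,
    fun x => mul_nonneg hr0.le η.nonneg, ?_, fun x hx => by simp [hη0 x hx], ?_⟩
  · rintro ⟨t, x⟩
    by_cases hx : x ∈ W
    · have h1 : ContMDiffAt 𝓘(ℝ, EuclideanSpace ℝ (Fin n)) (𝓡 n) ∞ (extChartAt (𝓡 n) q).symm
          (G t x) := (contMDiffOn_extChartAt_symm q).contMDiffAt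
            ((isOpen_extChartAt_target q).mem_nhds (hGt t x hx))
      have h2 : ContMDiffAt (𝓘(ℝ, ℝ).prod (𝓡 m)) 𝓘(ℝ, EuclideanSpace ℝ (Fin n)) ∞
          (fun z : ℝ × M => G z.1 z.2) (t, x) := by
        have h3 : ContMDiffAt (𝓘(ℝ, ℝ).prod (𝓡 m)) 𝓘(ℝ, EuclideanSpace ℝ (Fin n)) ∞
            (fun z : ℝ × M => extChartAt (𝓡 n) q (ψ z.2)) (t, x) :=
          ContMDiffAt.comp (t, x) (contMDiffAt_chart (hWq x hx))
            (hψ.contMDiffAt.comp (t, x) contMDiffAt_snd)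
        have h4 : ContMDiffAt (𝓘(ℝ, ℝ).prod (𝓡 m)) 𝓘(ℝ, ℝ) ∞
            (fun z : ℝ × M => Real.sin z.1) (t, x) :=
          ContMDiffAt.comp (t, x) (g := Real.sin) (I' := 𝓘(ℝ, ℝ))
            Real.contDiff_sin.contMDiff.contMDiffAt contMDiffAt_fst
        have h5 : ContMDiffAt (𝓘(ℝ, ℝ).prod (𝓡 m)) 𝓘(ℝ, ℝ) ∞
            (fun z : ℝ × M => η z.2) (t, x) :=
          ContMDiffAt.comp (t, x) η.contMDiff.contMDiffAt contMDiffAt_snd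
        have h6 : ContMDiffAt (𝓘(ℝ, ℝ).prod (𝓡 m)) 𝓘(ℝ, EuclideanSpace ℝ (Fin n)) ∞
            (fun _ : ℝ × M => w) (t, x) := contMDiffAt_const
        exact h3.add ((h4.mul (contMDiffAt_const.mul h5)).smul h6)
      refine (ContMDiffAt.comp (t, x) h1 h2).congr_of_eventuallyEq ?_
      filter_upwards [continuousAt_snd.eventually (hW.mem_nhds hx)] with z hz using hΦW z.1 z.2 hz
    · have hx' : x ∉ tsupport η := fun h => hx (hη h)
      have h1 : ContMDiffAt (𝓘(ℝ, ℝ).prod (𝓡 m)) (𝓡 n) ∞ (fun z : ℝ × M => ψ z.2) (t, x) :=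
        hψ.contMDiffAt.comp (t, x) contMDiffAt_snd
      refine h1.congr_of_eventuallyEq ?_
      filter_upwards [continuousAt_snd.eventually
        ((isClosed_tsupport η).isOpen_compl.mem_nhds hx')] with z hz using hΦη z.1 z.2 hz
  · funext x
    by_cases hx : x ∈ W
    · rw [hΦW 0 x hx]
      simp only [hG, Real.sin_zero, zero_mul, zero_smul, add_zero]
      exact (extChartAt (𝓡 n) q).left_inv (hWq x hx)
    · exact if_neg hx
  · simp [hr0]
  · intro x hx b
    have h1 : (fun t => coord q b (Φ t x)) =
        fun t => extChartAt (𝓡 n) q (ψ x) b + Real.sin t * (r * η x) * w b := by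
      funext t
      unfold coord
      rw [hΦW t x hx, (extChartAt (𝓡 n) q).right_inv (hGt t x hx)]
      rfl
    rw [h1]
    have h2 := (((Real.hasDerivAt_sin 0).mul_const (r * η x)).mul_const (w b)).const_add
      (extChartAt (𝓡 n) q (ψ x) b)
    rw [h2.deriv, Real.cos_zero, one_mul]

variable {M : Type*} [TopologicalSpace M] [ChartedSpace (EuclideanSpace ℝ (Fin 3)) M]
  {N : Type*} [TopologicalSpace N] [ChartedSpace (EuclideanSpace ℝ (Fin 2)) N]
  {ψ : M → N} {U : Set M} {V : Set N}
  {e : Fin 3 → (x : M) → TangentSpace (𝓡 3) x} {ε : Fin 2 → (y : N) → TangentSpace (𝓡 2) y}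
  {F₁ F₂ : N → ℝ} {κ₁ κ₂ σ : M → ℝ} {Φ : ℝ → M → N} {x : M}
  [IsManifold (𝓡 3) ∞ M] [RiemannianBundle (fun x : M => TangentSpace (𝓡 3) x)]
  [IsManifold (𝓡 2) ∞ N] [RiemannianBundle (fun y : N => TangentSpace (𝓡 2) y)]

theorem contMDiffAt_bitension (hψ : ContMDiff (𝓡 3) (𝓡 2) ∞ ψ)
    (hframe : IsAdaptedFrame ψ U V e ε)
    (hdata : IsIntegrabilityData ψ U V e ε F₁ F₂ κ₁ κ₂ σ) (hx : x ∈ U) (a : Fin 2) :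
    ContMDiffAt (𝓡 3) 𝓘(ℝ, ℝ) ∞ (bitension ψ e κ₁ (F₁ ∘ ψ) (F₂ ∘ ψ) a) x := by
  have hfr' := hdata.isFrame_base hframe
  have hfr := hdata.isFrame hψ hframe
  have hU := hframe.isOpen_source.mem_nhds hx
  have hV : ψ x ∈ V := hframe.mapsTo hx
  have hVo := hframe.isOpen_target.mem_nhds hV
  have hf₁ : ContMDiffAt (𝓡 3) 𝓘(ℝ, ℝ) ∞ (F₁ ∘ ψ) x :=
    (hdata.smooth_F₁.contMDiffAt hVo).comp x hψ.contMDiffAt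
  have hf₂ : ContMDiffAt (𝓡 3) 𝓘(ℝ, ℝ) ∞ (F₂ ∘ ψ) x :=
    (hdata.smooth_F₂.contMDiffAt hVo).comp x hψ.contMDiffAt
  have hκ := hdata.smooth_κ₁.contMDiffAt hU
  have he := fun i => hfr.smooth i x hx
  have hD := fun i => contMDiffAt_dirDeriv hκ (he i)
  have hF : ∀ a, ∀ y ∈ V, ContMDiffAt (𝓡 2) 𝓘(ℝ, ℝ) ∞ (![F₁, F₂] a) y := fun a y hy => by
    fin_cases a
    · exact hdata.smooth_F₁.contMDiffAt (hframe.isOpen_target.mem_nhds hy)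
    · exact hdata.smooth_F₂.contMDiffAt (hframe.isOpen_target.mem_nhds hy)
  have hK : ContMDiffAt (𝓡 2) 𝓘(ℝ, ℝ) ∞ (gaussCurvature (N := N)) (ψ x) := by
    have h1 := contMDiffAt_sub (contMDiffAt_sub (contMDiffAt_sub
      (contMDiffAt_dirDeriv (hF 1 _ hV) (hfr'.smooth 0 _ hV))
      (contMDiffAt_dirDeriv (hF 0 _ hV) (hfr'.smooth 1 _ hV)))
      (contMDiffAt_mul (hF 0 _ hV) (hF 0 _ hV))) (contMDiffAt_mul (hF 1 _ hV) (hF 1 _ hV))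
    refine h1.congr_of_eventuallyEq ?_
    filter_upwards [hVo] with y hy
    rw [hfr'.gaussCurvature_eq hF hy]
    ring
  have hKψ : ContMDiffAt (𝓡 3) 𝓘(ℝ, ℝ) ∞ (fun z => gaussCurvature (ψ z)) x :=
    hK.comp x hψ.contMDiffAt
  have hΔ : ContMDiffAt (𝓡 3) 𝓘(ℝ, ℝ) ∞ (laplacian (m := 3) κ₁) x := by
    have h1 := contMDiffAt_sum (Finset.univ : Finset (Fin 3)) fun s _ =>
      contMDiffAt_sub (contMDiffAt_dirDeriv (hD s) (he s))
        (contMDiffAt_sum (Finset.univ : Finset (Fin 3)) fun d _ =>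
          contMDiffAt_mul (hfr.contMDiffAt_connCoeff hx s s d) (hD d))
    refine h1.congr_of_eventuallyEq ?_
    filter_upwards [hU] with y hy
    exact hfr.laplacian_eq hy (hdata.smooth_κ₁.contMDiffAt (hframe.isOpen_source.mem_nhds hy))
  have hsq : ∀ {f : M → ℝ}, ContMDiffAt (𝓡 3) 𝓘(ℝ, ℝ) ∞ f x →
      ContMDiffAt (𝓡 3) 𝓘(ℝ, ℝ) ∞ (fun y => f y ^ 2) x := fun hf => by
    simpa only [pow_two] using contMDiffAt_mul hf hf
  have hneg : ∀ {f : M → ℝ}, ContMDiffAt (𝓡 3) 𝓘(ℝ, ℝ) ∞ f x →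
      ContMDiffAt (𝓡 3) 𝓘(ℝ, ℝ) ∞ (fun y => -f y) x := fun hf => by
    simpa using contMDiffAt_const_mul (-1) hf
  fin_cases a
  · exact contMDiffAt_add (hneg hΔ) (contMDiffAt_mul hκ
      (contMDiffAt_add (contMDiffAt_add (hneg hKψ) (hsq hf₁)) (hsq hf₂)))
  · exact contMDiffAt_sub (contMDiffAt_add (contMDiffAt_add (contMDiffAt_add
      (contMDiffAt_mul hf₁ (hD 0)) (contMDiffAt_dirDeriv (contMDiffAt_mul hκ hf₁) (he 0)))
      (contMDiffAt_mul hf₂ (hD 1))) (contMDiffAt_dirDeriv (contMDiffAt_mul hκ hf₂) (he 1)))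
      (contMDiffAt_mul (hsq hκ) hf₁)

variable [T2Space M] [SecondCountableTopology M] [MeasurableSpace M] [BorelSpace M]

/-- The first variation formula for the bienergy of a Riemannian submersion with `κ₂ = 0`. -/
theorem hasDerivAt_bienergy_submersion (hψ : ContMDiff (𝓡 3) (𝓡 2) ∞ ψ)
    (hframe : IsAdaptedFrame ψ U V e ε)
    (hdata : IsIntegrabilityData ψ U V e ε F₁ F₂ κ₁ κ₂ σ) (hκ₂ : ∀ x ∈ U, κ₂ x = 0)
    (hΦ : ContMDiff (𝓘(ℝ, ℝ).prod (𝓡 3)) (𝓡 2) ∞ fun z : ℝ × M => Φ z.1 z.2) (h0 : Φ 0 = ψ)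
    {Ω : Set M} (hΩ : IsCompact Ω) (hΩU : Ω ⊆ U) (hoff : ∀ t, ∀ x ∉ Ω, Φ t x = ψ x) :
    HasDerivAt (fun t => bienergy (m := 3) (n := 2) (Φ t) Ω)
      (∫ x in Ω, ∑ a, timeComp ε Φ a 0 x * bitension ψ e κ₁ (F₁ ∘ ψ) (F₂ ∘ ψ) a x
        ∂(riemannianVolume 3 M)) 0 := by
  have hfr' := hdata.isFrame_base hframe
  have hfr := hdata.isFrame hψ hframe
  have hV : ∀ x ∈ U, Φ 0 x ∈ V := fun x hx => by rw [h0]; exact hframe.mapsTo hx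
  have h1 := hasDerivAt_bienergy hfr hfr' hΦ hΩ hΩU fun x hx => hV x (hΩU hx)
  have hv : ∀ x ∈ U, ∀ a, ContMDiffAt (𝓡 3) 𝓘(ℝ, ℝ) ∞ (timeComp ε Φ a 0) x := fun x hx a =>
    (hfr'.jointSmoothAt_timeComp hΦ (hV x hx) a).slice
  have hvoff : ∀ a, ∀ x ∉ Ω, timeComp ε Φ a 0 x = 0 := by
    intro a x hx
    have : (fun s => Φ s x) = fun _ => ψ x := funext fun s => hoff s x hx
    unfold timeComp
    rw [this, mfderiv_const]
    exact inner_zero_right _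
  set h := flux e κ₁ (F₁ ∘ ψ) (F₂ ∘ ψ) (fun a => timeComp ε Φ a 0) with hh
  have hhs : ∀ i, ∀ x ∈ U, ContMDiffAt (𝓡 3) 𝓘(ℝ, ℝ) ∞ (h i) x := fun i x hx => by
    have hVo := hframe.isOpen_target.mem_nhds (hframe.mapsTo hx)
    exact contMDiffAt_flux (fun i => hfr.smooth i x hx)
      (hdata.smooth_κ₁.contMDiffAt (hframe.isOpen_source.mem_nhds hx))
      ((hdata.smooth_F₁.contMDiffAt hVo).comp x hψ.contMDiffAt)
      ((hdata.smooth_F₂.contMDiffAt hVo).comp x hψ.contMDiffAt) (hv x hx) i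
  -- The flux contains derivatives of the velocity; these vanish off `Ω` as well because the
  -- complement of `Ω` is open.
  have hhoff : ∀ i, ∀ x ∉ Ω, h i x = 0 := by
    intro i x hx
    have h3 : timeComp ε Φ 0 0 =ᶠ[nhds x] fun _ => 0 := by
      filter_upwards [hΩ.isClosed.isOpen_compl.mem_nhds hx] with y hy using hvoff 0 y hy
    simp only [hh, flux, variationComp, hvoff _ x hx, dirDeriv_congr h3, dirDeriv_const]
    fin_cases i <;> simp
  -- The second tension component is -κ₂ = 0 at t = 0, so its product drops out whatever its time
  -- derivative.
  have hpt : ∀ x ∈ Ω, ∑ a, tensionComp e (submersionCoeff (F₁ ∘ ψ) (F₂ ∘ ψ) κ₁ κ₂ σ) ε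
      (surfaceCoeff ![F₁, F₂]) Φ a 0 x * deriv (fun t => tensionComp e
        (submersionCoeff (F₁ ∘ ψ) (F₂ ∘ ψ) κ₁ κ₂ σ) ε (surfaceCoeff ![F₁, F₂]) Φ a t x) 0 =
      ∑ a, timeComp ε Φ a 0 x * bitension ψ e κ₁ (F₁ ∘ ψ) (F₂ ∘ ψ) a x +
      ∑ i, (dirDeriv (e i) (h i) x -
        (∑ j, submersionCoeff (F₁ ∘ ψ) (F₂ ∘ ψ) κ₁ κ₂ σ i j j x) * h i x) := by
    intro x hx
    rw [← tension_mul_deriv_eq hψ hframe hdata hκ₂ hΦ h0 (hΩU hx), Fin.sum_univ_two,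
      tensionComp_zero_zero hframe h0 (hΩU hx), tensionComp_one_zero hframe h0 (hΩU hx),
      hκ₂ x (hΩU hx)]
    ring
  have hint : ∀ i, IntegrableOn (fun x => dirDeriv (e i) (h i) x -
      (∑ j, submersionCoeff (F₁ ∘ ψ) (F₂ ∘ ψ) κ₁ κ₂ σ i j j x) * h i x) Ω
      (riemannianVolume 3 M) := fun i => by
    refine hfr.integrableOn hΩ hΩU fun x hx => ContinuousAt.continuousWithinAt ?_
    refine (contMDiffAt_dirDeriv (hhs i x hx) (hfr.smooth i x hx)).continuousAt.sub ?_
    exact (contMDiffAt_mul (contMDiffAt_sum Finset.univ fun j _ =>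
      hfr.smooth_coeff i j j x hx) (hhs i x hx)).continuousAt
  rw [setIntegral_congr_fun hΩ.isClosed.measurableSet hpt, integral_add,
    integral_finsetSum _ fun i _ => hint i] at h1
  · simpa only [hfr.integral_divergence hΩ hΩU (hhs _) (hhoff _), Finset.sum_const_zero,
      add_zero] using h1
  · refine hfr.integrableOn hΩ hΩU fun x hx => ContinuousAt.continuousWithinAt ?_
    exact (contMDiffAt_sum (Finset.univ : Finset (Fin 2)) fun a _ =>
      contMDiffAt_mul (hv x hx a) (contMDiffAt_bitension hψ hframe hdata hx a)).continuousAt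
  · exact integrable_finsetSum _ fun i _ => hint i

/-- The fundamental lemma of the calculus of variations: if the bitension is nonzero at a point,
push ψ in its direction near that point, and the first variation becomes strictly positive. -/
theorem isBiharmonicOn_iff_bitension (hψ : ContMDiff (𝓡 3) (𝓡 2) ∞ ψ)
    (hframe : IsAdaptedFrame ψ U V e ε)
    (hdata : IsIntegrabilityData ψ U V e ε F₁ F₂ κ₁ κ₂ σ) (hκ₂ : ∀ x ∈ U, κ₂ x = 0) :
    IsBiharmonicOn (m := 3) (n := 2) ψ U ↔
      ∀ x ∈ U, ∀ a, bitension ψ e κ₁ (F₁ ∘ ψ) (F₂ ∘ ψ) a x = 0 := by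
  have hfr' := hdata.isFrame_base hframe
  have hfr := hdata.isFrame hψ hframe
  set B := bitension ψ e κ₁ (F₁ ∘ ψ) (F₂ ∘ ψ) with hB
  constructor
  · intro hbi x₀ hx₀
    by_contra! hne
    obtain ⟨a₀, ha₀⟩ := hne
    set q := ψ x₀ with hqdef
    have hq : q ∈ (extChartAt (𝓡 2) q).source := mem_extChartAt_source q
    have hqV : q ∈ V := hframe.mapsTo hx₀
    -- `w` holds the coordinates at `q` of the vector with frame components `B` at `x₀`; `u` below
    -- gives the frame components, along ψ, of the field with constant coordinates `w`.
    set w : EuclideanSpace ℝ (Fin 2) := WithLp.toLp 2 fun b =>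
      ∑ c, B c x₀ * dirDeriv (ε c) (coord q b) q with hw
    set u : Fin 2 → M → ℝ := fun a x => ∑ b, w b * frameInv ε q b a (ψ x) with hu
    have hu₀ : ∀ a, u a x₀ = B a x₀ := fun a =>
      (hfr'.eq_sum_frameInv hq hqV (A := fun c => B c x₀) (X := fun b => w b) (fun b => rfl) a).symm
    -- At `x₀` this pairing is the squared length of the bitension, hence positive there and, by
    -- continuity, on a neighbourhood `W`.
    set P : M → ℝ := fun x => ∑ a, u a x * B a x with hP
    have hPc : ∀ x ∈ U, ψ x ∈ (extChartAt (𝓡 2) q).source → ContinuousAt P x := by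
      intro x hx hxq
      refine (contMDiffAt_sum (Finset.univ : Finset (Fin 2)) fun a _ => contMDiffAt_mul
        (contMDiffAt_sum (Finset.univ : Finset (Fin 2)) fun b _ => contMDiffAt_const_mul _ ?_)
        (contMDiffAt_bitension hψ hframe hdata hx a)).continuousAt
      exact (hfr'.contMDiffAt_frameInv hxq (hframe.mapsTo hx) b a).comp x hψ.contMDiffAt
    have hP₀ : 0 < P x₀ := by
      simp only [hP, hu₀]
      exact Finset.sum_pos' (fun a _ => mul_self_nonneg _)
        ⟨a₀, Finset.mem_univ _, mul_self_pos.2 ha₀⟩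
    obtain ⟨W, hWsub, hWo, hx₀W⟩ := mem_nhds_iff.1 (Filter.inter_mem
      (Filter.inter_mem (hframe.isOpen_source.mem_nhds hx₀)
        (hψ.continuous.continuousAt.eventually (source_mem_nhds hq)))
      ((hPc x₀ hx₀ hq).eventually (lt_mem_nhds hP₀)))
    have hWU : ∀ x ∈ W, x ∈ U := fun x hx => (hWsub hx).1.1
    have hWq : ∀ x ∈ W, ψ x ∈ (extChartAt (𝓡 2) q).source := fun x hx => (hWsub hx).1.2
    have hWP : ∀ x ∈ W, 0 < P x := fun x hx => (hWsub hx).2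
    obtain ⟨Φ, Ω, η, hΦ, h0, hΩ, hΩW, hoff, hηc, hη0, hηx₀, hηΩ, hd⟩ :=
      exists_variation hψ hWo hWq hx₀W w
    have hΩU : Ω ⊆ U := fun x hx => hWU x (hΩW hx)
    have hv : ∀ x ∈ W, ∑ a, timeComp ε Φ a 0 x * B a x = η x * P x := by
      intro x hx
      have hV : Φ 0 x ∈ V := by rw [h0]; exact hframe.mapsTo (hWU x hx)
      have hxq := hWq x hx
      have h1 : ∀ b, η x * w b = ∑ a, timeComp ε Φ a 0 x * dirDeriv (ε a) (coord q b) (ψ x) := by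
        intro b
        rw [← hd x hx b, hfr'.deriv_variation hΦ hV (by
          rw [h0]; exact (contMDiffAt_coord hxq b).mdifferentiableAt (by simp)), h0]
      have h2 := hfr'.eq_sum_frameInv hxq (hframe.mapsTo (hWU x hx)) h1
      rw [hP, Finset.mul_sum]
      refine Finset.sum_congr rfl fun a _ => ?_
      rw [h2 a, hu, ← mul_assoc, Finset.mul_sum]
      simp only [mul_assoc]
    have h1 := hasDerivAt_bienergy_submersion hψ hframe hdata hκ₂ hΦ h0 hΩ hΩU hoff
    have h2 := h1.unique (hbi Ω hΩ hΩU Φ hΦ h0 hoff)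
    rw [setIntegral_congr_fun hΩ.isClosed.measurableSet fun x hx => hv x (hΩW hx)] at h2
    have hint : IntegrableOn (fun x => η x * P x) Ω (riemannianVolume 3 M) := by
      obtain ⟨C, hC⟩ := hΩ.exists_bound_of_continuousOn (f := fun x => η x * P x) fun x hx =>
        (hηc.continuousAt.mul (hPc x (hΩU hx) (hWq x (hΩW hx)))).continuousWithinAt
      exact IntegrableOn.of_bound (hfr.measure_lt_top hΩ hΩU)
        (ContinuousOn.aestronglyMeasurable (fun x hx => (hηc.continuousAt.mul
          (hPc x (hΩU hx) (hWq x (hΩW hx)))).continuousWithinAt) hΩ.isClosed.measurableSet) C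
        ((ae_restrict_iff' hΩ.isClosed.measurableSet).2 (Filter.Eventually.of_forall hC))
    have hnn : 0 ≤ᵐ[(riemannianVolume 3 M).restrict Ω] fun x => η x * P x :=
      (ae_restrict_iff' hΩ.isClosed.measurableSet).2 (Filter.Eventually.of_forall fun x hx =>
        mul_nonneg (hη0 x) (hWP x (hΩW hx)).le)
    -- The integrand is positive on the open set where `η` > 0 inside `W`; that set contains `x₀`
    -- and has positive volume.
    have hpos := (setIntegral_pos_iff_support_of_nonneg_ae hnn hint).2 (by
      refine lt_of_lt_of_le (hfr.measure_pos (S := W ∩ {x | 0 < η x})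
        (hWo.inter (isOpen_lt continuous_const hηc)) (fun x hx => hWU x hx.1)
        (x := x₀) ⟨hx₀W, hηx₀⟩) (measure_mono ?_)
      rintro x ⟨hxW, hxη⟩
      refine ⟨(mul_pos hxη (hWP x hxW)).ne', ?_⟩
      by_contra hxΩ
      exact hxη.ne' (hηΩ x hxΩ))
    exact hpos.ne' h2
  · intro hzero Ω hΩ hΩU Φ hΦ h0 hoff
    have h1 := hasDerivAt_bienergy_submersion hψ hframe hdata hκ₂ hΦ h0 hΩ hΩU hoff
    have h2 : ∫ x in Ω, ∑ a, timeComp ε Φ a 0 x * B a x ∂(riemannianVolume 3 M) = 0 := by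
      rw [setIntegral_congr_fun (g := fun _ => (0 : ℝ)) hΩ.isClosed.measurableSet fun x hx => by
        simp [hzero x (hΩU hx)], integral_zero]
    rwa [← hB, h2] at h1

end Criterion

end RiemSubm

/-! ### The characterization of biharmonicity. -/

theorem corollary2p2
    {M : Type*} [TopologicalSpace M] [T2Space M] [SecondCountableTopology M]
    [ChartedSpace (EuclideanSpace ℝ (Fin 3)) M] [IsManifold (𝓡 3) ∞ M]
    [RiemannianBundle (fun x : M => TangentSpace (𝓡 3) x)]
    [IsContMDiffRiemannianBundle (𝓡 3) ∞ (EuclideanSpace ℝ (Fin 3))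
      (fun x : M => TangentSpace (𝓡 3) x)]
    [MeasurableSpace M] [BorelSpace M]
    {N : Type*} [TopologicalSpace N] [T2Space N] [SecondCountableTopology N]
    [ChartedSpace (EuclideanSpace ℝ (Fin 2)) N] [IsManifold (𝓡 2) ∞ N]
    [RiemannianBundle (fun y : N => TangentSpace (𝓡 2) y)]
    [IsContMDiffRiemannianBundle (𝓡 2) ∞ (EuclideanSpace ℝ (Fin 2))
      (fun y : N => TangentSpace (𝓡 2) y)]
    (ψ : M → N) (hψ : RiemSubm.IsRiemannianSubmersion (m := 3) (n := 2) ψ)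
    (U : Set M) (V : Set N)
    (e : Fin 3 → (x : M) → TangentSpace (𝓡 3) x)
    (ε : Fin 2 → (y : N) → TangentSpace (𝓡 2) y)
    (hframe : RiemSubm.IsAdaptedFrame ψ U V e ε)
    (F₁ F₂ : N → ℝ) (κ₁ κ₂ σ : M → ℝ)
    (hdata : RiemSubm.IsIntegrabilityData ψ U V e ε F₁ F₂ κ₁ κ₂ σ)
    (hκ₂ : ∀ x ∈ U, κ₂ x = 0) (f₁ f₂ : M → ℝ)
    (hf₁ : f₁ = F₁ ∘ ψ) (hf₂ : f₂ = F₂ ∘ ψ) :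
    RiemSubm.IsBiharmonicOn (m := 3) (n := 2) ψ U ↔
      ∀ x ∈ U,
        -RiemSubm.laplacian (m := 3) κ₁ x
            + κ₁ x * (-RiemSubm.gaussCurvature (ψ x) + f₁ x ^ 2 + f₂ x ^ 2) = 0 ∧
        f₁ x * RiemSubm.dirDeriv (e 0) κ₁ x
            + RiemSubm.dirDeriv (e 0) (fun z => κ₁ z * f₁ z) x
            + f₂ x * RiemSubm.dirDeriv (e 1) κ₁ x
            + RiemSubm.dirDeriv (e 1) (fun z => κ₁ z * f₂ z) x
            - κ₁ x ^ 2 * f₁ x = 0 := by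
  rw [RiemSubm.isBiharmonicOn_iff_bitension hψ.smooth hframe hdata hκ₂, hf₁, hf₂]
  -- The two components of `bitension` unfold to the two equations.
  exact forall₂_congr fun x _ => Fin.forall_fin_two
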